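/- Let $N\ge 2$, $m\in\mathbb N$, let $\Omega\subset\mathbb R^N$ be open and bounded, and let $X=(X_1,\dots,X_m)$ be locally Lipschitz vector fields on $\mathbb R^N$. For a $C^1$ function $u$ write $Xu=(X_1u,\dots,X_mu)$. A path $\gamma$ on $[0,T]$ is $X$-subunit if it is absolutely continuous and, for some measurable $\theta:[0,T]\to\mathbb R^m$, $\dot\gamma(t)=\sum_j\theta_j(t)X_j(\gamma(t))$ and $\sum_j\theta_j(t)^2\le1$ for a.e. $t\in[0,T]$. Let $d_X(x,y)$ be the infimum of the $T>0$ for which some $X$-subunit path $\gamma:[0,T]\to\mathbb R^N$ has $\gamma(0)=x$, $\gamma(T)=y$, and for $x\in\Omega$ let $B_r(x)=\{y\in\Omega: d_X(x,y)<r\}$. Assume: (i) any two points of $\Omega$ are joined by an $X$-subunit path with values in $\Omega$; (ii) for every $x\in\Omega$, $d_X(x,y)\to0$ as $|y-x|\to0$, $y\in\Omega$; (iii) $Q>2$ and $0<|B_r(x)|$, $|B_{2r}(x)|\le 2^Q|B_r(x)|$ for all $x\in\Omega$, $r>0$; (iv) there are $C_P,\nu>0$ such that, for all $x\in\Omega$,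 $r>0$ and every $u$ that is $C^1$ in a neighbourhood of $\overline{B_{\nu r}(x)}$ (closure in $\mathbb R^N$), with $u_r$ the mean of $u$ over $B_r(x)$, $$\frac1{|B_r(x)|}\int_{B_r(x)}|u-u_r|\,dx\le C_P\,r\,\frac1{|B_{\nu r}(x)|}\int_{B_{\nu r}(x)}|Xu|\,dx .$$ Let $W^{1,2}_0(\Omega,X)$ be the space of $u\in L^2(\Omega)$ for which there are $V\in L^2(\Omega;\mathbb R^m)$ and $\varphi_n\in C^\infty_c(\Omega)$ with $\varphi_n\to u$ and $X\varphi_n\to V$ in $L^2(\Omega)$; put $Xu=V$. Let $0<\alpha<\beta$ and let $A$ be a bounded measurable function on $\Omega$ with values in the (not necessarily symmetric) real $m\times m$ matrices, with $\alpha|\eta|^2\le A(x)\eta\cdot\eta\le\beta|\eta|^2$ for all $\eta\in\mathbb R^m$ and a.e. $x\in\Omega$. A solution of $$X^*(A(x)Xu)=f\ \text{ in }\Omega,\qquad u=0\ \text{ on }\partial\Omega,$$ is a function $u\in W^{1,2}_0(\Omega,X)$ with $\int_\Omega A\,Xu\cdot Xv\,dx=\int_\Omega f v\,dx$ for all $v\in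 W^{1,2}_0(\Omega,X)$. Let $L^{Q/2,1}(\Omega)$ be the Lorentz space of the measurable $f$ with $$\|f\|_{L^{Q/2,1}(\Omega)}=\int_0^\infty t^{2/Q}f^*(t)\,\frac{dt}t<\infty,\qquad f^*(t)=\inf\{s\ge0:|\{|f|>s\}|\le t\}.$$ Then there is a constant $C>0$, which depends only on $\Omega$, the family $X$ and $Q$, such that for all $\alpha,\beta,A$ as above and all $f\in L^{Q/2,1}(\Omega)$ a solution exists, and every solution $u$ belongs to $L^\infty(\Omega)$ and satisfies $$\|u\|_{L^\infty(\Omega)}\le\frac{C}{\alpha}\,\|f\|_{L^{Q/2,1}(\Omega)} .$$ -/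

import Mathlib

open MeasureTheory Set Filter Topology
open scoped ENNReal Matrix

noncomputable section

/-- `X`-subunit paths in `S`, for the vector fields `X 0, ..., X (m - 1)` on `ℝ^N`: absolutely
continuous `γ : [0, T] → S` with `γ' = ∑ j, θ j • X j (γ)` and `∑ j, θ j ^ 2 ≤ 1` almost everywhere
on `[0, T]`. -/
def IsSubunit {N m : ℕ} (X : Fin m → EuclideanSpace ℝ (Fin N) → EuclideanSpace ℝ (Fin N))
    (S : Set (EuclideanSpace ℝ (Fin N))) (T : ℝ) (γ : ℝ → EuclideanSpace ℝ (Fin N)) : Prop :=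
  AbsolutelyContinuousOnInterval γ 0 T ∧ (∀ t ∈ Icc 0 T, γ t ∈ S) ∧
    ∃ θ : ℝ → Fin m → ℝ, Measurable θ ∧ ∀ᵐ t ∂(volume.restrict (Icc 0 T)),
      ∑ j, θ t j ^ 2 ≤ 1 ∧ HasDerivAt γ (∑ j, θ t j • X j (γ t)) t

/-- Any two points of `Ω` are joined by an `X`-subunit path in `Ω`. -/
def IsXConnected {N m : ℕ} (X : Fin m → EuclideanSpace ℝ (Fin N) → EuclideanSpace ℝ (Fin N))
    (Ω : Set (EuclideanSpace ℝ (Fin N))) : Prop :=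
  ∀ x ∈ Ω, ∀ y ∈ Ω, ∃ T : ℝ, 0 < T ∧ ∃ γ, IsSubunit X Ω T γ ∧ γ 0 = x ∧ γ T = y

/-- The control (Carnot-Carathéodory) distance `d_X`, with values in `[0, ∞]`: the infimum of the
`T > 0` for which an `X`-subunit path `[0, T] → ℝ^N` joins `x` to `y`. -/
def ccDist {N m : ℕ} (X : Fin m → EuclideanSpace ℝ (Fin N) → EuclideanSpace ℝ (Fin N))
    (x y : EuclideanSpace ℝ (Fin N)) : ℝ≥0∞ :=
  sInf {τ : ℝ≥0∞ | ∃ T : ℝ, 0 < T ∧ τ = ENNReal.ofReal T ∧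
    ∃ γ, IsSubunit X univ T γ ∧ γ 0 = x ∧ γ T = y}

/-- The balls of the metric space `(Ω, d_X)`. -/
def ccBall {N m : ℕ} (X : Fin m → EuclideanSpace ℝ (Fin N) → EuclideanSpace ℝ (Fin N))
    (Ω : Set (EuclideanSpace ℝ (Fin N))) (x : EuclideanSpace ℝ (Fin N)) (r : ℝ) :
    Set (EuclideanSpace ℝ (Fin N)) :=
  {y ∈ Ω | ccDist X x y < ENNReal.ofReal r}

/-- The `X`-gradient `X u = (X_1 u, ..., X_m u)` of a differentiable function. -/
def xGrad {N m : ℕ} (X : Fin m → EuclideanSpace ℝ (Fin N) → EuclideanSpace ℝ (Fin N))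
    (u : EuclideanSpace ℝ (Fin N) → ℝ) (x : EuclideanSpace ℝ (Fin N)) :
    EuclideanSpace ℝ (Fin m) :=
  WithLp.toLp 2 fun j => fderiv ℝ u x (X j x)

/-- The Poincaré inequality on the balls of `(Ω, d_X)`, for every `u` which is `C^1` on a
neighbourhood of the (Euclidean) closure of the enlarged ball. -/
def XPoincare {N m : ℕ} (X : Fin m → EuclideanSpace ℝ (Fin N) → EuclideanSpace ℝ (Fin N))
    (Ω : Set (EuclideanSpace ℝ (Fin N))) : Prop :=
  ∃ CP > (0 : ℝ), ∃ ν > (0 : ℝ), ∀ x ∈ Ω, ∀ r > (0 : ℝ),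
    ∀ (W : Set (EuclideanSpace ℝ (Fin N))) (u : EuclideanSpace ℝ (Fin N) → ℝ),
      IsOpen W → closure (ccBall X Ω x (ν * r)) ⊆ W → ContDiffOn ℝ 1 u W →
      ⨍ y in ccBall X Ω x r, |u y - ⨍ z in ccBall X Ω x r, u z| ≤
        CP * r * ⨍ y in ccBall X Ω x (ν * r), ‖xGrad X u y‖

/-- The standing assumptions on the vector fields `X`, the domain `Ω` and the exponent `Q`. -/
structure XAdmissible {N m : ℕ}
    (X : Fin m → EuclideanSpace ℝ (Fin N) → EuclideanSpace ℝ (Fin N))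
    (Ω : Set (EuclideanSpace ℝ (Fin N))) (Q : ℝ) : Prop where
  locallyLipschitz : ∀ j, LocallyLipschitz (X j)
  isOpen : IsOpen Ω
  isBounded : Bornology.IsBounded Ω
  connected : IsXConnected X Ω
  /-- `|y - x| → 0` implies `d_X (x, y) → 0`. -/
  topology : ∀ x ∈ Ω, Tendsto (fun y => ccDist X x y) (𝓝[Ω] x) (𝓝 0)
  two_lt : 2 < Q
  doubling : ∀ x ∈ Ω, ∀ r > (0 : ℝ), 0 < volume (ccBall X Ω x r) ∧
    volume (ccBall X Ω x (2 * r)) ≤ (2 : ℝ≥0∞) ^ Q * volume (ccBall X Ω x r)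
  poincare : XPoincare X Ω

/-- `u ∈ W_0^{1,p}(Ω, X)` with `X`-gradient `V`: `(u, V)` is the limit in `L^p` of `(φ n, X (φ n))`
for a sequence `φ n ∈ C_c^∞(Ω)`. -/
def HasXGradW0 {N m : ℕ} (X : Fin m → EuclideanSpace ℝ (Fin N) → EuclideanSpace ℝ (Fin N))
    (Ω : Set (EuclideanSpace ℝ (Fin N))) (p : ℝ≥0∞) (u : EuclideanSpace ℝ (Fin N) → ℝ)
    (V : EuclideanSpace ℝ (Fin N) → EuclideanSpace ℝ (Fin m)) : Prop :=
  MemLp u p (volume.restrict Ω) ∧ MemLp V p (volume.restrict Ω) ∧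
    ∃ φ : ℕ → EuclideanSpace ℝ (Fin N) → ℝ,
      (∀ n, ContDiff ℝ ((⊤ : ℕ∞) : WithTop ℕ∞) (φ n) ∧ HasCompactSupport (φ n) ∧ tsupport (φ n) ⊆ Ω) ∧
      Tendsto (fun n => eLpNorm (fun x => φ n x - u x) p (volume.restrict Ω)) atTop (𝓝 0) ∧
      Tendsto (fun n => eLpNorm (fun x => xGrad X (φ n) x - V x) p (volume.restrict Ω))
        atTop (𝓝 0)

/-- `A` is a measurable, bounded (not necessarily symmetric) matrix-valued function on `Ω` with
`α |η|² ≤ A(x) η · η ≤ β |η|²` for all `η ∈ ℝ^m`. -/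
structure IsEllipticCoeff {N m : ℕ} (Ω : Set (EuclideanSpace ℝ (Fin N))) (α β : ℝ)
    (A : EuclideanSpace ℝ (Fin N) → Matrix (Fin m) (Fin m) ℝ) : Prop where
  measurable : ∀ i j, AEMeasurable (fun x => A x i j) (volume.restrict Ω)
  bounded : ∃ M : ℝ, ∀ᵐ x ∂(volume.restrict Ω), ∀ i j, |A x i j| ≤ M
  elliptic : ∀ᵐ x ∂(volume.restrict Ω), ∀ η : Fin m → ℝ,
    α * (η ⬝ᵥ η) ≤ (A x *ᵥ η) ⬝ᵥ η ∧ (A x *ᵥ η) ⬝ᵥ η ≤ β * (η ⬝ᵥ η)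

/-- Weak solutions `u ∈ W_0^{1,2}(Ω, X)` of `X^* (A X u) = f` in `Ω`, `u = 0` on `∂Ω`. -/
def IsWeakSolution {N m : ℕ}
    (X : Fin m → EuclideanSpace ℝ (Fin N) → EuclideanSpace ℝ (Fin N))
    (Ω : Set (EuclideanSpace ℝ (Fin N)))
    (A : EuclideanSpace ℝ (Fin N) → Matrix (Fin m) (Fin m) ℝ)
    (f u : EuclideanSpace ℝ (Fin N) → ℝ) : Prop :=
  ∃ V, HasXGradW0 X Ω 2 u V ∧ ∀ v Z, HasXGradW0 X Ω 2 v Z →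
    ∫ x in Ω, (A x *ᵥ (V x).ofLp) ⬝ᵥ (Z x).ofLp = ∫ x in Ω, f x * v x

/-- The decreasing rearrangement `f^*(t) = inf {s ≥ 0 : μ {|f| > s} ≤ t}`. -/
def decRearrangement {E : Type*} [MeasurableSpace E] (μ : Measure E) (f : E → ℝ) (t : ℝ) : ℝ≥0∞ :=
  sInf {s : ℝ≥0∞ | μ {x | s < ‖f x‖ₑ} ≤ ENNReal.ofReal t}

/-- The Lorentz (quasi-)norm `(∫_0^∞ (t^{1/p} f^*(t))^q dt/t)^{1/q}`, for `0 < p, q < ∞`. -/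
def eLorentzNorm {E : Type*} [MeasurableSpace E] (μ : Measure E) (p q : ℝ) (f : E → ℝ) : ℝ≥0∞ :=
  (∫⁻ t in Ioi (0 : ℝ),
    (ENNReal.ofReal (t ^ (1 / p)) * decRearrangement μ f t) ^ q * ENNReal.ofReal (1 / t)) ^ (1 / q)

/-- The Lorentz space `L^{p,q}(μ)`. -/
def MemLorentz {E : Type*} [MeasurableSpace E] (μ : Measure E) (p q : ℝ) (f : E → ℝ) : Prop :=
  AEMeasurable f μ ∧ eLorentzNorm μ p q f < ∞

end

/-! Everything rests on a weak Sobolev inequality with zero boundary values: ∫_E |u| ≤ C |E|^{1/Q}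
∫_Ω |Xu| for u in W_0^{1,2}(Ω, X) and measurable E ⊆ Ω (`exists_sobolev`, `exists_sobolev_W0`).

Bound. Suppose |{u > k}| ≤ t and test the equation with a smooth truncation of u that climbs from 0
to h between the levels k and k + h. Its energy is at most a constant times (h/α) ∫_{u > k} |f| ≤
(h/α) ∫_0^t f^*. If {u > k + h} still had measure above t/2, Sobolev and Cauchy-Schwarz would force
h ≤ (C/α) t^{-(1-2/Q)} ∫_0^t f^*. So the measure of the superlevel set halves each time the level
rises by that amount. Starting from k = 0 and t = |Ω|, the increments at t = |Ω| 2^{-i} add up to at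
most (C/α) ∫ s^{2/Q-1} f^*(s) ds, which is the Lorentz norm. The same holds for -u.

Sobolev. Finite volume and doubling bound the control diameter, so Ω is itself a ball, and averages
over the balls B(x, R 2^{-i}) telescope from the mean over Ω to φ(x). Poincaré on each ball,
integration over E and Tonelli leave the sum of 2^{-i} min(1, c 2^{iQ} |E|/|Ω|), of order
(|E|/|Ω|)^{1/Q}. This controls φ minus its mean. The mean itself is the delicate point: with no
regularity of ∂Ω one must show that the constant 1 is not a limit of test functions φ_n with Xφ_n →
0 in L^1. If it were, the indicator of Ω would be weakly invariant under the flows of all fields Σ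
c_j X_j. A shrinking bump transported along subunit paths then shows that Ω has full measure in a
ball of one fixed radius about each of its points, which contradicts boundedness
(`exists_abs_integral_le`).

Existence. Lax-Milgram applies once v ↦ ∫ f v is continuous on W_0^{1,2}(Ω, X). This follows by
duality from the L^∞ bound, applied with the identity matrix to bounded truncations of f
(`exists_lintegral_mul_le`). -/

/-! ### Subunit paths and the control distance -/

theorem AbsolutelyContinuousOnInterval.norm_sub_le {F : Type*} [NormedAddCommGroup F]
    [InnerProductSpace ℝ F] {γ : ℝ → F} {a b M : ℝ} (hab : a ≤ b)
    (hγ : AbsolutelyContinuousOnInterval γ a b)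
    (h : ∀ᵐ t, t ∈ Icc a b → ∃ w, HasDerivAt γ w t ∧ ‖w‖ ≤ M) :
    ‖γ b - γ a‖ ≤ M * (b - a) := by
  -- Pairing γ with its own increment v gives a real-valued function, to which the fundamental
  -- theorem of calculus applies.
  set v := γ b - γ a with hv
  have hf : AbsolutelyContinuousOnInterval (fun t => inner ℝ v (γ t)) a b := by
    apply squeeze_zero (fun t => ?_) (fun t => ?_) (by simpa using Tendsto.const_mul ‖v‖ hγ)
    · exact Finset.sum_nonneg (fun i hi => by positivity)
    · rw [Finset.mul_sum]
      refine Finset.sum_le_sum fun i _ => ?_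
      rw [dist_eq_norm, dist_eq_norm, ← inner_sub_right]
      exact norm_inner_le_norm _ _
  have h1 := hf.integral_deriv_eq_sub
  have h2 : ‖∫ t in a..b, deriv (fun t => inner ℝ v (γ t)) t‖ ≤ (‖v‖ * M) * |b - a| := by
    apply intervalIntegral.norm_integral_le_of_norm_le_const_ae
    filter_upwards [h] with t ht hmem
    rw [uIoc_of_le hab] at hmem
    obtain ⟨w, hw, hwM⟩ := ht (Ioc_subset_Icc_self hmem)
    have : HasDerivAt (fun t => inner ℝ v (γ t)) (inner ℝ v w) t := by
      simpa using (hasDerivAt_const t v).inner ℝ hw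
    rw [this.deriv]
    exact (norm_inner_le_norm _ _).trans (by gcongr)
  rw [h1, ← inner_sub_right, ← hv, real_inner_self_eq_norm_sq, abs_of_nonneg (sub_nonneg.2 hab),
    Real.norm_of_nonneg (by positivity)] at h2
  rcases (norm_nonneg v).eq_or_lt with h0 | h0
  -- Here v = 0 and only M ≥ 0 is at stake. A nondegenerate interval has positive measure, so the
  -- derivative bound holds at some point of it.
  · rw [← h0]
    rcases hab.eq_or_lt with rfl | hlt
    · simp
    · have : ∃ t, t ∈ Icc a b ∧ ∃ w, HasDerivAt γ w t ∧ ‖w‖ ≤ M := by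
        by_contra! hcon
        have hnull : volume (Icc a b) = 0 := by
          refine measure_mono_null (fun t ht => ?_) h
          simp only [mem_compl_iff, mem_ofPred_eq]
          intro hh
          obtain ⟨w, hw, hwM⟩ := hh ht
          exact absurd hwM (not_le.2 (hcon t ht w hw))
        rw [Real.volume_Icc] at hnull
        simp at hnull
        linarith
      obtain ⟨t, _, w, _, hw⟩ := this
      have := (norm_nonneg w).trans hw
      exact mul_nonneg this (sub_nonneg.2 hab)
  · nlinarith

section Paths

variable {N m : ℕ} {X : Fin m → EuclideanSpace ℝ (Fin N) → EuclideanSpace ℝ (Fin N)}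
  {S : Set (EuclideanSpace ℝ (Fin N))}

theorem norm_control_le {θ : Fin m → ℝ} (hθ : ∑ j, θ j ^ 2 ≤ 1)
    (v : Fin m → EuclideanSpace ℝ (Fin N)) : ‖∑ j, θ j • v j‖ ≤ ∑ j, ‖v j‖ := by
  refine (norm_sum_le _ _).trans (Finset.sum_le_sum fun j _ => ?_)
  rw [norm_smul]
  have h1 : θ j ^ 2 ≤ 1 :=
    (Finset.single_le_sum (f := fun j => θ j ^ 2) (fun i _ => sq_nonneg _)
      (Finset.mem_univ j)).trans hθ
  have h2 : ‖θ j‖ ≤ 1 := by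
    rw [Real.norm_eq_abs]
    exact abs_le_one_iff_mul_self_le_one.2 (by nlinarith)
  exact mul_le_of_le_one_left (norm_nonneg _) h2

theorem IsSubunit.norm_sub_le {T M : ℝ} {γ : ℝ → EuclideanSpace ℝ (Fin N)}
    (h : IsSubunit X S T γ) {s t : ℝ} (hs : 0 ≤ s) (hst : s ≤ t) (ht : t ≤ T)
    (hM : ∀ r ∈ Icc s t, ∑ j, ‖X j (γ r)‖ ≤ M) : ‖γ t - γ s‖ ≤ M * (t - s) := by
  obtain ⟨hac, -, θ, -, hθ⟩ := h
  apply AbsolutelyContinuousOnInterval.norm_sub_le hst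
  · apply hac.mono
    rw [uIcc_of_le hst, uIcc_of_le (hs.trans (hst.trans ht))]
    exact Icc_subset_Icc hs ht
  · rw [ae_restrict_iff' measurableSet_Icc] at hθ
    filter_upwards [hθ] with r hr hmem
    obtain ⟨h1, h2⟩ := hr ⟨hs.trans hmem.1, hmem.2.trans ht⟩
    exact ⟨_, h2, (norm_control_le h1 _).trans (hM r hmem)⟩

theorem IsSubunit.continuousOn {T : ℝ} {γ : ℝ → EuclideanSpace ℝ (Fin N)} (hT : 0 ≤ T)
    (h : IsSubunit X S T γ) : ContinuousOn γ (Icc 0 T) := by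
  have := h.1.continuousOn
  rwa [uIcc_of_le hT] at this

/-- The path has compact image, so it is Lipschitz. Reversed and concatenated paths regain their
absolute continuity from this Lipschitz bound. -/
theorem IsSubunit.exists_speed_bound (hX : ∀ j, Continuous (X j)) {T : ℝ}
    {γ : ℝ → EuclideanSpace ℝ (Fin N)} (hT : 0 ≤ T) (h : IsSubunit X S T γ) :
    ∃ M, ∀ r ∈ Icc 0 T, ∑ j, ‖X j (γ r)‖ ≤ M := by
  have hc : ContinuousOn (fun r => ∑ j, ‖X j (γ r)‖) (Icc 0 T) :=
    continuousOn_finsetSum _ fun j _ => ((hX j).comp_continuousOn (h.continuousOn hT)).norm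
  obtain ⟨M, hM⟩ := isCompact_Icc.exists_bound_of_continuousOn hc
  exact ⟨M, fun r hr => (le_abs_self _).trans (hM r hr)⟩

theorem absolutelyContinuousOnInterval_of_norm_sub_le {F : Type*} [NormedAddCommGroup F]
    {γ : ℝ → F} {T M : ℝ} (hT : 0 ≤ T)
    (h : ∀ s t, 0 ≤ s → s ≤ t → t ≤ T → ‖γ t - γ s‖ ≤ M * (t - s)) :
    AbsolutelyContinuousOnInterval γ 0 T := by
  have : LipschitzOnWith (Real.toNNReal M) γ (uIcc 0 T) := by
    rw [uIcc_of_le hT]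
    apply LipschitzOnWith.of_dist_le_mul
    intro s hs t ht
    wlog hst : s ≤ t generalizing s t
    · rw [dist_comm, dist_comm s]
      exact this t ht s hs (le_of_not_ge hst)
    rw [dist_comm, dist_eq_norm, dist_comm, Real.dist_eq, abs_of_nonneg (sub_nonneg.2 hst)]
    refine (h s t hs.1 hst ht.2).trans ?_
    have := sub_nonneg.2 hst
    gcongr
    exact Real.le_coe_toNNReal M
  exact this.absolutelyContinuousOnInterval

theorem IsSubunit.reverse (hX : ∀ j, Continuous (X j)) {T : ℝ}
    {γ : ℝ → EuclideanSpace ℝ (Fin N)} (hT : 0 ≤ T) (h : IsSubunit X S T γ) :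
    IsSubunit X S T (fun t => γ (T - t)) := by
  obtain ⟨M, hM⟩ := h.exists_speed_bound hX hT
  refine ⟨absolutelyContinuousOnInterval_of_norm_sub_le (M := M) hT fun s t hs hst ht => ?_,
    fun t ht => h.2.1 _ ⟨by linarith [ht.2], by linarith [ht.1]⟩, ?_⟩
  · have := h.norm_sub_le (s := T - t) (t := T - s) (M := M) (by linarith) (by linarith)
      (by linarith) (fun r hr => hM r ⟨by linarith [hr.1], by linarith [hr.2]⟩)
    rw [norm_sub_rev]
    convert this using 1
    ring
  · obtain ⟨-, -, θ, hθm, hθ⟩ := h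
    refine ⟨fun t j => - θ (T - t) j, by
      exact (hθm.comp (measurable_const.sub measurable_id)).neg, ?_⟩
    rw [ae_restrict_iff' measurableSet_Icc] at hθ ⊢
    have := (Measure.measurePreserving_sub_left (volume : Measure ℝ) T).quasiMeasurePreserving.ae hθ
    filter_upwards [this] with t ht hmem
    obtain ⟨h1, h2⟩ := ht ⟨by linarith [hmem.2], by linarith [hmem.1]⟩
    refine ⟨by simpa using h1, ?_⟩
    have h3 : HasDerivAt (fun t => T - t) (-1 : ℝ) t := by
      simpa using (hasDerivAt_id t).const_sub T
    have := h2.scomp t h3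
    simpa [Function.comp_def, Finset.sum_neg_distrib] using this

theorem IsSubunit.concat (hX : ∀ j, Continuous (X j)) {T₁ T₂ : ℝ}
    {γ₁ γ₂ : ℝ → EuclideanSpace ℝ (Fin N)} (hT₁ : 0 ≤ T₁) (hT₂ : 0 ≤ T₂)
    (h₁ : IsSubunit X S T₁ γ₁) (h₂ : IsSubunit X S T₂ γ₂) (heq : γ₁ T₁ = γ₂ 0) :
    IsSubunit X S (T₁ + T₂) (fun t => if t ≤ T₁ then γ₁ t else γ₂ (t - T₁)) := by
  obtain ⟨M₁, hM₁⟩ := h₁.exists_speed_bound hX hT₁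
  obtain ⟨M₂, hM₂⟩ := h₂.exists_speed_bound hX hT₂
  have l1 := fun s t (hs : 0 ≤ s) (hst : s ≤ t) (ht : t ≤ T₁) =>
    h₁.norm_sub_le (M := max M₁ M₂) hs hst ht
      (fun r hr => (hM₁ r ⟨hs.trans hr.1, hr.2.trans ht⟩).trans (le_max_left _ _))
  have l2 := fun s t (hs : 0 ≤ s) (hst : s ≤ t) (ht : t ≤ T₂) =>
    h₂.norm_sub_le (M := max M₁ M₂) hs hst ht
      (fun r hr => (hM₂ r ⟨hs.trans hr.1, hr.2.trans ht⟩).trans (le_max_right _ _))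
  refine ⟨absolutelyContinuousOnInterval_of_norm_sub_le (M := max M₁ M₂) (by linarith)
    fun s t hs hst ht => ?_, fun t ht => ?_, ?_⟩
  · by_cases h : t ≤ T₁
    · simpa [h, hst.trans h] using l1 s t hs hst h
    · by_cases h' : s ≤ T₁
      · simp only [h, h', if_true, if_false]
        push Not at h
        have e1 := l1 s T₁ hs h' le_rfl
        have e2 := l2 0 (t - T₁) le_rfl (by linarith) (by linarith)
        have : γ₂ (t - T₁) - γ₁ s = (γ₂ (t - T₁) - γ₂ 0) + (γ₁ T₁ - γ₁ s) := by rw [heq]; abel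
        rw [this]
        refine (norm_add_le _ _).trans ((add_le_add e2 e1).trans (le_of_eq ?_))
        ring
      · simp only [h, h', if_false]
        push Not at h h'
        have := l2 (s - T₁) (t - T₁) (by linarith) (by linarith) (by linarith)
        simpa using this
  · dsimp only
    split_ifs with h
    · exact h₁.2.1 t ⟨ht.1, h⟩
    · push Not at h
      exact h₂.2.1 _ ⟨by linarith, by linarith [ht.2]⟩
  · obtain ⟨-, -, θ₁, hθm₁, hθ₁⟩ := h₁
    obtain ⟨-, -, θ₂, hθm₂, hθ₂⟩ := h₂
    refine ⟨fun t => if t ≤ T₁ then θ₁ t else θ₂ (t - T₁),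
      Measurable.ite measurableSet_Iic hθm₁ (hθm₂.comp (measurable_id.sub_const _)), ?_⟩
    rw [ae_restrict_iff' measurableSet_Icc] at hθ₁ hθ₂ ⊢
    have h2 := (measurePreserving_sub_right (volume : Measure ℝ) T₁).quasiMeasurePreserving.ae hθ₂
    filter_upwards [hθ₁, h2, Measure.ae_ne volume T₁] with t ht1 ht2 hne hmem
    rcases lt_trichotomy t T₁ with hlt | rfl | hgt
    · obtain ⟨a, b⟩ := ht1 ⟨hmem.1, hlt.le⟩
      simp only [hlt.le, if_true]
      refine ⟨a, b.congr_of_eventuallyEq ?_⟩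
      filter_upwards [Iio_mem_nhds hlt] with s hs
      simp [(mem_Iio.1 hs).le]
    · exact absurd rfl hne
    · obtain ⟨a, b⟩ := ht2 ⟨by linarith, by linarith [hmem.2]⟩
      simp only [not_le.2 hgt, if_false]
      refine ⟨a, (b.comp_sub_const t T₁).congr_of_eventuallyEq ?_⟩
      filter_upwards [Ioi_mem_nhds hgt] with s hs
      simp [not_le.2 (mem_Ioi.1 hs)]

theorem ccDist_lt_iff {x y : EuclideanSpace ℝ (Fin N)} {r : ℝ≥0∞} :
    ccDist X x y < r ↔ ∃ T : ℝ, 0 < T ∧ ENNReal.ofReal T < r ∧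
      ∃ γ, IsSubunit X univ T γ ∧ γ 0 = x ∧ γ T = y := by
  rw [ccDist, sInf_lt_iff]
  constructor
  · rintro ⟨τ, ⟨T, hT, rfl, h⟩, hlt⟩
    exact ⟨T, hT, hlt, h⟩
  · rintro ⟨T, hT, hlt, h⟩
    exact ⟨_, ⟨T, hT, rfl, h⟩, hlt⟩

theorem ccDist_comm (hX : ∀ j, Continuous (X j)) (x y : EuclideanSpace ℝ (Fin N)) :
    ccDist X x y = ccDist X y x := by
  have key : ∀ x y, ccDist X x y ≤ ccDist X y x := fun x y => by
    refine le_of_forall_gt fun r hr => ?_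
    obtain ⟨T, hT, hTr, γ, hγ, h0, h1⟩ := ccDist_lt_iff.1 hr
    exact ccDist_lt_iff.2 ⟨T, hT, hTr, _, hγ.reverse hX hT.le, by simpa using h1, by simpa using h0⟩
  exact le_antisymm (key x y) (key y x)

theorem ccDist_triangle (hX : ∀ j, Continuous (X j)) (x y z : EuclideanSpace ℝ (Fin N)) :
    ccDist X x z ≤ ccDist X x y + ccDist X y z := by
  rw [ccDist.eq_1 X x y, ccDist.eq_1 X y z, ENNReal.sInf_add]
  simp only [ENNReal.add_sInf, le_iInf_iff]
  rintro a ⟨T₁, hT₁, rfl, γ₁, hγ₁, h1, h1'⟩ b ⟨T₂, hT₂, rfl, γ₂, hγ₂, h2, h2'⟩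
  rw [← ENNReal.ofReal_add hT₁.le hT₂.le]
  refine sInf_le ⟨T₁ + T₂, by positivity, rfl, _,
    hγ₁.concat hX hT₁.le hT₂.le hγ₂ (h1'.trans h2.symm), ?_, ?_⟩
  · simp [hT₁.le, h1]
  · simp [hT₂, h2']

/-- Confines a path to a ball up to its exit time, so that bounds valid on the ball can be used
until then. -/
theorem exists_first_hit {f : ℝ → ℝ} {T ε : ℝ} (hf : ContinuousOn f (Icc 0 T)) (hT : 0 ≤ T)
    (h0 : f 0 < ε) (hfT : ε ≤ f T) :
    ∃ t₁ ∈ Ioc 0 T, f t₁ = ε ∧ ∀ r ∈ Ico 0 t₁, f r < ε := by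
  have hcs : IsClosed (Icc 0 T ∩ f ⁻¹' Ici ε) :=
    hf.preimage_isClosed_of_isClosed isClosed_Icc isClosed_Ici
  have hne : (Icc 0 T ∩ f ⁻¹' Ici ε).Nonempty := ⟨T, ⟨hT, le_rfl⟩, hfT⟩
  have hbdd : BddBelow (Icc 0 T ∩ f ⁻¹' Ici ε) := ⟨0, fun t ht => ht.1.1⟩
  obtain ⟨⟨h0', hT'⟩, hε'⟩ := hcs.csInf_mem hne hbdd
  set t₁ := sInf (Icc 0 T ∩ f ⁻¹' Ici ε)
  have hlt : ∀ r ∈ Ico 0 t₁, f r < ε := fun r hr => by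
    by_contra! h
    exact absurd (csInf_le hbdd ⟨⟨hr.1, hr.2.le.trans hT'⟩, h⟩) (not_le.2 hr.2)
  refine ⟨t₁, ⟨h0'.lt_of_ne fun h => ?_, hT'⟩, ?_, hlt⟩
  · rw [← h] at hε'
    exact absurd h0 (not_lt.2 hε')
  · obtain ⟨r, hr, hrε⟩ := intermediate_value_Icc h0' (hf.mono (Icc_subset_Icc_right hT'))
      ⟨h0.le, hε'⟩
    rcases hr.2.eq_or_lt with h | h
    · rw [← h, hrε]
    · exact absurd hrε (hlt r ⟨hr.1, h⟩).ne

/-- Inside the ball of radius ε the speed is at most M, so leaving it takes time at least ε / M.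
Small control balls are therefore small in the Euclidean sense, which makes averages over them
converge to the value at the centre. -/
theorem exists_ccDist_lt_imp_norm_sub_lt (hX : ∀ j, Continuous (X j))
    (x : EuclideanSpace ℝ (Fin N)) {ε : ℝ} (hε : 0 < ε) :
    ∃ δ > (0 : ℝ), ∀ y, ccDist X x y < ENNReal.ofReal δ → ‖y - x‖ < ε := by
  have hc : Continuous fun p => ∑ j, ‖X j p‖ := by fun_prop
  obtain ⟨M, hM⟩ := (isCompact_closedBall x ε).exists_bound_of_continuousOn hc.continuousOn
  have hM0 : 0 ≤ M := (norm_nonneg _).trans (hM x (Metric.mem_closedBall_self hε.le))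
  refine ⟨ε / (M + 1), by positivity, fun y hy => ?_⟩
  obtain ⟨T, hT, hTr, γ, hγ, rfl, rfl⟩ := ccDist_lt_iff.1 hy
  rw [ENNReal.ofReal_lt_ofReal_iff (by positivity), lt_div_iff₀ (by positivity)] at hTr
  by_contra! hcon
  have hcont := hγ.continuousOn hT.le
  obtain ⟨t₁, ⟨ht₁pos, hT'⟩, (hε' : ‖γ t₁ - γ 0‖ = ε), hbefore⟩ := exists_first_hit
    ((hcont.sub continuousOn_const).norm) hT.le (by simpa using hε) hcon
  have h0 := ht₁pos.le
  have hclose : ∀ s ∈ Ico 0 t₁, ‖γ s - γ 0‖ ≤ M * s := fun s hs => by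
    have := hγ.norm_sub_le (M := M) le_rfl hs.1 (hs.2.le.trans hT') (fun r hr => by
      refine (le_abs_self _).trans (hM _ ?_)
      rw [Metric.mem_closedBall, dist_eq_norm]
      exact (hbefore r ⟨hr.1, hr.2.trans_lt hs.2⟩).le)
    simpa using this
  have hlim : ‖γ t₁ - γ 0‖ ≤ M * t₁ := by
    have hnb : (𝓝[Ico 0 t₁] t₁).NeBot := by
      rw [← mem_closure_iff_nhdsWithin_neBot, closure_Ico ht₁pos.ne]
      exact ⟨h0, le_rfl⟩
    have c1 : Tendsto (fun s => ‖γ s - γ 0‖) (𝓝[Ico 0 t₁] t₁) (𝓝 ‖γ t₁ - γ 0‖) :=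
      (((hcont.sub continuousOn_const).norm) t₁ ⟨h0, hT'⟩).mono_left
        (nhdsWithin_mono _ fun s hs => ⟨hs.1, hs.2.le.trans hT'⟩)
    have c2 : Tendsto (fun s => M * s) (𝓝[Ico 0 t₁] t₁) (𝓝 (M * t₁)) :=
      ((continuous_const.mul continuous_id).tendsto t₁).mono_left nhdsWithin_le_nhds
    exact le_of_tendsto_of_tendsto c1 c2 (eventually_of_mem self_mem_nhdsWithin hclose)
  nlinarith

end Paths

/-! ### Control balls: openness, finite diameter, lower volume bound -/

section Balls

variable {N m : ℕ} {X : Fin m → EuclideanSpace ℝ (Fin N) → EuclideanSpace ℝ (Fin N)}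
  {Ω : Set (EuclideanSpace ℝ (Fin N))} {Q : ℝ}

theorem ccBall_subset (x : EuclideanSpace ℝ (Fin N)) (r : ℝ) : ccBall X Ω x r ⊆ Ω := fun _ h => h.1

theorem ccBall_mono (x : EuclideanSpace ℝ (Fin N)) {r s : ℝ} (h : r ≤ s) :
    ccBall X Ω x r ⊆ ccBall X Ω x s :=
  fun _ hy => ⟨hy.1, hy.2.trans_le (ENNReal.ofReal_le_ofReal h)⟩

namespace XAdmissible

theorem continuous (hX : XAdmissible X Ω Q) (j : Fin m) : Continuous (X j) :=
  (hX.locallyLipschitz j).continuous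

theorem ccDist_lt_top (hX : XAdmissible X Ω Q) {x y : EuclideanSpace ℝ (Fin N)} (hx : x ∈ Ω)
    (hy : y ∈ Ω) : ccDist X x y < ∞ := by
  obtain ⟨T, hT, γ, hγ, h0, h1⟩ := hX.connected x hx y hy
  exact ccDist_lt_iff.2 ⟨T, hT, ENNReal.ofReal_lt_top, γ, ⟨hγ.1, fun _ _ => mem_univ _, hγ.2.2⟩,
    h0, h1⟩

/-- Continuity of the distance at the diagonal spreads to all pairs by the triangle inequality.
Joint openness supplies the measurability needed to exchange centre and variable by Tonelli. -/
theorem isOpen_setOf_ccDist_lt (hX : XAdmissible X Ω Q) (r : ℝ≥0∞) :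
    IsOpen {p : EuclideanSpace ℝ (Fin N) × EuclideanSpace ℝ (Fin N) |
      p.1 ∈ Ω ∧ p.2 ∈ Ω ∧ ccDist X p.1 p.2 < r} := by
  rw [isOpen_iff_mem_nhds]
  rintro ⟨x, y⟩ ⟨hx, hy, hlt⟩
  obtain ⟨ε, hε, hεr⟩ : ∃ ε : ℝ≥0∞, 0 < ε ∧ ccDist X x y + ε + ε < r := by
    obtain ⟨s, hs1, hs2⟩ := exists_between hlt
    refine ⟨(s - ccDist X x y) / 2, ENNReal.half_pos (tsub_pos_of_lt hs1).ne', ?_⟩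
    rw [add_assoc, ENNReal.add_halves, add_tsub_cancel_of_le hs1.le]
    exact hs2
  have h1 : {x' | x' ∈ Ω ∧ ccDist X x x' < ε} ∈ 𝓝 x := by
    have := hX.topology x hx (Iio_mem_nhds hε)
    rw [hX.isOpen.nhdsWithin_eq hx] at this
    exact inter_mem (hX.isOpen.mem_nhds hx) this
  have h2 : {y' | y' ∈ Ω ∧ ccDist X y y' < ε} ∈ 𝓝 y := by
    have := hX.topology y hy (Iio_mem_nhds hε)
    rw [hX.isOpen.nhdsWithin_eq hy] at this
    exact inter_mem (hX.isOpen.mem_nhds hy) this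
  filter_upwards [prod_mem_nhds h1 h2]
  rintro ⟨x', y'⟩ ⟨⟨hx', hd⟩, ⟨hy', hd'⟩⟩
  refine ⟨hx', hy', lt_of_le_of_lt ?_ hεr⟩
  calc ccDist X x' y' ≤ ccDist X x' y + ccDist X y y' := ccDist_triangle hX.continuous _ _ _
    _ ≤ (ccDist X x' x + ccDist X x y) + ccDist X y y' := by
        gcongr; exact ccDist_triangle hX.continuous _ _ _
    _ ≤ (ε + ccDist X x y) + ε := by
        gcongr
        · rw [ccDist_comm hX.continuous]; exact hd.le
    _ = ccDist X x y + ε + ε := by rw [add_comm ε]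

theorem isOpen_ccBall (hX : XAdmissible X Ω Q) {x : EuclideanSpace ℝ (Fin N)} (hx : x ∈ Ω)
    (r : ℝ) : IsOpen (ccBall X Ω x r) := by
  have := (hX.isOpen_setOf_ccDist_lt (ENNReal.ofReal r)).preimage (Continuous.prodMk_right x)
  convert this using 1
  ext y
  simp [ccBall, hx]

theorem volume_lt_top (hX : XAdmissible X Ω Q) : volume Ω < ∞ :=
  hX.isBounded.measure_lt_top

theorem volume_ccBall_ne_top (hX : XAdmissible X Ω Q) (x : EuclideanSpace ℝ (Fin N)) (r : ℝ) :
    volume (ccBall X Ω x r) ≠ ∞ :=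
  ((measure_mono (ccBall_subset x r)).trans_lt hX.volume_lt_top).ne

theorem volume_ccBall_two_pow_mul_le (hX : XAdmissible X Ω Q) {x : EuclideanSpace ℝ (Fin N)}
    (hx : x ∈ Ω) {r : ℝ} (hr : 0 < r) (k : ℕ) :
    volume (ccBall X Ω x (2 ^ k * r)) ≤ ((2 : ℝ≥0∞) ^ Q) ^ k * volume (ccBall X Ω x r) := by
  induction k with
  | zero => simp
  | succ k ih =>
    rw [pow_succ', mul_assoc, pow_succ', mul_assoc]
    exact (hX.doubling x hx _ (by positivity)).2.trans (by gcongr)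

/-- Distances in Ω are finite, but their boundedness needs doubling. Some ball B(x, n) nearly
exhausts Ω. A point y far from x would carry a ball disjoint from B(x, n) whose measure is a fixed
fraction of that of B(x, n), and Ω has no room for both. -/
theorem exists_diam (hX : XAdmissible X Ω Q) :
    ∃ R > (0 : ℝ), ∀ x ∈ Ω, ∀ y ∈ Ω, ccDist X x y < ENNReal.ofReal R := by
  rcases Ω.eq_empty_or_nonempty with rfl | ⟨x, hx⟩
  · exact ⟨1, one_pos, by simp⟩
  have hΩ0 : volume Ω ≠ 0 := (hX.isOpen.measure_pos _ ⟨x, hx⟩).ne'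
  -- Two doublings: with r half the distance from x to y and r > n + 1, the ball B(x, n) lies in
  -- B(y, 4r).
  set K : ℝ≥0∞ := ((2 : ℝ≥0∞) ^ Q) ^ 2 with hK
  have hK0 : K ≠ 0 := by
    rw [hK]; exact pow_ne_zero _ (ENNReal.rpow_pos (by norm_num) (by norm_num)).ne'
  have hKt : K ≠ ∞ := by
    rw [hK]
    exact ENNReal.pow_ne_top (ENNReal.rpow_ne_top_of_nonneg (by linarith [hX.two_lt]) (by norm_num))
  obtain ⟨n, hn⟩ : ∃ n : ℕ, volume Ω < (1 + K⁻¹) * volume (ccBall X Ω x n) := by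
    have hmono : Monotone fun n : ℕ => ccBall X Ω x n := fun a b hab =>
      ccBall_mono x (Nat.cast_le.2 hab)
    have hU : ⋃ n : ℕ, ccBall X Ω x n = Ω := by
      refine subset_antisymm (iUnion_subset fun n => ccBall_subset x n) fun y hy => ?_
      obtain ⟨n, hn⟩ := ENNReal.exists_nat_gt (hX.ccDist_lt_top hx hy).ne
      exact mem_iUnion.2 ⟨n, hy, by simpa using hn⟩
    have ht := tendsto_measure_iUnion_atTop (μ := volume) hmono
    rw [hU] at ht
    have ht' := ENNReal.Tendsto.const_mul (a := 1 + K⁻¹) ht (Or.inl hΩ0)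
    have hlt : volume Ω < (1 + K⁻¹) * volume Ω := by
      rw [add_mul, one_mul]
      exact ENNReal.lt_add_right hX.volume_lt_top.ne
        (mul_ne_zero (ENNReal.inv_ne_zero.2 hKt) hΩ0)
    exact (ht'.eventually (lt_mem_nhds hlt)).exists
  have hbd : ∀ y ∈ Ω, ccDist X x y ≤ ENNReal.ofReal (2 * n + 2) := by
    intro y hy
    by_contra! hcon
    set r : ℝ := (ccDist X x y).toReal / 2 with hr
    have hd : ccDist X x y = ENNReal.ofReal (2 * r) := by
      rw [hr, mul_div_cancel₀ _ two_ne_zero, ENNReal.ofReal_toReal (hX.ccDist_lt_top hx hy).ne]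
    have hrn : (n : ℝ) + 1 < r := by
      rw [hd, ENNReal.ofReal_lt_ofReal_iff_of_nonneg (by positivity)] at hcon
      linarith
    have hr0 : 0 < r := by linarith [(Nat.cast_nonneg n : (0 : ℝ) ≤ n)]
    have hdisj : Disjoint (ccBall X Ω x n) (ccBall X Ω y r) := by
      rw [Set.disjoint_left]
      rintro z ⟨-, hz1⟩ ⟨-, hz2⟩
      have h3 := ccDist_triangle hX.continuous x z y
      rw [hd, ccDist_comm hX.continuous z y] at h3
      have h4 := h3.trans (add_le_add hz1.le hz2.le)
      rw [← ENNReal.ofReal_add (by positivity) hr0.le,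
        ENNReal.ofReal_le_ofReal_iff (by positivity)] at h4
      linarith
    have hsub : ccBall X Ω x n ⊆ ccBall X Ω y (2 ^ 2 * r) := by
      rintro z ⟨hz, hz1⟩
      refine ⟨hz, ?_⟩
      calc ccDist X y z ≤ ccDist X y x + ccDist X x z := ccDist_triangle hX.continuous _ _ _
        _ < ENNReal.ofReal (2 * r) + ENNReal.ofReal n := by
            rw [ccDist_comm hX.continuous, hd]
            exact ENNReal.add_lt_add_left ENNReal.ofReal_ne_top hz1
        _ ≤ ENNReal.ofReal (2 ^ 2 * r) := by
            rw [← ENNReal.ofReal_add (by positivity) (by positivity)]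
            exact ENNReal.ofReal_le_ofReal (by linarith)
    have h5 : volume (ccBall X Ω x n) ≤ K * volume (ccBall X Ω y r) :=
      (measure_mono hsub).trans (hX.volume_ccBall_two_pow_mul_le hy hr0 2)
    have h6 : K⁻¹ * volume (ccBall X Ω x n) ≤ volume (ccBall X Ω y r) := by
      rw [mul_comm, ← div_eq_mul_inv]
      exact ENNReal.div_le_of_le_mul' h5
    have h7 : volume (ccBall X Ω x n) + volume (ccBall X Ω y r) ≤ volume Ω := by
      rw [← measure_union hdisj (hX.isOpen_ccBall hy r).measurableSet]
      exact measure_mono (union_subset (ccBall_subset _ _) (ccBall_subset _ _))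
    refine absurd hn (not_lt.2 (le_trans ?_ h7))
    rw [add_mul, one_mul]
    gcongr
  refine ⟨2 * (2 * n + 2) + 1, by positivity, fun y hy z hz => ?_⟩
  calc ccDist X y z ≤ ccDist X y x + ccDist X x z := ccDist_triangle hX.continuous _ _ _
    _ ≤ ENNReal.ofReal (2 * n + 2) + ENNReal.ofReal (2 * n + 2) := by
        rw [ccDist_comm hX.continuous y x]
        exact add_le_add (hbd y hy) (hbd z hz)
    _ < ENNReal.ofReal (2 * (2 * n + 2) + 1) := by
        rw [← ENNReal.ofReal_add (by positivity) (by positivity),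
          ENNReal.ofReal_lt_ofReal_iff (by positivity)]
        linarith

theorem _root_.ccBall_eq_of_forall_ccDist_lt {R : ℝ}
    (hR : ∀ x ∈ Ω, ∀ y ∈ Ω, ccDist X x y < ENNReal.ofReal R) {x : EuclideanSpace ℝ (Fin N)}
    (hx : x ∈ Ω) {r : ℝ} (hr : R ≤ r) : ccBall X Ω x r = Ω :=
  (ccBall_subset x r).antisymm fun y hy =>
    ⟨hy, (hR x hx y hy).trans_le (ENNReal.ofReal_le_ofReal hr)⟩

/-- The lower bound |B(x, R 2^{-i})| ≥ 2^{-iQ} |Ω|, through which Q becomes the dimension in the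
Sobolev inequality. -/
theorem volume_le_volume_ccBall (hX : XAdmissible X Ω Q) {R : ℝ} (hR0 : 0 < R)
    (hR : ∀ x ∈ Ω, ∀ y ∈ Ω, ccDist X x y < ENNReal.ofReal R) {x : EuclideanSpace ℝ (Fin N)}
    (hx : x ∈ Ω) (i : ℕ) :
    volume Ω ≤ ((2 : ℝ≥0∞) ^ Q) ^ i * volume (ccBall X Ω x (R / 2 ^ i)) := by
  have := hX.volume_ccBall_two_pow_mul_le hx (r := R / 2 ^ i) (by positivity) i
  rwa [mul_div_cancel₀ _ (by positivity), ccBall_eq_of_forall_ccDist_lt hR hx le_rfl] at this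

end XAdmissible

end Balls

/-! ### Derivative bounds for the smooth step function -/

namespace Real.smoothTransition

theorem exists_deriv_bound : ∃ M > (0 : ℝ), ∀ x, |deriv Real.smoothTransition x| ≤ M := by
  have hc : Continuous (deriv Real.smoothTransition) :=
    (Real.smoothTransition.contDiff (n := 1)).continuous_deriv le_rfl
  obtain ⟨M, hM⟩ := (isCompact_Icc (a := (0 : ℝ)) (b := 1)).exists_bound_of_continuousOn
    hc.continuousOn
  refine ⟨max M 1, by positivity, fun x => ?_⟩
  by_cases hx : x ∈ Icc (0 : ℝ) 1
  · exact (hM x hx).trans (le_max_left _ _)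
  · have : deriv Real.smoothTransition x = 0 := by
      rw [mem_Icc, not_and_or, not_le, not_le] at hx
      rcases hx with hx | hx
      · have : Real.smoothTransition =ᶠ[𝓝 x] fun _ => 0 := by
          filter_upwards [Iio_mem_nhds hx] with y hy
          exact Real.smoothTransition.zero_of_nonpos (le_of_lt hy)
        rw [this.deriv_eq, deriv_const]
      · have : Real.smoothTransition =ᶠ[𝓝 x] fun _ => 1 := by
          filter_upwards [Ioi_mem_nhds hx] with y hy
          exact Real.smoothTransition.one_of_one_le (le_of_lt hy)
        rw [this.deriv_eq, deriv_const]
    rw [this, abs_zero]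
    positivity

theorem deriv_nonneg (x : ℝ) : 0 ≤ deriv Real.smoothTransition x :=
  Real.smoothTransition.monotone.deriv_nonneg

theorem hasDerivAt (x : ℝ) :
    HasDerivAt Real.smoothTransition (deriv Real.smoothTransition x) x :=
  ((Real.smoothTransition.contDiff (n := 1)).differentiable one_ne_zero x).hasDerivAt

theorem abs_sub_le {M : ℝ} (hM : ∀ x, |deriv Real.smoothTransition x| ≤ M) (x y : ℝ) :
    |Real.smoothTransition x - Real.smoothTransition y| ≤ M * |x - y| := by
  have := Convex.norm_image_sub_le_of_norm_deriv_le (f := Real.smoothTransition) (s := univ)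
    (fun x _ => (hasDerivAt x).differentiableAt) (fun x _ => hM x) convex_univ (mem_univ y)
    (mem_univ x)
  simpa using this

end Real.smoothTransition

/-! ### A shrinking bump carried along a path -/

section MovingBump


variable {E : Type*} [NormedAddCommGroup E]

/-- A smooth bump supported in the ball of centre `γ t` and radius `β ^ (-1/2) * exp (-L * t)`. -/
noncomputable def movingBump (β L : ℝ) (γ : ℝ → E) (t : ℝ) (z : E) : ℝ :=
  Real.smoothTransition (1 - β * Real.exp (2 * L * t) * ‖z - γ t‖ ^ 2)

variable {β L : ℝ} {γ : ℝ → E}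

theorem movingBump_nonneg (t : ℝ) (z : E) : 0 ≤ movingBump β L γ t z :=
  Real.smoothTransition.nonneg _

theorem movingBump_pos_iff {ρ : ℝ} (hρ : 0 < ρ) (t : ℝ) (z : E) :
    0 < movingBump ((ρ ^ 2)⁻¹) L γ t z ↔ ‖z - γ t‖ < ρ * Real.exp (-L * t) := by
  have h1 : 0 < movingBump ((ρ ^ 2)⁻¹) L γ t z ↔
      (ρ ^ 2)⁻¹ * Real.exp (2 * L * t) * ‖z - γ t‖ ^ 2 < 1 := by
    rw [movingBump]
    constructor
    · intro h
      by_contra! hcon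
      rw [Real.smoothTransition.zero_of_nonpos (by linarith)] at h
      exact lt_irrefl _ h
    · intro h
      exact Real.smoothTransition.pos_of_pos (by linarith)
  rw [h1, ← pow_lt_pow_iff_left₀ (norm_nonneg _) (by positivity) two_ne_zero, mul_pow,
    ← Real.exp_nat_mul, mul_assoc, inv_mul_lt_iff₀ (by positivity), mul_one,
    show ((2 : ℕ) : ℝ) * (-L * t) = -(2 * L * t) by push_cast; ring, Real.exp_neg,
    ← div_eq_mul_inv, lt_div_iff₀ (Real.exp_pos _), mul_comm]

theorem movingBump_eq_zero {ρ : ℝ} (hρ : 0 < ρ) {t : ℝ} {z : E}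
    (h : ρ * Real.exp (-L * t) ≤ ‖z - γ t‖) : movingBump ((ρ ^ 2)⁻¹) L γ t z = 0 := by
  by_contra hcon
  exact absurd ((movingBump_pos_iff hρ t z).1
    ((movingBump_nonneg t z).lt_of_ne (Ne.symm hcon))) (not_lt.2 h)

/-- The time increments have a dominating function independent of time and supported in a fixed
ball. It makes the integral of the bump absolutely continuous in t and permits differentiation under
the integral sign. -/
theorem exists_movingBump_lipschitz (hL : 0 ≤ L) {ρ T M : ℝ} (hρ : 0 < ρ) (hT : 0 ≤ T)
    (hM : 0 ≤ M)
    (hγ : ∀ s t, 0 ≤ s → s ≤ t → t ≤ T → ‖γ t - γ s‖ ≤ M * (t - s)) :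
    ∃ C : ℝ, 0 ≤ C ∧ ∀ z, ∀ s t, 0 ≤ s → s ≤ t → t ≤ T →
      |movingBump ((ρ ^ 2)⁻¹) L γ t z - movingBump ((ρ ^ 2)⁻¹) L γ s z| ≤
        (Metric.closedBall (γ 0) (M * T + ρ)).indicator (fun _ => C) z * (t - s) := by
  obtain ⟨M', hM', hσ⟩ := Real.smoothTransition.exists_deriv_bound
  -- For z in the ball of radius M T + ρ about γ 0, D bounds the distance from z to every γ r, since
  -- γ moves by at most M T. For z outside that ball the bump vanishes at all times.
  set D : ℝ := 2 * (M * T) + ρ with hD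
  have hD0 : 0 ≤ D := by positivity
  set β := (ρ ^ 2)⁻¹ with hβ
  have hβ0 : 0 < β := by positivity
  set e := Real.exp (2 * L * T) with he
  refine ⟨M' * (β * (2 * L * e * D ^ 2 + e * (2 * D * M))), by positivity,
    fun z s t hs hst ht => ?_⟩
  have hdist : ∀ r, 0 ≤ r → r ≤ T → ‖γ r - γ 0‖ ≤ M * T := fun r hr hrT => by
    refine (hγ 0 r le_rfl hr hrT).trans ?_
    rw [sub_zero]
    gcongr
  by_cases hz : z ∈ Metric.closedBall (γ 0) (M * T + ρ)
  · rw [indicator_of_mem hz, mul_assoc]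
    refine (Real.smoothTransition.abs_sub_le hσ _ _).trans ?_
    gcongr
    rw [Metric.mem_closedBall, dist_eq_norm] at hz
    have hzr : ∀ r, 0 ≤ r → r ≤ T → ‖z - γ r‖ ≤ D := fun r hr hrT => by
      have := norm_sub_le_norm_sub_add_norm_sub z (γ 0) (γ r)
      rw [norm_sub_rev (γ 0)] at this
      linarith [hdist r hr hrT]
    have e1 : |‖z - γ t‖ ^ 2 - ‖z - γ s‖ ^ 2| ≤ 2 * D * M * (t - s) := by
      rw [sq_sub_sq, abs_mul, abs_of_nonneg (by positivity)]
      have a1 := hzr t (hs.trans hst) ht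
      have a2 := hzr s hs (hst.trans ht)
      have a3 : |‖z - γ t‖ - ‖z - γ s‖| ≤ M * (t - s) := by
        refine (abs_norm_sub_norm_le _ _).trans ?_
        rw [sub_sub_sub_cancel_left, norm_sub_rev]
        exact hγ s t hs hst ht
      have : 0 ≤ M * (t - s) := (abs_nonneg _).trans a3
      have a4 : ‖z - γ t‖ + ‖z - γ s‖ ≤ 2 * D := by linarith
      exact (mul_le_mul a4 a3 (abs_nonneg _) (by positivity)).trans (le_of_eq (by ring))
    have hexp : ∀ r, r ≤ T → Real.exp (2 * L * r) ≤ e := fun r hr => by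
      rw [he]; gcongr
    have e2 : |Real.exp (2 * L * t) - Real.exp (2 * L * s)| ≤ 2 * L * e * (t - s) := by
      rw [abs_of_nonneg (sub_nonneg.2 (by gcongr))]
      have h1 := Real.add_one_le_exp (2 * L * s - 2 * L * t)
      have h2 : Real.exp (2 * L * s) = Real.exp (2 * L * t) *
          Real.exp (2 * L * s - 2 * L * t) := by rw [← Real.exp_add]; ring_nf
      have h3 := hexp t ht
      have h4 : 0 ≤ 2 * L * (t - s) := mul_nonneg (by positivity) (by linarith)
      rw [h2]
      nlinarith [Real.exp_pos (2 * L * t)]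
    have e3 : 1 - β * Real.exp (2 * L * t) * ‖z - γ t‖ ^ 2 -
        (1 - β * Real.exp (2 * L * s) * ‖z - γ s‖ ^ 2) =
        -(β * ((Real.exp (2 * L * t) - Real.exp (2 * L * s)) * ‖z - γ t‖ ^ 2 +
          Real.exp (2 * L * s) * (‖z - γ t‖ ^ 2 - ‖z - γ s‖ ^ 2))) := by ring
    rw [e3, abs_neg, abs_mul, abs_of_pos hβ0]
    refine (mul_le_mul_of_nonneg_left ?_ hβ0.le).trans (le_of_eq (mul_assoc _ _ _).symm)
    refine (abs_add_le _ _).trans ?_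
    rw [abs_mul, abs_mul, abs_of_nonneg (sq_nonneg ‖z - γ t‖), abs_of_pos (Real.exp_pos _), add_mul]
    have h4 : 0 ≤ 2 * L * e * (t - s) := mul_nonneg (by positivity) (by linarith)
    refine add_le_add ?_ ?_
    · exact (mul_le_mul e2 (pow_le_pow_left₀ (norm_nonneg _) (hzr t (hs.trans hst) ht) 2)
        (by positivity) h4).trans (le_of_eq (by ring))
    · exact (mul_le_mul (hexp s (hst.trans ht)) e1 (abs_nonneg _) (by positivity)).trans
        (le_of_eq (by ring))
  · rw [indicator_of_notMem hz, zero_mul]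
    rw [Metric.mem_closedBall, dist_eq_norm, not_le] at hz
    have hzero : ∀ r, 0 ≤ r → r ≤ T → movingBump β L γ r z = 0 := fun r hr hrT => by
      apply movingBump_eq_zero hρ
      have h1 := norm_sub_le_norm_sub_add_norm_sub z (γ r) (γ 0)
      have h2 := hdist r hr hrT
      have h3 : ρ * Real.exp (-L * r) ≤ ρ := by
        refine mul_le_of_le_one_right hρ.le (Real.exp_le_one_iff.2 ?_)
        nlinarith
      linarith
    rw [hzero t (hs.trans hst) ht, hzero s hs (hst.trans ht)]
    simp

variable [InnerProductSpace ℝ E]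

theorem contDiff_movingBump (t : ℝ) :
    ContDiff ℝ ((⊤ : ℕ∞) : WithTop ℕ∞) (movingBump β L γ t) := by
  refine Real.smoothTransition.contDiff.comp (contDiff_const.sub (contDiff_const.mul ?_))
  exact (contDiff_id.sub contDiff_const).norm_sq ℝ

theorem hasFDerivAt_movingBump (t : ℝ) (z v : E) :
    fderiv ℝ (movingBump β L γ t) z v =
      deriv Real.smoothTransition (1 - β * Real.exp (2 * L * t) * ‖z - γ t‖ ^ 2) *
        (-(β * Real.exp (2 * L * t) * (2 * inner ℝ (z - γ t) v))) := by
  have h1 : HasFDerivAt (fun z => 1 - β * Real.exp (2 * L * t) * ‖z - γ t‖ ^ 2)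
      (-((β * Real.exp (2 * L * t)) • (2 • (innerSL ℝ (z - γ t))))) z := by
    have := ((hasStrictFDerivAt_norm_sq (z - γ t)).hasFDerivAt.comp z
      ((hasFDerivAt_id z).sub_const (γ t))).const_mul (β * Real.exp (2 * L * t))
    exact this.const_sub 1
  have h2 := (Real.smoothTransition.hasDerivAt _).comp_hasFDerivAt z h1
  have : movingBump β L γ t =
    Real.smoothTransition ∘ fun z => 1 - β * Real.exp (2 * L * t) * ‖z - γ t‖ ^ 2 := rfl
  rw [this, h2.fderiv]
  simp [two_mul, inner_sub_left]

theorem hasDerivAt_movingBump {t : ℝ} {w : E} (hγ : HasDerivAt γ w t) (z : E) :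
    HasDerivAt (fun t => movingBump β L γ t z)
      (deriv Real.smoothTransition (1 - β * Real.exp (2 * L * t) * ‖z - γ t‖ ^ 2) *
        (-(β * Real.exp (2 * L * t) * (2 * L) * ‖z - γ t‖ ^ 2 +
          β * Real.exp (2 * L * t) * (2 * inner ℝ (z - γ t) (-w))))) t := by
  have h1 : HasDerivAt (fun t => ‖z - γ t‖ ^ 2) (2 * inner ℝ (z - γ t) (-w)) t := by
    have := (hγ.const_sub z).norm_sq
    simpa using this
  have h2 : HasDerivAt (fun t => β * Real.exp (2 * L * t))
      (β * Real.exp (2 * L * t) * (2 * L)) t := by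
    have := (((hasDerivAt_id t).const_mul (2 * L)).exp).const_mul β
    exact this.congr_deriv (by simp only [id, mul_one]; ring)
  exact (Real.smoothTransition.hasDerivAt _).comp t ((h2.mul h1).const_sub 1)

/-- The bump is a subsolution of the transport equation along Z. Flow lines of an L-Lipschitz field
approach γ at relative rate at most L, and the radius shrinks at exactly that rate. -/
theorem deriv_movingBump_add_fderiv_nonpos (hβ : 0 ≤ β) {Z : E → E} {t : ℝ}
    (hZ : ∀ x y, ‖Z x - Z y‖ ≤ L * ‖x - y‖) (hγ : HasDerivAt γ (Z (γ t)) t) (z : E) :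
    deriv (fun t => movingBump β L γ t z) t ≤ -fderiv ℝ (movingBump β L γ t) z (Z z) := by
  rw [(hasDerivAt_movingBump hγ z).deriv, hasFDerivAt_movingBump, ← mul_neg]
  refine mul_le_mul_of_nonneg_left ?_ (Real.smoothTransition.deriv_nonneg _)
  have h1 : inner ℝ (z - γ t) (Z (γ t) - Z z) ≤ L * ‖z - γ t‖ ^ 2 := by
    refine (real_inner_le_norm _ _).trans ?_
    have := hZ (γ t) z
    rw [norm_sub_rev (γ t)] at this
    nlinarith [norm_nonneg (z - γ t)]
  rw [inner_sub_right] at h1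
  rw [inner_neg_right]
  have h2 : 0 ≤ β * Real.exp (2 * L * t) := by positivity
  nlinarith

theorem hasCompactSupport_movingBump [FiniteDimensional ℝ E] {ρ : ℝ} (hρ : 0 < ρ) (t : ℝ) :
    HasCompactSupport (movingBump ((ρ ^ 2)⁻¹) L γ t) := by
  apply HasCompactSupport.of_support_subset_isCompact
    (isCompact_closedBall (γ t) (ρ * Real.exp (-L * t)))
  intro z hz
  rw [Metric.mem_closedBall, dist_eq_norm]
  by_contra! hcon
  exact hz (movingBump_eq_zero hρ hcon.le)

end MovingBump

/-- A closed-up form of Gronwall's inequality for absolutely continuous functions. -/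
theorem AbsolutelyContinuousOnInterval.nonpos_of_deriv_le {f : ℝ → ℝ} {T K : ℝ} (hT : 0 ≤ T)
    (hf : AbsolutelyContinuousOnInterval f 0 T) (h0 : f 0 ≤ 0)
    (hd : ∀ᵐ t, t ∈ Icc 0 T → ∃ w, HasDerivAt f w t ∧ w ≤ K * f t) : f T ≤ 0 := by
  have he : AbsolutelyContinuousOnInterval (fun t => Real.exp (-K * t)) 0 T := by
    apply ContDiffOn.absolutelyContinuousOnInterval
    fun_prop
  have h1 := (he.mul hf).integral_deriv_eq_sub
  have h2 : ∫ t in (0 : ℝ)..T, deriv ((fun t => Real.exp (-K * t)) * f) t ≤ 0 := by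
    rw [intervalIntegral.integral_of_le hT]
    apply integral_nonpos_of_ae
    rw [EventuallyLE, ae_restrict_iff' measurableSet_Ioc]
    filter_upwards [hd] with t ht hmem
    obtain ⟨w, hw, hwK⟩ := ht (Ioc_subset_Icc_self hmem)
    have h3 : HasDerivAt (fun t => Real.exp (-K * t)) (Real.exp (-K * t) * (-K)) t := by
      simpa using ((hasDerivAt_id t).const_mul (-K)).exp
    rw [(h3.mul hw).deriv]
    have := Real.exp_pos (-K * t)
    simp only [Pi.zero_apply]
    nlinarith
  rw [h1] at h2
  simp only [Pi.mul_apply, mul_zero, Real.exp_zero, one_mul] at h2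
  have := Real.exp_pos (-K * T)
  by_contra! hcon
  nlinarith [mul_pos this hcon]

/-- Let f(t) be the integral over G of the moving bump. The transport inequality and `hdiv` give f'
≤ K f, and f(0) = 0, so f(T) = 0 by Gronwall. The velocity of γ may come from a different field at
each time, hence the family 𝒴 with common constants L and K. -/
theorem volume_inter_ball_eq_zero_of_path {E : Type*} [NormedAddCommGroup E]
    [InnerProductSpace ℝ E] [FiniteDimensional ℝ E] [MeasureSpace E] [BorelSpace E]
    [IsLocallyFiniteMeasure (volume : Measure E)]
    {G : Set E} (hG : MeasurableSet G) {𝒴 : Set (E → E)} {L K : ℝ} (hL0 : 0 ≤ L)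
    (hL : ∀ Z ∈ 𝒴, ∀ x y, ‖Z x - Z y‖ ≤ L * ‖x - y‖)
    (hdiv : ∀ Z ∈ 𝒴, ∀ ψ : E → ℝ, ContDiff ℝ ((⊤ : ℕ∞) : WithTop ℕ∞) ψ → HasCompactSupport ψ →
      (∀ z, 0 ≤ ψ z) → -∫ z in G, fderiv ℝ ψ z (Z z) ≤ K * ∫ z in G, ψ z)
    {γ : ℝ → E} {T M ρ : ℝ} (hT : 0 ≤ T) (hM : 0 ≤ M) (hρ : 0 < ρ)
    (hγ : ∀ s t, 0 ≤ s → s ≤ t → t ≤ T → ‖γ t - γ s‖ ≤ M * (t - s))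
    (hγ' : ∀ᵐ t, t ∈ Icc 0 T → ∃ Z ∈ 𝒴, HasDerivAt γ (Z (γ t)) t)
    (h0 : volume (G ∩ Metric.ball (γ 0) ρ) = 0) :
    volume (G ∩ Metric.ball (γ T) (ρ * Real.exp (-L * T))) = 0 := by
  set β : ℝ := (ρ ^ 2)⁻¹ with hβ
  have hβ0 : 0 ≤ β := by positivity
  set F := movingBump β L γ with hF
  have hFc : ∀ t, Continuous (F t) := fun t => (contDiff_movingBump t).continuous
  have hFs : ∀ t, HasCompactSupport (F t) := fun t => hasCompactSupport_movingBump hρ t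
  have hFi : ∀ t, Integrable (F t) (volume.restrict G) := fun t =>
    ((hFc t).integrable_of_hasCompactSupport (hFs t)).restrict
  obtain ⟨C, hC0, hC⟩ := exists_movingBump_lipschitz hL0 hρ hT hM hγ
  set b : E → ℝ := (Metric.closedBall (γ 0) (M * T + ρ)).indicator (fun _ => C) with hb
  have hb0 : ∀ z, 0 ≤ b z := fun z => indicator_nonneg (fun _ _ => hC0) z
  have hbi : Integrable b (volume.restrict G) := by
    apply Integrable.restrict
    exact (integrable_indicator_iff Metric.isClosed_closedBall.measurableSet).2
      (integrableOn_const (isCompact_closedBall _ _).measure_lt_top.ne)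
  set f : ℝ → ℝ := fun t => ∫ z in G, F t z with hf
  have hfLip : ∀ s t, 0 ≤ s → s ≤ t → t ≤ T → ‖f t - f s‖ ≤ (∫ z in G, b z) * (t - s) := by
    intro s t hs hst ht
    rw [hf]
    dsimp only
    rw [← integral_sub (hFi t) (hFi s), ← integral_mul_const]
    exact norm_integral_le_of_norm_le (hbi.mul_const _) (ae_of_all _ fun z => hC z s t hs hst ht)
  have hfac := absolutelyContinuousOnInterval_of_norm_sub_le hT hfLip
  have hf0 : f 0 ≤ 0 := by
    refine le_of_eq (integral_eq_zero_of_ae ?_)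
    rw [EventuallyEq, ae_restrict_iff' hG]
    have : ∀ᵐ z, z ∉ G ∩ Metric.ball (γ 0) ρ := measure_eq_zero_iff_ae_notMem.1 h0
    filter_upwards [this] with z hz hzG
    apply movingBump_eq_zero hρ
    by_contra! hcon
    refine hz ⟨hzG, ?_⟩
    rw [Metric.mem_ball, dist_eq_norm]
    simpa using hcon
  have hderiv : ∀ᵐ t, t ∈ Icc 0 T → ∃ w, HasDerivAt f w t ∧ w ≤ K * f t := by
    -- Removing the two endpoints leaves a neighbourhood of t inside [0, T], where the Lipschitz
    -- bound in time is available.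
    filter_upwards [hγ', Measure.ae_ne volume 0, Measure.ae_ne volume T] with t ht hne0 hneT hmem
    obtain ⟨Z, hZ, hZd⟩ := ht hmem
    have hIoo : Ioo 0 T ∈ 𝓝 t := Ioo_mem_nhds (hmem.1.lt_of_ne (Ne.symm hne0))
      (hmem.2.lt_of_ne hneT)
    have hdF : ∀ z, HasDerivAt (fun t => F t z) (deriv (fun t => F t z) t) t := fun z =>
      (hasDerivAt_movingBump hZd z).differentiableAt.hasDerivAt
    have hmeas : AEStronglyMeasurable (fun z => deriv (fun t => F t z) t) (volume.restrict G) := by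
      have : (fun z => deriv (fun t => F t z) t) = fun z =>
        (deriv Real.smoothTransition (1 - β * Real.exp (2 * L * t) * ‖z - γ t‖ ^ 2) *
        (-(β * Real.exp (2 * L * t) * (2 * L) * ‖z - γ t‖ ^ 2 +
          β * Real.exp (2 * L * t) * (2 * inner ℝ (z - γ t) (-(Z (γ t))))))) :=
        funext fun z => (hasDerivAt_movingBump hZd z).deriv
      rw [this]
      have hc : Continuous (deriv Real.smoothTransition) :=
        (Real.smoothTransition.contDiff (n := 1)).continuous_deriv le_rfl
      exact Continuous.aestronglyMeasurable (by fun_prop)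
    obtain ⟨hint, hder⟩ := hasDerivAt_integral_of_dominated_loc_of_lip (μ := volume.restrict G)
      (F := F) (F' := fun z => deriv (fun t => F t z) t) (bound := b) hIoo
      (Eventually.of_forall fun t => (hFi t).aestronglyMeasurable) (hFi t) hmeas
      (ae_of_all _ fun z => by
        apply LipschitzOnWith.of_dist_le_mul
        intro s hs r hr
        wlog hsr : s ≤ r generalizing s r
        · rw [dist_comm, dist_comm s]
          exact this r hr s hs (le_of_not_ge hsr)
        rw [dist_comm, dist_comm s, Real.dist_eq, Real.dist_eq, abs_of_nonneg (sub_nonneg.2 hsr)]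
        refine (hC z s r hs.1.le hsr hr.2.le).trans (le_of_eq ?_)
        rw [Real.coe_nnabs, abs_of_nonneg (hb0 z)]) hbi (ae_of_all _ hdF)
    refine ⟨_, hder, ?_⟩
    have hZc : Continuous Z := by
      have : LipschitzWith (Real.toNNReal L) Z := LipschitzWith.of_dist_le_mul fun x y => by
        rw [dist_eq_norm, dist_eq_norm, Real.coe_toNNReal _ hL0]; exact hL Z hZ x y
      exact this.continuous
    refine le_trans ?_ (hdiv Z hZ (F t) (contDiff_movingBump t) (hFs t)
      (fun z => movingBump_nonneg t z))
    rw [← integral_neg]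
    have hfd : Continuous fun z => fderiv ℝ (F t) z (Z z) :=
      ((contDiff_movingBump t).continuous_fderiv (by simp)).clm_apply hZc
    refine integral_mono hint (Integrable.neg (Integrable.restrict
      (hfd.integrable_of_hasCompactSupport ?_)))
      fun z => deriv_movingBump_add_fderiv_nonpos hβ0 (hL Z hZ) hZd z
    refine ((hFs t).fderiv ℝ).mono fun z hz => ?_
    rw [Function.mem_support] at hz ⊢
    exact fun h => hz (by rw [h]; rfl)
  have hfT := hfac.nonpos_of_deriv_le hT hf0 hderiv
  have h1 : f T = 0 := le_antisymm hfT (integral_nonneg fun z => movingBump_nonneg T z)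
  rw [hf, integral_eq_zero_iff_of_nonneg (fun z => movingBump_nonneg T z) (hFi T), EventuallyEq,
    ae_restrict_iff' hG] at h1
  rw [measure_eq_zero_iff_ae_notMem]
  filter_upwards [h1] with z hz
  rintro ⟨hzG, hzb⟩
  rw [Metric.mem_ball, dist_eq_norm] at hzb
  exact absurd (hz hzG) ((movingBump_pos_iff hρ T z).2 hzb).ne'

/-- Test functions: smooth functions with compact support in `Ω`. -/
def IsTestFun {N : ℕ} (Ω : Set (EuclideanSpace ℝ (Fin N))) (φ : EuclideanSpace ℝ (Fin N) → ℝ) :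
    Prop :=
  ContDiff ℝ ((⊤ : ℕ∞) : WithTop ℕ∞) φ ∧ HasCompactSupport φ ∧ tsupport φ ⊆ Ω

/-! ### Integration by parts for Lipschitz fields -/

section Divergence

variable {N : ℕ}

/-- The divergence of a vector field, in terms of line derivatives. -/
noncomputable def lineDiv (Z : EuclideanSpace ℝ (Fin N) → EuclideanSpace ℝ (Fin N))
    (z : EuclideanSpace ℝ (Fin N)) : ℝ :=
  ∑ i, lineDeriv ℝ (fun z => Z z i) z (EuclideanSpace.single i 1)

variable {Z : EuclideanSpace ℝ (Fin N) → EuclideanSpace ℝ (Fin N)} {L : NNReal}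

theorem LipschitzWith.euclidean_apply (hZ : LipschitzWith L Z) (i : Fin N) :
    LipschitzWith L fun z => Z z i := by
  refine LipschitzWith.of_dist_le_mul fun x y => (le_trans ?_ (hZ.dist_le_mul x y))
  rw [dist_eq_norm, dist_eq_norm]
  exact PiLp.norm_apply_le (Z x - Z y) i

theorem measurable_lineDiv (hZ : LipschitzWith L Z) : Measurable (lineDiv Z) :=
  Finset.measurable_fun_sum _ fun i _ => measurable_lineDeriv (hZ.euclidean_apply i).continuous

theorem abs_lineDiv_le (hZ : LipschitzWith L Z) (z : EuclideanSpace ℝ (Fin N)) :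
    |lineDiv Z z| ≤ N * L := by
  refine (Finset.abs_sum_le_sum_abs _ _).trans ?_
  calc _ ≤ ∑ i : Fin N, (L : ℝ) := Finset.sum_le_sum fun i _ => by
        have := norm_lineDeriv_le_of_lipschitz ℝ (x₀ := z) (v := EuclideanSpace.single i (1 : ℝ))
          (hZ.euclidean_apply i)
        simpa using this
    _ = N * L := by simp

theorem fderiv_apply_eq_sum (g : EuclideanSpace ℝ (Fin N) → ℝ) (z v : EuclideanSpace ℝ (Fin N)) :
    fderiv ℝ g z v = ∑ i, fderiv ℝ g z (EuclideanSpace.single i 1) * v i := by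
  conv_lhs => rw [← (EuclideanSpace.basisFun (Fin N) ℝ).sum_repr v]
  rw [map_sum]
  refine Finset.sum_congr rfl fun i _ => ?_
  simp [mul_comm]

theorem HasCompactSupport.fderiv_field {g : EuclideanSpace ℝ (Fin N) → ℝ}
    (hg : HasCompactSupport g) (Z : EuclideanSpace ℝ (Fin N) → EuclideanSpace ℝ (Fin N)) :
    HasCompactSupport fun z => fderiv ℝ g z (Z z) := by
  refine (hg.fderiv ℝ).mono fun z hz => ?_
  rw [Function.mem_support] at hz ⊢
  exact fun h => hz (by rw [h]; rfl)

theorem integrable_lineDiv_mul (hZ : LipschitzWith L Z) {g : EuclideanSpace ℝ (Fin N) → ℝ}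
    (hg : Integrable g) : Integrable fun z => lineDiv Z z * g z :=
  hg.bdd_mul (c := N * L) (measurable_lineDiv hZ).aestronglyMeasurable
    (ae_of_all _ fun z => abs_lineDiv_le hZ z)

/-- A Lipschitz field need not be differentiable everywhere, so integration by parts is done one
coordinate at a time with line derivatives. -/
theorem integral_lineDiv_mul (hZ : LipschitzWith L Z) {g : EuclideanSpace ℝ (Fin N) → ℝ}
    (hg : ContDiff ℝ ((⊤ : ℕ∞) : WithTop ℕ∞) g) (hgc : HasCompactSupport g) :
    ∫ z, lineDiv Z z * g z = -∫ z, fderiv ℝ g z (Z z) := by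
  obtain ⟨D, hD⟩ := hg.lipschitzWith_of_hasCompactSupport hgc (by simp)
  have hgd : Differentiable ℝ g := hg.differentiable (by simp)
  have hgi := hg.continuous.integrable_of_hasCompactSupport hgc (μ := volume)
  have hfi : ∀ i, Integrable fun z => fderiv ℝ g z (EuclideanSpace.single i 1) * Z z i := fun i =>
    (((hg.continuous_fderiv (by simp)).clm_apply continuous_const).mul
      (hZ.euclidean_apply i).continuous).integrable_of_hasCompactSupport
      ((hgc.fderiv_apply ℝ _).mul_right)
  simp_rw [lineDiv, Finset.sum_mul, fderiv_apply_eq_sum g _ (Z _)]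
  rw [integral_finsetSum, integral_finsetSum, ← Finset.sum_neg_distrib]
  · refine Finset.sum_congr rfl fun i _ => ?_
    rw [LipschitzWith.integral_lineDeriv_mul_eq (hZ.euclidean_apply i) hD hgc, ← integral_neg]
    refine integral_congr_ae (ae_of_all _ fun z => ?_)
    simp only
    rw [(hgd z).lineDeriv_eq_fderiv, map_neg, neg_mul]
  · exact fun i _ => hfi i
  · intro i _
    refine hgi.bdd_mul (c := L) (measurable_lineDeriv
      (hZ.euclidean_apply i).continuous).aestronglyMeasurable (ae_of_all _ fun z => ?_)
    have := norm_lineDeriv_le_of_lipschitz ℝ (x₀ := z) (v := EuclideanSpace.single i (1 : ℝ))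
      (hZ.euclidean_apply i)
    simpa using this

/-- If test functions in `Ω` approximate `1` while their derivatives along `Z` vanish in the limit,
then the flow of `Z` does not leave `Ω`, in the following infinitesimal sense. -/
theorem neg_integral_compl_fderiv_le {Ω : Set (EuclideanSpace ℝ (Fin N))} (hΩ : MeasurableSet Ω)
    (hΩt : volume Ω < ∞)
    (hZ : LipschitzWith L Z) {φ : ℕ → EuclideanSpace ℝ (Fin N) → ℝ} (hφ : ∀ n, IsTestFun Ω (φ n))
    (h1 : Tendsto (fun n => ∫ z in Ω, |φ n z - 1|) atTop (𝓝 0))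
    (h2 : Tendsto (fun n => ∫ z in Ω, |fderiv ℝ (φ n) z (Z z)|) atTop (𝓝 0))
    {ψ : EuclideanSpace ℝ (Fin N) → ℝ} (hψ : ContDiff ℝ ((⊤ : ℕ∞) : WithTop ℕ∞) ψ)
    (hψc : HasCompactSupport ψ) (hψ0 : ∀ z, 0 ≤ ψ z) :
    -∫ z in Ωᶜ, fderiv ℝ ψ z (Z z) ≤ (N * L) * ∫ z in Ωᶜ, ψ z := by
  have hZc := hZ.continuous
  have hψi : Integrable ψ := hψ.continuous.integrable_of_hasCompactSupport hψc
  have hψ'c : Continuous fun z => fderiv ℝ ψ z (Z z) :=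
    (hψ.continuous_fderiv (by simp)).clm_apply hZc
  have hψ'i : Integrable fun z => fderiv ℝ ψ z (Z z) :=
    hψ'c.integrable_of_hasCompactSupport (hψc.fderiv_field Z)
  obtain ⟨P, hP⟩ := hψc.exists_bound_of_continuous hψ.continuous
  obtain ⟨P', hP'⟩ := (hψc.fderiv_field Z).exists_bound_of_continuous hψ'c
  -- h plays the role of the divergence of ψ Z, so its integral over the whole space is 0. Its
  -- integral over Ω is the limit of ∫_Ω φ_n h = -∫_Ω ψ Zφ_n, again 0. What remains is the integral
  -- over the complement of Ω, where the divergence of Z is at most N L.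
  set h : EuclideanSpace ℝ (Fin N) → ℝ := fun z => lineDiv Z z * ψ z + fderiv ℝ ψ z (Z z) with hh
  have hhi : Integrable h := (integrable_lineDiv_mul hZ hψi).add hψ'i
  have hP0 : 0 ≤ P := (norm_nonneg _).trans (hP 0)
  have hhb : ∀ z, |h z| ≤ N * L * P + P' := fun z => by
    refine (abs_add_le _ _).trans (add_le_add ?_ (hP' z))
    rw [abs_mul]
    exact mul_le_mul (abs_lineDiv_le hZ z) (hP z) (abs_nonneg _) (by positivity)
  have hall : ∫ z, h z = 0 := by
    rw [hh, integral_add (integrable_lineDiv_mul hZ hψi) hψ'i, integral_lineDiv_mul hZ hψ hψc]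
    ring
  have hφh : ∀ n, ∫ z in Ω, φ n z * h z = -∫ z in Ω, ψ z * fderiv ℝ (φ n) z (Z z) := by
    intro n
    obtain ⟨hs, hc, hsub⟩ := hφ n
    have hz : ∀ z, z ∉ Ω → φ n z = 0 := fun z hz => image_eq_zero_of_notMem_tsupport
      fun h => hz (hsub h)
    have hz' : ∀ z, z ∉ Ω → fderiv ℝ (φ n) z = 0 := fun z hz => by
      by_contra hne
      exact hz (hsub (support_fderiv_subset ℝ hne))
    rw [setIntegral_eq_integral_of_forall_compl_eq_zero (fun z hzΩ => by rw [hz z hzΩ, zero_mul]),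
      setIntegral_eq_integral_of_forall_compl_eq_zero (fun z hzΩ => by rw [hz' z hzΩ]; simp)]
    have hprod : ContDiff ℝ ((⊤ : ℕ∞) : WithTop ℕ∞) (fun z => φ n z * ψ z) := hs.mul hψ
    have hprodc : HasCompactSupport fun z => φ n z * ψ z := hc.mul_right
    have i1 := integral_lineDiv_mul hZ hprod hprodc
    have hfd : ∀ z, fderiv ℝ (fun z => φ n z * ψ z) z (Z z) =
        φ n z * fderiv ℝ ψ z (Z z) + ψ z * fderiv ℝ (φ n) z (Z z) := fun z => by
      rw [fderiv_fun_mul (hs.differentiable (by simp) z) (hψ.differentiable (by simp) z)]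
      simp
    simp_rw [hfd] at i1
    have j1 : Integrable fun z => φ n z * fderiv ℝ ψ z (Z z) :=
      (hs.continuous.mul hψ'c).integrable_of_hasCompactSupport hc.mul_right
    have j2 : Integrable fun z => ψ z * fderiv ℝ (φ n) z (Z z) :=
      (hψ.continuous.mul ((hs.continuous_fderiv (by simp)).clm_apply
        hZc)).integrable_of_hasCompactSupport hψc.mul_right
    have j3 : Integrable fun z => lineDiv Z z * (φ n z * ψ z) :=
      integrable_lineDiv_mul hZ (hprod.continuous.integrable_of_hasCompactSupport hprodc)
    rw [integral_add j1 j2] at i1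
    have : (fun z => φ n z * h z) = fun z => lineDiv Z z * (φ n z * ψ z) +
        φ n z * fderiv ℝ ψ z (Z z) := by
      funext z; rw [hh]; ring
    rw [this, integral_add j3 j1]
    linarith
  have hΩ0 : ∫ z in Ω, h z = 0 := by
    have hbound : ∀ n, |∫ z in Ω, h z| ≤ (N * L * P + P') * (∫ z in Ω, |φ n z - 1|) +
        P * ∫ z in Ω, |fderiv ℝ (φ n) z (Z z)| := by
      intro n
      obtain ⟨hs, hc, hsub⟩ := hφ n
      have k1 : IntegrableOn (fun z => |φ n z - 1|) Ω :=
        (((hs.continuous.integrable_of_hasCompactSupport hc).integrableOn).sub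
          (integrableOn_const hΩt.ne)).abs
      have k2 : IntegrableOn (fun z => |fderiv ℝ (φ n) z (Z z)|) Ω :=
        ((((hs.continuous_fderiv (by simp)).clm_apply
        hZc).integrable_of_hasCompactSupport (hc.fderiv_field Z)).integrableOn).abs
      have k3 : IntegrableOn (fun z => φ n z * h z) Ω := by
        obtain ⟨B, hB⟩ := hc.exists_bound_of_continuous hs.continuous
        exact (hhi.bdd_mul (c := B) hs.continuous.aestronglyMeasurable
          (ae_of_all _ hB)).integrableOn
      have : ∫ z in Ω, h z = (∫ z in Ω, (h z - φ n z * h z)) + ∫ z in Ω, φ n z * h z := by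
        rw [integral_sub hhi.integrableOn k3]; ring
      rw [this, hφh n, ← integral_const_mul, ← integral_const_mul]
      refine (abs_add_le _ _).trans (add_le_add ?_ ?_)
      · rw [← Real.norm_eq_abs]
        refine norm_integral_le_of_norm_le (k1.const_mul _) (ae_of_all _ fun z => ?_)
        rw [Real.norm_eq_abs, show h z - φ n z * h z = h z * -(φ n z - 1) by ring, abs_mul, abs_neg]
        exact mul_le_mul_of_nonneg_right (hhb z) (abs_nonneg _)
      · rw [abs_neg, ← Real.norm_eq_abs]
        refine norm_integral_le_of_norm_le (k2.const_mul _) (ae_of_all _ fun z => ?_)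
        rw [Real.norm_eq_abs, abs_mul]
        exact mul_le_mul_of_nonneg_right (hP z) (abs_nonneg _)
    have hlim : Tendsto (fun n => (N * L * P + P') * (∫ z in Ω, |φ n z - 1|) +
        P * ∫ z in Ω, |fderiv ℝ (φ n) z (Z z)|) atTop (𝓝 0) := by
      simpa using (h1.const_mul (N * L * P + P')).add (h2.const_mul P)
    exact abs_nonpos_iff.1 (ge_of_tendsto' hlim hbound)
  have hcompl : ∫ z in Ωᶜ, h z = 0 := by
    have := integral_add_compl hΩ hhi
    linarith
  rw [hh, integral_add (integrable_lineDiv_mul hZ hψi).integrableOn hψ'i.integrableOn] at hcompl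
  have hfin : ∫ z in Ωᶜ, lineDiv Z z * ψ z ≤ ∫ z in Ωᶜ, (N * L) * ψ z := by
    refine integral_mono (integrable_lineDiv_mul hZ hψi).integrableOn
      (hψi.const_mul _).integrableOn fun z => ?_
    exact mul_le_mul_of_nonneg_right ((le_abs_self _).trans (abs_lineDiv_le hZ z)) (hψ0 z)
  rw [integral_const_mul] at hfin
  linarith

end Divergence

/-! ### Constants are not limits of test functions -/

section ZeroBoundary

variable {N m : ℕ} {X : Fin m → EuclideanSpace ℝ (Fin N) → EuclideanSpace ℝ (Fin N)}
  {Ω : Set (EuclideanSpace ℝ (Fin N))} {Q : ℝ}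

theorem continuous_xGrad (hX : ∀ j, Continuous (X j)) {φ : EuclideanSpace ℝ (Fin N) → ℝ}
    (hφ : ContDiff ℝ 1 φ) : Continuous (xGrad X φ) := by
  refine (PiLp.continuous_toLp 2 _).comp (continuous_pi fun j => ?_)
  exact (hφ.continuous_fderiv one_ne_zero).clm_apply (hX j)

theorem hasCompactSupport_xGrad {φ : EuclideanSpace ℝ (Fin N) → ℝ} (hφ : HasCompactSupport φ) :
    HasCompactSupport (xGrad X φ) := by
  refine (hφ.fderiv ℝ).mono fun z hz => ?_
  rw [Function.mem_support] at hz ⊢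
  exact fun h => hz (by ext j; simp [xGrad, h])

theorem xGrad_const_mul {φ : EuclideanSpace ℝ (Fin N) → ℝ} (hφ : Differentiable ℝ φ) (c : ℝ)
    (z : EuclideanSpace ℝ (Fin N)) : xGrad X (fun z => c * φ z) z = c • xGrad X φ z := by
  ext j
  simp [xGrad, fderiv_const_mul (hφ z)]

theorem abs_fderiv_control_le {φ : EuclideanSpace ℝ (Fin N) → ℝ} {c : Fin m → ℝ}
    (hc : ∑ j, c j ^ 2 ≤ 1) (z : EuclideanSpace ℝ (Fin N)) :
    |fderiv ℝ φ z (∑ j, c j • X j z)| ≤ ‖xGrad X φ z‖ := by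
  have h1 : fderiv ℝ φ z (∑ j, c j • X j z) =
      inner ℝ (xGrad X φ z) (WithLp.toLp 2 c : EuclideanSpace ℝ (Fin m)) := by
    simp [xGrad, PiLp.inner_apply]
  have h2 : ‖(WithLp.toLp 2 c : EuclideanSpace ℝ (Fin m))‖ ≤ 1 := by
    rw [EuclideanSpace.norm_eq, Real.sqrt_le_one]
    simpa using hc
  rw [h1]
  exact (abs_real_inner_le_norm _ _).trans (mul_le_of_le_one_right (norm_nonneg _) h2)

theorem IsTestFun.const_mul {φ : EuclideanSpace ℝ (Fin N) → ℝ} (hφ : IsTestFun Ω φ) (c : ℝ) :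
    IsTestFun Ω fun z => c * φ z :=
  ⟨contDiff_const.mul hφ.1, hφ.2.1.mul_left, (tsupport_mul_subset_right).trans hφ.2.2⟩

namespace XAdmissible

/-- For r so large that both r and ν r exceed the diameter, the ball and its enlargement are both
equal to Ω. -/
theorem exists_poincare_domain (hX : XAdmissible X Ω Q) :
    ∃ C > (0 : ℝ), ∀ φ, ContDiff ℝ 1 φ →
      ∫ y in Ω, |φ y - ⨍ z in Ω, φ z| ≤ C * ∫ y in Ω, ‖xGrad X φ y‖ := by
  rcases Ω.eq_empty_or_nonempty with rfl | ⟨x, hx⟩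
  · exact ⟨1, one_pos, by simp⟩
  obtain ⟨R, hR0, hR⟩ := hX.exists_diam
  obtain ⟨CP, hCP, ν, hν, hP⟩ := hX.poincare
  set r := max R (R / ν) with hr
  have hr0 : 0 < r := hR0.trans_le (le_max_left _ _)
  refine ⟨CP * r, by positivity, fun φ hφ => ?_⟩
  have h := hP x hx r hr0 univ φ isOpen_univ (subset_univ _) hφ.contDiffOn
  rw [ccBall_eq_of_forall_ccDist_lt hR hx (le_max_left _ _),
    ccBall_eq_of_forall_ccDist_lt hR hx (show R ≤ ν * r by
    rw [← div_le_iff₀' hν]; exact le_max_right _ _)] at h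
  have hv : 0 < volume.real Ω :=
    ENNReal.toReal_pos (hX.isOpen.measure_pos _ ⟨x, hx⟩).ne' hX.volume_lt_top.ne
  rw [average_eq (μ := volume.restrict Ω) (f := fun y => |φ y - ⨍ z in Ω, φ z|),
    average_eq (μ := volume.restrict Ω) (f := fun y => ‖xGrad X φ y‖), smul_eq_mul, smul_eq_mul,
    measureReal_restrict_apply_univ, mul_left_comm] at h
  exact le_of_mul_le_mul_left h (inv_pos.2 hv)

/-- The space `W_0^{1,1}(Ω, X)` does not contain the constants, in quantitative form. -/
theorem exists_abs_integral_le (hX : XAdmissible X Ω Q) (hN : 0 < N) :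
    ∃ C > (0 : ℝ), ∀ φ, IsTestFun Ω φ → |∫ y in Ω, φ y| ≤ C * ∫ y in Ω, ‖xGrad X φ y‖ := by
  rcases Ω.eq_empty_or_nonempty with rfl | ⟨x₀, hx₀⟩
  · exact ⟨1, one_pos, by simp⟩
  -- Failure of the inequality yields test functions that tend to 1 in L^1(Ω) while their
  -- X-gradients tend to 0. Then Ω loses no mass along subunit paths, so a ball about x₀ inside Ω is
  -- carried to balls in which Ω has full measure, with radius bounded below. This is impossible
  -- near the edge of a bounded set.
  by_contra! hcon
  obtain ⟨C₁, hC₁, hpoin⟩ := hX.exists_poincare_domain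
  obtain ⟨D, hD0, hD⟩ := hX.exists_diam
  have hv : 0 < volume.real Ω :=
    ENNReal.toReal_pos (hX.isOpen.measure_pos _ ⟨x₀, hx₀⟩).ne' hX.volume_lt_top.ne
  have hΩm := hX.isOpen.measurableSet
  -- test functions of mean `1` with small gradient
  obtain ⟨φ, hφ, hφ1, hφ2⟩ : ∃ φ : ℕ → EuclideanSpace ℝ (Fin N) → ℝ, (∀ n, IsTestFun Ω (φ n)) ∧
      Tendsto (fun n => ∫ z in Ω, |φ n z - 1|) atTop (𝓝 0) ∧
      Tendsto (fun n => ∫ z in Ω, ‖xGrad X (φ n) z‖) atTop (𝓝 0) := by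
    choose φ hφ hlt using fun n : ℕ => hcon (n + 1) (by positivity)
    set c : ℕ → ℝ := fun n => volume.real Ω / ∫ z in Ω, φ n z with hc
    have hnn : ∀ n, 0 ≤ ∫ z in Ω, ‖xGrad X (φ n) z‖ := fun n =>
      integral_nonneg fun _ => norm_nonneg _
    have hne : ∀ n, 0 < |∫ z in Ω, φ n z| := fun n =>
      lt_of_le_of_lt (mul_nonneg (by positivity) (hnn n)) (hlt n)
    have hgrad : ∀ n, ∫ z in Ω, ‖xGrad X (fun z => c n * φ n z) z‖ ≤
        volume.real Ω / ((n : ℝ) + 1) := by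
      intro n
      have : ∀ z, ‖xGrad X (fun z => c n * φ n z) z‖ = |c n| * ‖xGrad X (φ n) z‖ := fun z => by
        rw [xGrad_const_mul ((hφ n).1.differentiable (by simp)), norm_smul, Real.norm_eq_abs]
      simp_rw [this]
      rw [integral_const_mul, hc, abs_div, abs_of_pos hv, div_mul_eq_mul_div, div_le_div_iff₀ (hne n)
        (by positivity), mul_assoc, mul_comm (∫ z in Ω, ‖xGrad X (φ n) z‖)]
      exact mul_le_mul_of_nonneg_left (hlt n).le hv.le
    have hlim : Tendsto (fun n : ℕ => volume.real Ω / ((n : ℝ) + 1)) atTop (𝓝 0) :=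
      tendsto_const_nhds.div_atTop (tendsto_natCast_atTop_atTop.atTop_add tendsto_const_nhds)
    refine ⟨fun n z => c n * φ n z, fun n => (hφ n).const_mul _, ?_, ?_⟩
    · refine squeeze_zero (g := fun n : ℕ => C₁ * (volume.real Ω / ((n : ℝ) + 1)))
        (fun n => integral_nonneg fun _ => abs_nonneg _) (fun n => ?_)
        (by simpa using hlim.const_mul C₁)
      have h1 := hpoin (fun z => c n * φ n z) (((hφ n).const_mul _).1.of_le (by simp))
      have h2 : ⨍ z in Ω, c n * φ n z = 1 := by
        rw [average_eq, measureReal_restrict_apply_univ, integral_const_mul, smul_eq_mul, hc]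
        have := abs_pos.1 (hne n)
        field_simp
      rw [h2] at h1
      exact h1.trans (mul_le_mul_of_nonneg_left (hgrad n) hC₁.le)
    · exact squeeze_zero (fun n => integral_nonneg fun _ => norm_nonneg _) hgrad hlim
  -- globally Lipschitz fields
  obtain ⟨R₀, hR₀⟩ := hX.isBounded.subset_closedBall 0
  -- The extra 1 places the sphere of radius R off the closure of Ω, which is used to show that
  -- paths from x₀ never reach it.
  set R := R₀ + 1 with hR
  have hext : ∀ j, ∃ K, ∃ Y : EuclideanSpace ℝ (Fin N) → EuclideanSpace ℝ (Fin N),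
      LipschitzWith K Y ∧ EqOn (X j) Y (Metric.closedBall 0 R) := fun j => by
    obtain ⟨K, hK⟩ := LocallyLipschitzOn.exists_lipschitzOnWith_of_compact
      (isCompact_closedBall (0 : EuclideanSpace ℝ (Fin N)) R)
      ((hX.locallyLipschitz j).locallyLipschitzOn)
    obtain ⟨g, hg, hg'⟩ := hK.extend_finite_dimension
    exact ⟨_, g, hg, hg'⟩
  choose K Y hY hXY using hext
  -- Fields with frozen control: at almost every time the velocity of a subunit path is given by the
  -- member of 𝒴 with c = θ(t), as long as the path stays in the ball of radius R.
  set 𝒴 : Set (EuclideanSpace ℝ (Fin N) → EuclideanSpace ℝ (Fin N)) :=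
    {Z | ∃ c : Fin m → ℝ, ∑ j, c j ^ 2 ≤ 1 ∧ Z = fun x => ∑ j, c j • Y j x} with h𝒴
  set L : NNReal := ∑ j, K j with hL
  have hlip : ∀ Z ∈ 𝒴, ∀ x y, ‖Z x - Z y‖ ≤ L * ‖x - y‖ := by
    rintro Z ⟨c, hc, rfl⟩ x y
    have : ∑ j, c j • Y j x - ∑ j, c j • Y j y = ∑ j, c j • (Y j x - Y j y) := by
      rw [← Finset.sum_sub_distrib]; simp_rw [smul_sub]
    rw [this]
    refine (norm_control_le hc _).trans ?_
    rw [hL, NNReal.coe_sum, Finset.sum_mul]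
    refine Finset.sum_le_sum fun j _ => ?_
    simpa [dist_eq_norm] using (hY j).dist_le_mul x y
  have hlip' : ∀ Z ∈ 𝒴, LipschitzWith L Z := fun Z hZ => LipschitzWith.of_dist_le_mul fun x y => by
    rw [dist_eq_norm, dist_eq_norm]; exact hlip Z hZ x y
  have hsubR : Ω ⊆ Metric.closedBall 0 R :=
    hR₀.trans (Metric.closedBall_subset_closedBall (by rw [hR]; linarith))
  have hdiv : ∀ Z ∈ 𝒴, ∀ ψ : EuclideanSpace ℝ (Fin N) → ℝ,
      ContDiff ℝ ((⊤ : ℕ∞) : WithTop ℕ∞) ψ → HasCompactSupport ψ → (∀ z, 0 ≤ ψ z) →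
      -∫ z in Ωᶜ, fderiv ℝ ψ z (Z z) ≤ (N * L) * ∫ z in Ωᶜ, ψ z := by
    intro Z hZ ψ h1 h2 h3
    refine neg_integral_compl_fderiv_le hΩm hX.volume_lt_top (hlip' Z hZ) hφ hφ1 ?_ h1 h2 h3
    refine squeeze_zero (fun n => integral_nonneg fun _ => abs_nonneg _) (fun n => ?_) hφ2
    have hZc := (hlip' Z hZ).continuous
    refine setIntegral_mono_on ?_ ?_ hΩm fun z hz => ?_
    · exact (((((hφ n).1.continuous_fderiv (by simp)).clm_apply
        hZc).integrable_of_hasCompactSupport ((hφ n).2.1.fderiv_field Z)).integrableOn).abs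
    · exact (((continuous_xGrad hX.continuous ((hφ n).1.of_le (by simp))).integrable_of_hasCompactSupport
        (hasCompactSupport_xGrad (hφ n).2.1)).integrableOn).norm
    · obtain ⟨c, hc, rfl⟩ := hZ
      have : ∑ j, c j • Y j z = ∑ j, c j • X j z :=
        Finset.sum_congr rfl fun j _ => by rw [hXY j (hsubR hz)]
      dsimp only
      rw [this]
      exact abs_fderiv_control_le hc z
  obtain ⟨ρ, hρ, hball⟩ := Metric.isOpen_iff.1 hX.isOpen x₀ hx₀
  obtain ⟨M, hM⟩ : ∃ M, ∀ p ∈ Metric.closedBall (0 : EuclideanSpace ℝ (Fin N)) R,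
      ∑ j, ‖X j p‖ ≤ M := by
    have hc : Continuous fun p => ∑ j, ‖X j p‖ :=
      continuous_finsetSum _ fun j _ => (hX.continuous j).norm
    obtain ⟨M, hM⟩ := (isCompact_closedBall (0 : EuclideanSpace ℝ (Fin N))
      R).exists_bound_of_continuousOn hc.continuousOn
    exact ⟨M, fun p hp => (le_abs_self _).trans (hM p hp)⟩
  have hM0 : 0 ≤ M := (Finset.sum_nonneg fun j _ => norm_nonneg _).trans (hM x₀ (hsubR hx₀))
  have hpath : ∀ T γ, 0 ≤ T → IsSubunit X univ T γ → γ 0 = x₀ →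
      (∀ r ∈ Icc 0 T, γ r ∈ Metric.closedBall 0 R) →
      volume (Ωᶜ ∩ Metric.ball (γ T) (ρ * Real.exp (-L * T))) = 0 := by
    intro T γ hT hγ h0 hin
    refine volume_inter_ball_eq_zero_of_path hΩm.compl L.coe_nonneg hlip hdiv hT hM0 hρ
      (fun s t hs hst ht => hγ.norm_sub_le hs hst ht fun r hr =>
        hM _ (hin r ⟨hs.trans hr.1, hr.2.trans ht⟩)) ?_ ?_
    · obtain ⟨-, -, θ, -, hθ⟩ := hγ
      rw [ae_restrict_iff' measurableSet_Icc] at hθ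
      filter_upwards [hθ] with t ht hmem
      obtain ⟨h1, h2⟩ := ht hmem
      refine ⟨_, ⟨θ t, h1, rfl⟩, ?_⟩
      have : ∑ j, θ t j • Y j (γ t) = ∑ j, θ t j • X j (γ t) :=
        Finset.sum_congr rfl fun j _ => by rw [hXY j (hin t hmem)]
      rw [this]
      exact h2
    · rw [h0]
      have : Ωᶜ ∩ Metric.ball x₀ ρ = ∅ := by
        rw [inter_comm, ← disjoint_iff_inter_eq_empty]
        exact disjoint_compl_right_iff_subset.2 hball
      rw [this, measure_empty]
  -- Paths competing in the distance may leave Ω. At a first time on the sphere of radius R, `hpath`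
  -- would give Ω full measure near a point outside its closure.
  have hstay : ∀ T γ, 0 ≤ T → IsSubunit X univ T γ → γ 0 = x₀ →
      ∀ r ∈ Icc 0 T, γ r ∈ Metric.closedBall 0 R := by
    intro T γ hT hγ h0
    by_contra! hcon'
    obtain ⟨r, hr, hrR⟩ := hcon'
    rw [mem_closedBall_zero_iff, not_le] at hrR
    have hx₀R : ‖x₀‖ < R := by
      have := hR₀ hx₀
      rw [mem_closedBall_zero_iff] at this
      linarith
    obtain ⟨t₁, ⟨ht₁0, ht₁T⟩, heq, hlt⟩ := exists_first_hit (f := fun t => ‖γ t‖)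
      (((hγ.continuousOn hT).mono (Icc_subset_Icc_right hr.2)).norm) hr.1 (by rw [h0]; exact hx₀R)
      hrR.le
    have ht₁T' := ht₁T.trans hr.2
    have hγ₁ : IsSubunit X univ t₁ γ := by
      obtain ⟨hac, -, θ, hθm, hθ⟩ := hγ
      refine ⟨hac.mono ?_, fun _ _ => mem_univ _, θ, hθm,
        ae_restrict_of_ae_restrict_of_subset (Icc_subset_Icc_right ht₁T') hθ⟩
      rw [uIcc_of_le ht₁0.le, uIcc_of_le hT]
      exact Icc_subset_Icc_right ht₁T'
    have hnull := hpath t₁ γ ht₁0.le hγ₁ h0 fun s hs => by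
      rw [mem_closedBall_zero_iff]
      rcases hs.2.eq_or_lt with h | h
      · rw [h]; exact heq.le
      · exact (hlt s ⟨hs.1, h⟩).le
    have hcl : γ t₁ ∉ closure Ω := fun h => by
      have := closure_minimal hR₀ Metric.isClosed_closedBall h
      rw [mem_closedBall_zero_iff, heq, hR] at this
      linarith
    have hopen : IsOpen ((closure Ω)ᶜ ∩ Metric.ball (γ t₁) (ρ * Real.exp (-L * t₁))) :=
      isClosed_closure.isOpen_compl.inter Metric.isOpen_ball
    refine absurd (measure_mono_null (inter_subset_inter_left _
      (compl_subset_compl.2 subset_closure)) hnull)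
      (hopen.measure_pos volume ⟨γ t₁, hcl, Metric.mem_ball_self (by positivity)⟩).ne'
  -- Every y in Ω is reached from x₀ in time less than the diameter bound D, so this radius serves
  -- all y at once.
  set ε := ρ * Real.exp (-L * D) with hε
  have hε0 : 0 < ε := by positivity
  have hnull : ∀ y ∈ Ω, volume (Ωᶜ ∩ Metric.ball y ε) = 0 := by
    intro y hy
    obtain ⟨T, hT, hTD, γ, hγ, h0, h1⟩ := ccDist_lt_iff.1 (hD x₀ hx₀ y hy)
    have := hpath T γ hT.le hγ h0 (hstay T γ hT.le hγ h0)
    rw [h1] at this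
    refine measure_mono_null (inter_subset_inter_right _ (Metric.ball_subset_ball ?_)) this
    rw [ENNReal.ofReal_lt_ofReal_iff hD0] at hTD
    rw [hε]
    gcongr ρ * Real.exp ?_
    nlinarith [L.coe_nonneg]
  -- a point of `Ω` near which the first coordinate leaves `Ω`
  set i₀ : Fin N := ⟨0, hN⟩
  have hbdd : BddAbove ((fun y : EuclideanSpace ℝ (Fin N) => y i₀) '' Ω) := by
    refine ⟨R₀, ?_⟩
    rintro _ ⟨y, hy, rfl⟩
    have h1 := hR₀ hy
    rw [mem_closedBall_zero_iff] at h1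
    exact (le_abs_self _).trans ((PiLp.norm_apply_le y i₀).trans h1)
  obtain ⟨_, ⟨y, hy, rfl⟩, hys⟩ := exists_lt_of_lt_csSup (⟨_, mem_image_of_mem _ hx₀⟩ :
    ((fun y : EuclideanSpace ℝ (Fin N) => y i₀) '' Ω).Nonempty)
    (show sSup ((fun y : EuclideanSpace ℝ (Fin N) => y i₀) '' Ω) - ε / 2 < _ by linarith)
  have hopen : IsOpen ({w : EuclideanSpace ℝ (Fin N) |
      sSup ((fun y : EuclideanSpace ℝ (Fin N) => y i₀) '' Ω) < w i₀} ∩ Metric.ball y ε) :=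
    (isOpen_lt continuous_const (by fun_prop)).inter Metric.isOpen_ball
  refine absurd (measure_mono_null (inter_subset_inter_left _ fun w hw hwΩ => ?_) (hnull y hy))
    (hopen.measure_pos volume ⟨y + EuclideanSpace.single i₀ (ε / 2), ?_, ?_⟩).ne'
  · exact absurd (le_csSup hbdd (mem_image_of_mem _ hwΩ)) (not_le.2 hw)
  · simp only [mem_ofPred_eq, PiLp.add_apply, PiLp.single_apply, if_true]
    linarith
  · rw [Metric.mem_ball, dist_eq_norm, add_sub_cancel_left, PiLp.norm_single,
      Real.norm_eq_abs, abs_of_pos (by positivity)]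
    linarith

end XAdmissible

end ZeroBoundary

/-! ### The dyadic sum behind the exponent 1/Q -/

/-- The bracket is the increment of the bounded function 6u/(1+u) from u to 2u. For u = 2^i β the
factor 2^{-i} turns the leading u into β, so the sum over i telescopes to at most 6 β and need not
be split at 2^i β = 1. -/
theorem min_one_rpow_le {Q u : ℝ} (hQ : 2 ≤ Q) (hu : 0 ≤ u) :
    min 1 (u ^ Q) ≤ u * (6 * (2 * u) / (1 + 2 * u) - 6 * u / (1 + u)) := by
  have e : u * (6 * (2 * u) / (1 + 2 * u) - 6 * u / (1 + u)) =
      6 * u ^ 2 / ((1 + 2 * u) * (1 + u)) := by field_simp; ring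
  rw [e, le_div_iff₀ (by positivity)]
  rcases le_total u 1 with h | h
  · have h1 : min 1 (u ^ Q) ≤ u ^ 2 := (min_le_right _ _).trans (by
      rcases hu.eq_or_lt with rfl | hu
      · rw [Real.zero_rpow (by linarith)]; norm_num
      · rw [← Real.rpow_natCast]
        exact Real.rpow_le_rpow_of_exponent_ge hu h (by simpa using hQ))
    calc _ ≤ u ^ 2 * ((1 + 2 * u) * (1 + u)) := by gcongr
      _ ≤ u ^ 2 * 6 := by gcongr; nlinarith
      _ = 6 * u ^ 2 := by ring
  · calc _ ≤ 1 * ((1 + 2 * u) * (1 + u)) := by gcongr; exact min_le_left _ _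
      _ ≤ _ := by nlinarith

theorem sum_half_pow_mul_min_le {Q β : ℝ} (hQ : 2 ≤ Q) (hβ : 0 ≤ β) (n : ℕ) :
    ∑ i ∈ Finset.range n, (1 / 2 : ℝ) ^ i * min 1 ((2 ^ i * β) ^ Q) ≤ 6 * β := by
  have h1 : ∑ i ∈ Finset.range n, (1 / 2 : ℝ) ^ i * min 1 ((2 ^ i * β) ^ Q) ≤
      ∑ i ∈ Finset.range n, (β * (6 * (2 ^ (i + 1) * β) / (1 + 2 ^ (i + 1) * β)) -
        β * (6 * (2 ^ i * β) / (1 + 2 ^ i * β))) := by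
    refine Finset.sum_le_sum fun i _ => ?_
    have := min_one_rpow_le hQ (show 0 ≤ 2 ^ i * β by positivity)
    calc _ ≤ (1 / 2 : ℝ) ^ i * (2 ^ i * β * (6 * (2 * (2 ^ i * β)) / (1 + 2 * (2 ^ i * β)) -
          6 * (2 ^ i * β) / (1 + 2 ^ i * β))) := by gcongr
      _ = ((1 / 2 : ℝ) ^ i * 2 ^ i) * (β * (6 * (2 * (2 ^ i * β)) / (1 + 2 * (2 ^ i * β)) -
          6 * (2 ^ i * β) / (1 + 2 ^ i * β))) := by ring
      _ = _ := by
        rw [← mul_pow, one_div, inv_mul_cancel₀ two_ne_zero, one_pow, one_mul, mul_sub, pow_succ',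
          mul_assoc 2]
  refine h1.trans ?_
  rw [Finset.sum_range_sub (fun i => β * (6 * (2 ^ i * β) / (1 + 2 ^ i * β)))]
  have h2 : 6 * (2 ^ n * β) / (1 + 2 ^ n * β) ≤ 6 := by
    rw [div_le_iff₀ (by positivity)]; nlinarith [show 0 ≤ 2 ^ n * β by positivity]
  have h3 : 0 ≤ β * (6 * (2 ^ 0 * β) / (1 + 2 ^ 0 * β)) := by positivity
  nlinarith

theorem tsum_half_pow_mul_min_le {Q : ℝ} (hQ : 2 ≤ Q) {B : ℝ≥0∞} (hB : B ≠ ∞) :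
    ∑' i : ℕ, ENNReal.ofReal ((1 / 2) ^ i) * min 1 (((2 : ℝ≥0∞) ^ Q) ^ i * B) ≤
      6 * B ^ (1 / Q) := by
  have hQ0 : 0 < Q := by linarith
  set β : ℝ := B.toReal ^ (1 / Q) with hβ
  have hβ0 : 0 ≤ β := by positivity
  have hBβ : B = ENNReal.ofReal (β ^ Q) := by
    rw [hβ, ← Real.rpow_mul ENNReal.toReal_nonneg, one_div_mul_cancel hQ0.ne', Real.rpow_one,
      ENNReal.ofReal_toReal hB]
  have hBβ' : B ^ (1 / Q) = ENNReal.ofReal β := by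
    rw [hBβ, ENNReal.ofReal_rpow_of_nonneg (by positivity) (by positivity),
      ← Real.rpow_mul hβ0, mul_one_div_cancel hQ0.ne', Real.rpow_one]
  have hterm : ∀ i : ℕ, ENNReal.ofReal ((1 / 2) ^ i) * min 1 (((2 : ℝ≥0∞) ^ Q) ^ i * B) =
      ENNReal.ofReal ((1 / 2) ^ i * min 1 ((2 ^ i * β) ^ Q)) := fun i => by
    rw [ENNReal.ofReal_mul (by positivity)]
    congr 1
    rw [ENNReal.ofReal_min, ENNReal.ofReal_one, hBβ]
    congr 1
    rw [Real.mul_rpow (by positivity) hβ0, ENNReal.ofReal_mul (by positivity)]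
    congr 1
    rw [← Real.rpow_natCast, ← Real.rpow_mul two_pos.le, mul_comm, Real.rpow_mul two_pos.le,
      Real.rpow_natCast, ENNReal.ofReal_pow (by positivity),
      ← ENNReal.ofReal_rpow_of_pos two_pos]
    simp
  simp_rw [hterm]
  rw [hBβ', show (6 : ℝ≥0∞) = ENNReal.ofReal 6 by simp, ← ENNReal.ofReal_mul (by norm_num)]
  refine ENNReal.tsum_le_of_sum_range_le fun n => ?_
  rw [← ENNReal.ofReal_sum_of_nonneg fun i _ => by positivity]
  exact ENNReal.ofReal_le_ofReal (sum_half_pow_mul_min_le hQ hβ0 n)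

/-! ### Pointwise bound by telescoping averages -/

section Telescoping

variable {N m : ℕ} {X : Fin m → EuclideanSpace ℝ (Fin N) → EuclideanSpace ℝ (Fin N)}
  {Ω : Set (EuclideanSpace ℝ (Fin N))} {Q : ℝ}

namespace XAdmissible

theorem volume_real_ccBall_pos (hX : XAdmissible X Ω Q) {x : EuclideanSpace ℝ (Fin N)}
    (hx : x ∈ Ω) {r : ℝ} (hr : 0 < r) : 0 < volume.real (ccBall X Ω x r) :=
  ENNReal.toReal_pos (hX.doubling x hx r hr).1.ne' (hX.volume_ccBall_ne_top x r)

theorem integrableOn_ccBall (hX : XAdmissible X Ω Q) {F : Type*} [NormedAddCommGroup F]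
    {φ : EuclideanSpace ℝ (Fin N) → F} (hφ : Continuous φ) (x : EuclideanSpace ℝ (Fin N)) (r : ℝ) :
    IntegrableOn φ (ccBall X Ω x r) := by
  have hK : IsCompact (closure Ω) := hX.isBounded.isCompact_closure
  exact (hφ.continuousOn.integrableOn_compact hK).mono_set
    ((ccBall_subset x r).trans subset_closure)

theorem tendsto_average_ccBall (hX : XAdmissible X Ω Q) {φ : EuclideanSpace ℝ (Fin N) → ℝ}
    (hφ : Continuous φ) {x : EuclideanSpace ℝ (Fin N)} (hx : x ∈ Ω) {r : ℕ → ℝ}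
    (hr : ∀ n, 0 < r n) (hr0 : Tendsto r atTop (𝓝 0)) :
    Tendsto (fun n => ⨍ y in ccBall X Ω x (r n), φ y) atTop (𝓝 (φ x)) := by
  rw [Metric.nhds_basis_closedBall.tendsto_right_iff]
  intro ε hε
  obtain ⟨δ, hδ, hδφ⟩ := Metric.continuous_iff.1 hφ x ε hε
  obtain ⟨η, hη, hηd⟩ := exists_ccDist_lt_imp_norm_sub_lt hX.continuous x hδ
  filter_upwards [hr0.eventually (gt_mem_nhds hη)] with n hn
  refine (convex_closedBall (φ x) ε).set_average_mem Metric.isClosed_closedBall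
    (hX.doubling x hx _ (hr n)).1.ne' (hX.volume_ccBall_ne_top x _) ?_
    (hX.integrableOn_ccBall hφ x _)
  refine ae_restrict_of_forall_mem (hX.isOpen_ccBall hx _).measurableSet fun y hy => ?_
  refine (hδφ y ?_).le
  rw [dist_eq_norm]
  exact hηd y (hy.2.trans_le (ENNReal.ofReal_le_ofReal hn.le))

theorem abs_average_sub_average_le (hX : XAdmissible X Ω Q) {φ : EuclideanSpace ℝ (Fin N) → ℝ}
    (hφ : Continuous φ) {x : EuclideanSpace ℝ (Fin N)} (hx : x ∈ Ω) {r : ℝ} (hr : 0 < r) :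
    |(⨍ y in ccBall X Ω x r, φ y) - ⨍ y in ccBall X Ω x (2 * r), φ y| ≤
      2 ^ Q * ⨍ y in ccBall X Ω x (2 * r), |φ y - ⨍ z in ccBall X Ω x (2 * r), φ z| := by
  set a := ⨍ z in ccBall X Ω x (2 * r), φ z with ha
  have hv := hX.volume_real_ccBall_pos hx hr
  have hv2 := hX.volume_real_ccBall_pos hx (show 0 < 2 * r by positivity)
  have h1 : (⨍ y in ccBall X Ω x r, φ y) - a = ⨍ y in ccBall X Ω x r, (φ y - a) := by
    rw [average_eq, average_eq, integral_sub (hX.integrableOn_ccBall hφ x r)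
      (integrableOn_const (hX.volume_ccBall_ne_top x r)), setIntegral_const,
      measureReal_restrict_apply_univ, smul_eq_mul, smul_eq_mul, smul_eq_mul, mul_sub,
      inv_mul_cancel_left₀ hv.ne']
  have hint : ∀ s, IntegrableOn (fun y => |φ y - a|) (ccBall X Ω x s) := fun s =>
    hX.integrableOn_ccBall (by fun_prop) x s
  have hdoub : volume.real (ccBall X Ω x (2 * r)) ≤ 2 ^ Q * volume.real (ccBall X Ω x r) := by
    have := ENNReal.toReal_mono (ENNReal.mul_ne_top (ENNReal.rpow_ne_top_of_nonneg
      (by linarith [hX.two_lt]) (by norm_num)) (hX.volume_ccBall_ne_top x r))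
      (hX.doubling x hx r hr).2
    rw [ENNReal.toReal_mul, ← ENNReal.toReal_rpow] at this
    simpa [Measure.real] using this
  rw [h1, average_eq, average_eq, measureReal_restrict_apply_univ, measureReal_restrict_apply_univ,
    smul_eq_mul, smul_eq_mul, abs_mul, abs_of_pos (inv_pos.2 hv), ← mul_assoc]
  refine mul_le_mul ?_ ?_ (abs_nonneg _) (by positivity)
  · rw [inv_eq_one_div, ← div_eq_mul_inv, div_le_div_iff₀ hv hv2, one_mul]
    exact hdoub
  · refine (abs_integral_le_integral_abs).trans ?_
    exact setIntegral_mono_set (hint _) (ae_of_all _ fun _ => abs_nonneg _)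
      (ccBall_mono x (by linarith)).eventuallyLE

/-- The averages over B(x, R 2^{-i}) start at the mean over Ω and converge to φ(x). Doubling bounds
consecutive differences by the mean oscillation on the larger ball, and Poincaré bounds that with
the factor 2^{-i} coming from the radius. -/
theorem exists_pointwise_bound (hX : XAdmissible X Ω Q) {R : ℝ} (hR0 : 0 < R)
    (hR : ∀ x ∈ Ω, ∀ y ∈ Ω, ccDist X x y < ENNReal.ofReal R) :
    ∃ C > (0 : ℝ), ∃ ν > (0 : ℝ), ∀ φ, ContDiff ℝ 1 φ → ∀ x ∈ Ω,
      ‖φ x - ⨍ y in Ω, φ y‖ₑ ≤ ∑' i : ℕ, ENNReal.ofReal (C * (1 / 2) ^ i) *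
        ((volume (ccBall X Ω x (ν * (R / 2 ^ i))))⁻¹ *
          ∫⁻ y in ccBall X Ω x (ν * (R / 2 ^ i)), ‖xGrad X φ y‖ₑ) := by
  obtain ⟨CP, hCP, ν, hν, hP⟩ := hX.poincare
  refine ⟨2 ^ Q * (CP * R), by positivity, ν, hν, fun φ hφ x hx => ?_⟩
  have hri : ∀ i : ℕ, 0 < R / 2 ^ i := fun i => by positivity
  have hlim : Tendsto (fun i : ℕ => R / 2 ^ i) atTop (𝓝 0) :=
    tendsto_const_nhds.div_atTop (tendsto_pow_atTop_atTop_of_one_lt one_lt_two)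
  have key := edist_le_tsum_of_edist_le_of_tendsto₀ (f := fun i : ℕ =>
    ⨍ y in ccBall X Ω x (R / 2 ^ i), φ y) (fun i : ℕ => ENNReal.ofReal (2 ^ Q * (CP * R) *
      (1 / 2) ^ i) * ((volume (ccBall X Ω x (ν * (R / 2 ^ i))))⁻¹ *
          ∫⁻ y in ccBall X Ω x (ν * (R / 2 ^ i)), ‖xGrad X φ y‖ₑ)) (fun i => ?_)
    (hX.tendsto_average_ccBall hφ.continuous hx hri hlim)
  · rw [pow_zero, div_one, ccBall_eq_of_forall_ccDist_lt hR hx le_rfl, edist_comm, edist_eq_enorm_sub] at key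
    exact key
  · have e : R / 2 ^ i = 2 * (R / 2 ^ (i + 1)) := by rw [pow_succ]; field_simp
    have h1 := hX.abs_average_sub_average_le hφ.continuous hx (hri (i + 1))
    rw [← e] at h1
    have h2 := hP x hx (R / 2 ^ i) (hri i) univ φ isOpen_univ (subset_univ _) hφ.contDiffOn
    have hρ : 0 < ν * (R / 2 ^ i) := mul_pos hν (hri i)
    have hav : ENNReal.ofReal (⨍ y in ccBall X Ω x (ν * (R / 2 ^ i)), ‖xGrad X φ y‖) =
        (volume (ccBall X Ω x (ν * (R / 2 ^ i))))⁻¹ *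
          ∫⁻ y in ccBall X Ω x (ν * (R / 2 ^ i)), ‖xGrad X φ y‖ₑ := by
      rw [average_eq, measureReal_restrict_apply_univ, smul_eq_mul,
        ENNReal.ofReal_mul (inv_nonneg.2 measureReal_nonneg),
        ofReal_integral_norm_eq_lintegral_enorm (hX.integrableOn_ccBall
          (continuous_xGrad hX.continuous hφ) x _),
        ENNReal.ofReal_inv_of_pos (hX.volume_real_ccBall_pos hx hρ), ofReal_measureReal
          (hX.volume_ccBall_ne_top x _)]
    rw [← hav, ← ENNReal.ofReal_mul (by positivity), edist_comm, edist_dist, Real.dist_eq]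
    refine ENNReal.ofReal_le_ofReal (h1.trans ?_)
    refine (mul_le_mul_of_nonneg_left h2 (by positivity)).trans (le_of_eq ?_)
    rw [one_div, inv_pow]
    ring

end XAdmissible

end Telescoping

/-! ### Weak Sobolev inequality for test functions -/

section Sobolev

variable {N m : ℕ} {X : Fin m → EuclideanSpace ℝ (Fin N) → EuclideanSpace ℝ (Fin N)}
  {Ω : Set (EuclideanSpace ℝ (Fin N))} {Q : ℝ}

namespace XAdmissible

theorem two_rpow_ne_zero : (2 : ℝ≥0∞) ^ Q ≠ 0 := (ENNReal.rpow_pos (by norm_num) (by norm_num)).ne'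

theorem two_rpow_ne_top (hX : XAdmissible X Ω Q) : (2 : ℝ≥0∞) ^ Q ≠ ∞ :=
  ENNReal.rpow_ne_top_of_nonneg (by linarith [hX.two_lt]) (by norm_num)

/-- Interchanging the centre and the variable point of an average. -/
theorem lintegral_average_le (hX : XAdmissible X Ω Q) {ρ : ℝ} (hρ : 0 < ρ) {κ : ℝ≥0∞}
    (hκ : ∀ y ∈ Ω, volume Ω ≤ κ * volume (ccBall X Ω y ρ))
    {E : Set (EuclideanSpace ℝ (Fin N))} (hE : MeasurableSet E) (hEΩ : E ⊆ Ω)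
    {g : EuclideanSpace ℝ (Fin N) → ℝ≥0∞} (hg : Measurable g) :
    ∫⁻ x in E, (volume (ccBall X Ω x ρ))⁻¹ * ∫⁻ y in ccBall X Ω x ρ, g y ≤
      (2 : ℝ≥0∞) ^ Q * min 1 (κ * (volume E / volume Ω)) * ∫⁻ y in Ω, g y := by
  rcases Ω.eq_empty_or_nonempty with rfl | ⟨x₀, hx₀⟩
  · rw [subset_empty_iff.1 hEΩ]; simp
  have hΩ0 : volume Ω ≠ 0 := (hX.isOpen.measure_pos _ ⟨x₀, hx₀⟩).ne'
  -- S is symmetric, so after Tonelli x ranges over a ball about y. Doubling replaces |B(x, ρ)| by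
  -- |B(y, ρ)| at the cost of 2^Q, which leaves |B(y, ρ) ∩ E| / |B(y, ρ)|. The two entries of the
  -- minimum are the two obvious bounds for this ratio.
  set S := {p : EuclideanSpace ℝ (Fin N) × EuclideanSpace ℝ (Fin N) |
      p.1 ∈ Ω ∧ p.2 ∈ Ω ∧ ccDist X p.1 p.2 < ENNReal.ofReal ρ} with hS
  have hSm : MeasurableSet S := (hX.isOpen_setOf_ccDist_lt _).measurableSet
  have hSsym : ∀ x y, (x, y) ∈ S ↔ (y, x) ∈ S := fun x y => by
    simp only [hS, mem_ofPred_eq]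
    rw [ccDist_comm hX.continuous]
    tauto
  have hSx : ∀ x ∈ Ω, Prod.mk x ⁻¹' S = ccBall X Ω x ρ := fun x hx => by
    ext y; simp [hS, ccBall, hx]
  set w : EuclideanSpace ℝ (Fin N) → ℝ≥0∞ := fun x => (volume (Prod.mk x ⁻¹' S))⁻¹ with hw
  have hwm : Measurable w := (measurable_measure_prodMk_left hSm).inv
  have hbm : ∀ x ∈ Ω, MeasurableSet (ccBall X Ω x ρ) := fun x hx =>
    (hX.isOpen_ccBall hx ρ).measurableSet
  calc ∫⁻ x in E, (volume (ccBall X Ω x ρ))⁻¹ * ∫⁻ y in ccBall X Ω x ρ, g y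
      = ∫⁻ x in E, ∫⁻ y in Ω, w x * (S.indicator (fun p => g p.2) (x, y)) := by
        refine setLIntegral_congr_fun hE fun x hx => ?_
        have hx' := hEΩ hx
        simp only [hw]
        rw [hSx x hx', lintegral_const_mul']
        · congr 1
          rw [← lintegral_indicator (hbm x hx'), ← lintegral_indicator hX.isOpen.measurableSet]
          refine lintegral_congr fun y => ?_
          by_cases hy : y ∈ ccBall X Ω x ρ
          · have : (x, y) ∈ S := by rw [← hSx x hx'] at hy; exact hy
            rw [indicator_of_mem hy, indicator_of_mem hy.1, indicator_of_mem this]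
          · have : (x, y) ∉ S := by rw [← hSx x hx'] at hy; exact hy
            rw [indicator_of_notMem hy]
            by_cases hyΩ : y ∈ Ω
            · rw [indicator_of_mem hyΩ, indicator_of_notMem this]
            · rw [indicator_of_notMem hyΩ]
        · exact ENNReal.inv_ne_top.2 (hX.doubling x hx' ρ hρ).1.ne'
    _ = ∫⁻ y in Ω, ∫⁻ x in E, w x * (S.indicator (fun p => g p.2) (x, y)) := by
        apply lintegral_lintegral_swap
        exact ((hwm.comp measurable_fst).mul
          ((hg.comp measurable_snd).indicator hSm)).aemeasurable
    _ ≤ ∫⁻ y in Ω, ((2 : ℝ≥0∞) ^ Q * min 1 (κ * (volume E / volume Ω))) * g y := by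
        refine setLIntegral_mono' hX.isOpen.measurableSet fun y hy => ?_
        have hv0 := (hX.doubling y hy ρ hρ).1.ne'
        have hvt := hX.volume_ccBall_ne_top y ρ
        have hle : ∀ x ∈ E, w x * (S.indicator (fun p => g p.2) (x, y)) ≤
            (ccBall X Ω y ρ).indicator
              (fun _ => (2 : ℝ≥0∞) ^ Q * (volume (ccBall X Ω y ρ))⁻¹ * g y) x := by
          intro x hx
          by_cases hxy : (x, y) ∈ S
          · have hx' := hEΩ hx
            have hxB : x ∈ ccBall X Ω y ρ := by
              rw [← hSx y hy]; exact (hSsym x y).1 hxy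
            rw [indicator_of_mem hxy, indicator_of_mem hxB]
            simp only [hw]
            rw [hSx x hx']
            gcongr
            have hsub : ccBall X Ω y ρ ⊆ ccBall X Ω x (2 * ρ) := by
              rintro z ⟨hz, hzd⟩
              refine ⟨hz, (ccDist_triangle hX.continuous x y z).trans_lt ?_⟩
              rw [two_mul, ENNReal.ofReal_add hρ.le hρ.le]
              exact ENNReal.add_lt_add hxy.2.2 hzd
            have h1 := (measure_mono hsub).trans (hX.doubling x hx' ρ hρ).2
            rw [ENNReal.inv_le_iff_inv_le, ENNReal.mul_inv (Or.inl two_rpow_ne_zero)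
              (Or.inl hX.two_rpow_ne_top), inv_inv, mul_comm, ← div_eq_mul_inv]
            exact ENNReal.div_le_of_le_mul' h1
          · rw [indicator_of_notMem hxy, mul_zero]
            exact zero_le
        calc ∫⁻ x in E, w x * (S.indicator (fun p => g p.2) (x, y))
            ≤ ∫⁻ x in E, (ccBall X Ω y ρ).indicator
              (fun _ => (2 : ℝ≥0∞) ^ Q * (volume (ccBall X Ω y ρ))⁻¹ * g y) x :=
              setLIntegral_mono' hE hle
          _ = (2 : ℝ≥0∞) ^ Q * (volume (ccBall X Ω y ρ))⁻¹ * g y *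
              volume (ccBall X Ω y ρ ∩ E) := by
              rw [lintegral_indicator (hbm y hy), lintegral_const,
                Measure.restrict_restrict (hbm y hy), Measure.restrict_apply_univ]
          _ = (2 : ℝ≥0∞) ^ Q * (volume (ccBall X Ω y ρ ∩ E) / volume (ccBall X Ω y ρ)) * g y := by
              rw [div_eq_mul_inv]; ring
          _ ≤ _ := by
              gcongr
              refine le_min ?_ ?_
              · exact ENNReal.div_le_of_le_mul (by rw [one_mul]; exact measure_mono inter_subset_left)
              · refine ENNReal.div_le_of_le_mul ?_
                calc volume (ccBall X Ω y ρ ∩ E) ≤ volume E := measure_mono inter_subset_right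
                  _ = volume E / volume Ω * volume Ω :=
                    (ENNReal.div_mul_cancel hΩ0 hX.volume_lt_top.ne).symm
                  _ ≤ volume E / volume Ω * (κ * volume (ccBall X Ω y ρ)) := by
                    gcongr; exact hκ y hy
                  _ = _ := by ring
    _ = _ := lintegral_const_mul _ hg

/-- The Sobolev inequality for smooth functions vanishing on the boundary, in weak form. -/
theorem exists_sobolev (hX : XAdmissible X Ω Q) (hN : 0 < N) :
    ∃ C > (0 : ℝ), ∀ φ, IsTestFun Ω φ → ∀ E ⊆ Ω, MeasurableSet E →
      ∫⁻ x in E, ‖φ x‖ₑ ≤ ENNReal.ofReal C * volume E ^ (1 / Q) * ∫⁻ x in Ω, ‖xGrad X φ x‖ₑ := by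
  rcases Ω.eq_empty_or_nonempty with rfl | ⟨x₀, hx₀⟩
  · refine ⟨1, one_pos, fun φ _ E hE _ => ?_⟩
    rw [subset_empty_iff.1 hE]; simp
  have hΩ0 : volume Ω ≠ 0 := (hX.isOpen.measure_pos _ ⟨x₀, hx₀⟩).ne'
  have hΩt := hX.volume_lt_top.ne
  have hQ := hX.two_lt
  obtain ⟨R, hR0, hR⟩ := hX.exists_diam
  obtain ⟨C₁, hC₁, ν, hν, hpt⟩ := hX.exists_pointwise_bound hR0 hR
  obtain ⟨C₂, hC₂, hmean⟩ := hX.exists_abs_integral_le hN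
  -- ν may be less than 1. Then k further doublings recover the lower volume bound for balls of
  -- radius ν R 2^{-i}.
  obtain ⟨k, hk⟩ : ∃ k : ℕ, 1 ≤ 2 ^ k * ν := by
    obtain ⟨k, hk⟩ := pow_unbounded_of_one_lt (1 / ν) one_lt_two
    exact ⟨k, ((div_lt_iff₀ hν).1 hk).le⟩
  set q : ℝ≥0∞ := (2 : ℝ≥0∞) ^ Q with hq
  have hq0 : q ≠ 0 := two_rpow_ne_zero
  have hqt : q ≠ ∞ := hX.two_rpow_ne_top
  have hκ : ∀ i : ℕ, ∀ y ∈ Ω, volume Ω ≤ (q ^ i * q ^ k) * volume (ccBall X Ω y (ν * (R / 2 ^ i))) := by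
    intro i y hy
    have h1 := hX.volume_ccBall_two_pow_mul_le hy (r := ν * (R / 2 ^ i)) (by positivity) k
    refine (hX.volume_le_volume_ccBall hR0 hR hy i).trans ?_
    rw [mul_assoc]
    gcongr
    refine (measure_mono (ccBall_mono y ?_)).trans h1
    rw [← mul_assoc]
    exact le_mul_of_one_le_left (by positivity) hk
  -- The first summand is for the oscillation of φ about its mean over Ω, the second for the mean
  -- itself.
  set K : ℝ≥0∞ := (ENNReal.ofReal C₁ * q * (6 * (q ^ k) ^ (1 / Q)) + ENNReal.ofReal C₂) *
    ((volume Ω)⁻¹) ^ (1 / Q) with hK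
  have hKt : K ≠ ∞ := by
    refine ENNReal.mul_ne_top (ENNReal.add_ne_top.2 ⟨?_, ENNReal.ofReal_ne_top⟩)
      (ENNReal.rpow_ne_top_of_nonneg (by positivity) (ENNReal.inv_ne_top.2 hΩ0))
    refine ENNReal.mul_ne_top (ENNReal.mul_ne_top ENNReal.ofReal_ne_top hqt)
      (ENNReal.mul_ne_top (by norm_num) (ENNReal.rpow_ne_top_of_nonneg (by positivity)
        (ENNReal.pow_ne_top hqt)))
  refine ⟨K.toReal + 1, by positivity, fun φ hφ E hEΩ hE => ?_⟩
  have hφ1 : ContDiff ℝ 1 φ := hφ.1.of_le (by simp)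
  set G := ∫⁻ x in Ω, ‖xGrad X φ x‖ₑ with hG
  have hgm : Measurable fun x => ‖xGrad X φ x‖ₑ :=
    (continuous_xGrad hX.continuous hφ1).enorm.measurable
  set b := volume E / volume Ω with hb
  have hb1 : b ≤ 1 := ENNReal.div_le_of_le_mul (by rw [one_mul]; exact measure_mono hEΩ)
  have hbQ : b ≤ b ^ (1 / Q) := by
    conv_lhs => rw [← ENNReal.rpow_one b]
    exact ENNReal.rpow_le_rpow_of_exponent_ge hb1 (by rw [div_le_one (by linarith)]; linarith)
  set a := ⨍ y in Ω, φ y with ha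
  have hosc : ∫⁻ x in E, ‖φ x - a‖ₑ ≤ ENNReal.ofReal C₁ * q * (6 * (q ^ k) ^ (1 / Q)) *
      b ^ (1 / Q) * G := by
    have hSm : ∀ i : ℕ, AEMeasurable (fun x => ENNReal.ofReal (C₁ * (1 / 2) ^ i) *
        ((volume (ccBall X Ω x (ν * (R / 2 ^ i))))⁻¹ *
          ∫⁻ y in ccBall X Ω x (ν * (R / 2 ^ i)), ‖xGrad X φ y‖ₑ)) (volume.restrict E) := by
      intro i
      set S := {p : EuclideanSpace ℝ (Fin N) × EuclideanSpace ℝ (Fin N) |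
        p.1 ∈ Ω ∧ p.2 ∈ Ω ∧ ccDist X p.1 p.2 < ENNReal.ofReal (ν * (R / 2 ^ i))} with hS
      have hSm : MeasurableSet S := (hX.isOpen_setOf_ccDist_lt _).measurableSet
      have hSx : ∀ x ∈ E, Prod.mk x ⁻¹' S = ccBall X Ω x (ν * (R / 2 ^ i)) := fun x hx => by
        ext y; simp [hS, ccBall, hEΩ hx]
      have hm : Measurable fun x => ENNReal.ofReal (C₁ * (1 / 2) ^ i) *
        ((volume (Prod.mk x ⁻¹' S))⁻¹ * ∫⁻ y, S.indicator (fun p => ‖xGrad X φ p.2‖ₑ) (x, y)) :=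
        ((measurable_measure_prodMk_left hSm).inv.mul
          (((hgm.comp measurable_snd).indicator hSm).lintegral_prod_right')).const_mul _
      refine hm.aemeasurable.congr (ae_restrict_of_forall_mem hE fun x hx => ?_)
      simp only
      rw [hSx x hx, ← lintegral_indicator ((hX.isOpen_ccBall (hEΩ hx) _).measurableSet), ← hSx x hx]
      rfl
    calc ∫⁻ x in E, ‖φ x - a‖ₑ
        ≤ ∫⁻ x in E, ∑' i : ℕ, ENNReal.ofReal (C₁ * (1 / 2) ^ i) *
        ((volume (ccBall X Ω x (ν * (R / 2 ^ i))))⁻¹ *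
          ∫⁻ y in ccBall X Ω x (ν * (R / 2 ^ i)), ‖xGrad X φ y‖ₑ) :=
          setLIntegral_mono' hE fun x hx => hpt φ hφ1 x (hEΩ hx)
      _ = ∑' i : ℕ, ENNReal.ofReal (C₁ * (1 / 2) ^ i) * ∫⁻ x in E,
        ((volume (ccBall X Ω x (ν * (R / 2 ^ i))))⁻¹ *
          ∫⁻ y in ccBall X Ω x (ν * (R / 2 ^ i)), ‖xGrad X φ y‖ₑ) := by
          rw [lintegral_tsum hSm]
          refine tsum_congr fun i => lintegral_const_mul' _ _ ENNReal.ofReal_ne_top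
      _ ≤ ∑' i : ℕ, ENNReal.ofReal (C₁ * (1 / 2) ^ i) *
          (q * min 1 ((q ^ i * q ^ k) * b) * G) := by
          refine ENNReal.tsum_le_tsum fun i => ?_
          gcongr
          exact hX.lintegral_average_le (by positivity) (hκ i) hE hEΩ hgm
      _ = ENNReal.ofReal C₁ * q * (∑' i : ℕ, ENNReal.ofReal ((1 / 2) ^ i) *
            min 1 (q ^ i * (q ^ k * b))) * G := by
          rw [mul_assoc _ _ G, ← ENNReal.tsum_mul_right, ← ENNReal.tsum_mul_left]
          refine tsum_congr fun i => ?_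
          rw [ENNReal.ofReal_mul hC₁.le, mul_assoc (q ^ i)]
          ring
      _ ≤ ENNReal.ofReal C₁ * q * (6 * (q ^ k * b) ^ (1 / Q)) * G := by
          gcongr
          exact tsum_half_pow_mul_min_le hQ.le (ENNReal.mul_ne_top (ENNReal.pow_ne_top hqt)
            (hb1.trans_lt ENNReal.one_lt_top).ne)
      _ = _ := by
          rw [ENNReal.mul_rpow_of_nonneg _ _ (by positivity)]
          ring
  have hconst : ∫⁻ _ in E, ‖a‖ₑ ≤ ENNReal.ofReal C₂ * b ^ (1 / Q) * G := by
    have h1 : ‖a‖ₑ ≤ (volume Ω)⁻¹ * (ENNReal.ofReal C₂ * G) := by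
      have hv : 0 < volume.real Ω := ENNReal.toReal_pos hΩ0 hΩt
      rw [ha, average_eq, measureReal_restrict_apply_univ, smul_eq_mul, enorm_mul,
        Real.enorm_of_nonneg (inv_nonneg.2 hv.le), ENNReal.ofReal_inv_of_pos hv,
        ofReal_measureReal hΩt]
      gcongr
      rw [hG, ← ofReal_integral_norm_eq_lintegral_enorm
        (((continuous_xGrad hX.continuous hφ1).integrable_of_hasCompactSupport
        (hasCompactSupport_xGrad hφ.2.1)).integrableOn), ← ENNReal.ofReal_mul hC₂.le,
        ← ofReal_norm]
      exact ENNReal.ofReal_le_ofReal (hmean φ hφ)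
    rw [setLIntegral_const]
    calc ‖a‖ₑ * volume E ≤ ((volume Ω)⁻¹ * (ENNReal.ofReal C₂ * G)) * volume E := by gcongr
      _ = ENNReal.ofReal C₂ * b * G := by rw [hb, div_eq_mul_inv]; ring
      _ ≤ _ := by gcongr
  calc ∫⁻ x in E, ‖φ x‖ₑ ≤ ∫⁻ x in E, (‖φ x - a‖ₑ + ‖a‖ₑ) := by
        refine lintegral_mono fun x => ?_
        calc ‖φ x‖ₑ = ‖φ x - a + a‖ₑ := by rw [sub_add_cancel]
          _ ≤ _ := enorm_add_le _ _
    _ = (∫⁻ x in E, ‖φ x - a‖ₑ) + ∫⁻ _ in E, ‖a‖ₑ := lintegral_add_right _ measurable_const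
    _ ≤ ENNReal.ofReal C₁ * q * (6 * (q ^ k) ^ (1 / Q)) * b ^ (1 / Q) * G +
        ENNReal.ofReal C₂ * b ^ (1 / Q) * G := add_le_add hosc hconst
    _ = K * volume E ^ (1 / Q) * G := by
        rw [hK, hb, div_eq_mul_inv (volume E), ENNReal.mul_rpow_of_nonneg _ _ (by positivity)]
        ring
    _ ≤ _ := by
        gcongr
        rw [← ENNReal.ofReal_toReal hKt]
        exact ENNReal.ofReal_le_ofReal (by simp)

end XAdmissible

end Sobolev

/-! ### Auxiliary facts on L^2 -/

section LTwo

variable {α F G : Type*} [MeasurableSpace α] {μ : Measure α} [NormedAddCommGroup F]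
  [NormedAddCommGroup G]

theorem eLpNorm_two_sq (f : α → F) : eLpNorm f 2 μ ^ 2 = ∫⁻ x, ‖f x‖ₑ ^ 2 ∂μ := by
  have := eLpNorm_nnreal_pow_eq_lintegral (μ := μ) (f := f) (p := 2) two_ne_zero
  simpa using this

theorem lintegral_enorm_mul_enorm_le {f : α → F} {g : α → G} (hf : AEStronglyMeasurable f μ)
    (hg : AEStronglyMeasurable g μ) :
    ∫⁻ x, ‖f x‖ₑ * ‖g x‖ₑ ∂μ ≤ eLpNorm f 2 μ * eLpNorm g 2 μ := by
  have h := ENNReal.lintegral_mul_le_Lp_mul_Lq μ Real.HolderConjugate.two_two hf.enorm hg.enorm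
  rw [eLpNorm_eq_lintegral_rpow_enorm_toReal (by norm_num) (by norm_num),
    eLpNorm_eq_lintegral_rpow_enorm_toReal (by norm_num) (by norm_num)]
  simpa using h

theorem lintegral_enorm_le_eLpNorm_two {f : α → F} (hf : AEStronglyMeasurable f μ) :
    ∫⁻ x, ‖f x‖ₑ ∂μ ≤ eLpNorm f 2 μ * μ univ ^ (1 / 2 : ℝ) := by
  have h := eLpNorm_le_eLpNorm_mul_rpow_measure_univ (p := 1) (q := 2) (by norm_num) hf
  rw [eLpNorm_one_eq_lintegral_enorm] at h
  convert h using 2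
  norm_num

theorem tendsto_eLpNorm_two_of_dominated {f : ℕ → α → F} {g : α → F}
    (hf : ∀ n, AEStronglyMeasurable (f n) μ) {h : α → G} (hh : MemLp h 2 μ) {c : ℝ}
    (hb : ∀ n, ∀ᵐ x ∂μ, ‖f n x - g x‖ ≤ c * ‖h x‖) (hg : AEStronglyMeasurable g μ)
    (hlim : ∀ᵐ x ∂μ, Tendsto (fun n => f n x) atTop (𝓝 (g x))) :
    Tendsto (fun n => eLpNorm (fun x => f n x - g x) 2 μ) atTop (𝓝 0) := by
  have hfin : ∫⁻ x, (ENNReal.ofReal c * ‖h x‖ₑ) ^ 2 ∂μ ≠ ∞ := by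
    simp_rw [mul_pow]
    rw [lintegral_const_mul' _ _ (ENNReal.pow_ne_top ENNReal.ofReal_ne_top), ← eLpNorm_two_sq]
    exact ENNReal.mul_ne_top (ENNReal.pow_ne_top ENNReal.ofReal_ne_top)
      (ENNReal.pow_ne_top hh.eLpNorm_ne_top)
  have h1 : Tendsto (fun n => ∫⁻ x, ‖f n x - g x‖ₑ ^ 2 ∂μ) atTop (𝓝 (∫⁻ x, 0 ∂μ)) := by
    refine tendsto_lintegral_of_dominated_convergence' _
      (fun n => ((hf n).sub hg).enorm.pow_const 2) (fun n => ?_) hfin ?_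
    · filter_upwards [hb n] with x hx
      gcongr
      rw [← ofReal_norm, ← ofReal_norm]
      rw [← ENNReal.ofReal_mul' (norm_nonneg _)]
      exact ENNReal.ofReal_le_ofReal hx
    · filter_upwards [hlim] with x hx
      have h2 : Tendsto (fun n => ‖f n x - g x‖ₑ) atTop (𝓝 0) := by
        have := (hx.sub_const (g x)).enorm
        simpa using this
      have h3 := (ENNReal.continuous_pow 2).tendsto 0 |>.comp h2
      simpa [Function.comp_def] using h3
  simp_rw [← eLpNorm_two_sq (fun x => f _ x - g x), lintegral_zero] at h1
  have h2 := (ENNReal.continuous_rpow_const (y := (1 / 2 : ℝ))).tendsto 0 |>.comp h1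
  have e : ∀ a : ℝ≥0∞, (a ^ 2) ^ (2⁻¹ : ℝ) = a := fun a => by
    rw [← ENNReal.rpow_natCast, ← ENNReal.rpow_mul]; norm_num
  simpa [Function.comp_def, e] using h2

end LTwo

/-! ### Chain rule, Sobolev and Poincaré inequalities in W_0^{1,2} -/

section W0

variable {N m : ℕ} {X : Fin m → EuclideanSpace ℝ (Fin N) → EuclideanSpace ℝ (Fin N)}
  {Ω : Set (EuclideanSpace ℝ (Fin N))} {Q : ℝ}

theorem IsTestFun.memLp {φ : EuclideanSpace ℝ (Fin N) → ℝ} (hφ : IsTestFun Ω φ) (p : ℝ≥0∞) :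
    MemLp φ p (volume.restrict Ω) :=
  (hφ.1.continuous.memLp_of_hasCompactSupport hφ.2.1).restrict Ω

theorem IsTestFun.memLp_xGrad (hX : ∀ j, Continuous (X j)) {φ : EuclideanSpace ℝ (Fin N) → ℝ}
    (hφ : IsTestFun Ω φ) (p : ℝ≥0∞) : MemLp (xGrad X φ) p (volume.restrict Ω) :=
  ((continuous_xGrad hX (hφ.1.of_le (by simp))).memLp_of_hasCompactSupport
    (hasCompactSupport_xGrad hφ.2.1)).restrict Ω

theorem IsTestFun.comp {φ : EuclideanSpace ℝ (Fin N) → ℝ} (hφ : IsTestFun Ω φ) {T : ℝ → ℝ}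
    (hT : ContDiff ℝ ((⊤ : ℕ∞) : WithTop ℕ∞) T) (hT0 : T 0 = 0) : IsTestFun Ω (T ∘ φ) :=
  ⟨hT.comp hφ.1, hφ.2.1.comp_left hT0,
    (closure_mono (Function.support_comp_subset hT0 φ)).trans hφ.2.2⟩

theorem xGrad_comp {φ : EuclideanSpace ℝ (Fin N) → ℝ} (hφ : Differentiable ℝ φ) {T : ℝ → ℝ}
    (hT : Differentiable ℝ T) (z : EuclideanSpace ℝ (Fin N)) :
    xGrad X (T ∘ φ) z = deriv T (φ z) • xGrad X φ z := by
  ext j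
  have := ((hT (φ z)).hasDerivAt.comp_hasFDerivAt z (hφ z).hasFDerivAt).fderiv
  simp [xGrad, this]

/-- The chain rule in `W_0^{1,2}(Ω, X)`. -/
theorem HasXGradW0.comp (hX : ∀ j, Continuous (X j)) {u : EuclideanSpace ℝ (Fin N) → ℝ}
    {V : EuclideanSpace ℝ (Fin N) → EuclideanSpace ℝ (Fin m)} (h : HasXGradW0 X Ω 2 u V)
    {T : ℝ → ℝ} (hT : ContDiff ℝ ((⊤ : ℕ∞) : WithTop ℕ∞) T) (hT0 : T 0 = 0) {M : ℝ}
    (hM : ∀ s, |deriv T s| ≤ M) :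
    HasXGradW0 X Ω 2 (T ∘ u) (fun x => deriv T (u x) • V x) := by
  obtain ⟨hu, hV, φ, hφ, h1, h2⟩ := h
  have hφ' : ∀ n, IsTestFun Ω (φ n) := hφ
  have hTd : Differentiable ℝ T := hT.differentiable (by simp)
  have hT' : Continuous (deriv T) := (hT.of_le (show (1 : WithTop ℕ∞) ≤ _ by simp)).continuous_deriv
    le_rfl
  have hLip : ∀ s t, ‖T s - T t‖ ≤ M * ‖s - t‖ := fun s t =>
    Convex.norm_image_sub_le_of_norm_deriv_le (s := univ) (fun x _ => hTd x) (fun x _ => hM x)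
      convex_univ (mem_univ _) (mem_univ _)
  -- The gradient error is T'(φ_n) (Xφ_n - V) + (T'(φ_n) - T'(u)) V. The second term goes to 0 by
  -- dominated convergence, which asks for almost everywhere convergence and hence for a
  -- subsequence.
  have hmeas := tendstoInMeasure_of_tendsto_eLpNorm (p := 2) (by norm_num)
    (fun n => ((hφ' n).memLp 2).aestronglyMeasurable) hu.aestronglyMeasurable h1
  obtain ⟨ns, hns, hae⟩ := hmeas.exists_seq_tendsto_ae
  have hTV : AEStronglyMeasurable (fun x => deriv T (u x) • V x) (volume.restrict Ω) :=
    (hT'.comp_aestronglyMeasurable hu.aestronglyMeasurable).smul hV.aestronglyMeasurable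
  refine ⟨hu.of_le_mul (c := M) (hT.continuous.comp_aestronglyMeasurable hu.aestronglyMeasurable)
    (ae_of_all _ fun x => by simpa [hT0] using hLip (u x) 0), hV.of_le_mul (c := M) hTV
    (ae_of_all _ fun x => by
      rw [norm_smul]; exact mul_le_mul_of_nonneg_right (hM _) (norm_nonneg _)),
    fun n => T ∘ φ (ns n), fun n => (hφ' (ns n)).comp hT hT0, ?_, ?_⟩
  · have hz : Tendsto (fun n => ENNReal.ofReal M *
        eLpNorm (fun x => φ (ns n) x - u x) 2 (volume.restrict Ω)) atTop (𝓝 0) := by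
      have := ENNReal.Tendsto.const_mul (h1.comp hns.tendsto_atTop) (Or.inr (ENNReal.ofReal_ne_top (r := M)))
      simpa using this
    refine tendsto_of_tendsto_of_tendsto_of_le_of_le tendsto_const_nhds hz (fun _ => zero_le)
      fun n => ?_
    exact eLpNorm_le_mul_eLpNorm_of_ae_le_mul (ae_of_all _ fun x => hLip _ _) 2
  · have hz1 : Tendsto (fun n => ENNReal.ofReal M *
        eLpNorm (fun x => xGrad X (φ (ns n)) x - V x) 2 (volume.restrict Ω)) atTop (𝓝 0) := by
      have := ENNReal.Tendsto.const_mul (h2.comp hns.tendsto_atTop) (Or.inr (ENNReal.ofReal_ne_top (r := M)))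
      simpa using this
    have hsm : ∀ n, AEStronglyMeasurable (fun x => deriv T (φ (ns n) x) • V x)
        (volume.restrict Ω) := fun n =>
      (hT'.comp_aestronglyMeasurable ((hφ' (ns n)).memLp 2).aestronglyMeasurable).smul
        hV.aestronglyMeasurable
    have hz2 : Tendsto (fun n => eLpNorm (fun x => deriv T (φ (ns n) x) • V x -
        deriv T (u x) • V x) 2 (volume.restrict Ω)) atTop (𝓝 0) := by
      refine tendsto_eLpNorm_two_of_dominated hsm hV (c := 2 * M) (fun n => ae_of_all _ fun x => ?_)
        hTV ?_
      · rw [← sub_smul, norm_smul]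
        refine mul_le_mul_of_nonneg_right ?_ (norm_nonneg _)
        refine (norm_sub_le _ _).trans ?_
        have := add_le_add (hM (φ (ns n) x)) (hM (u x))
        rw [two_mul]
        exact this
      · filter_upwards [hae] with x hx
        exact ((hT'.tendsto _).comp hx).smul_const _
    have hz := hz1.add hz2
    rw [add_zero] at hz
    refine tendsto_of_tendsto_of_tendsto_of_le_of_le tendsto_const_nhds hz (fun _ => zero_le)
      fun n => ?_
    have hg := ((hφ' (ns n)).memLp_xGrad hX 2).aestronglyMeasurable
    have hsplit : (fun x => xGrad X (T ∘ φ (ns n)) x - deriv T (u x) • V x) =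
        (fun x => deriv T (φ (ns n) x) • (xGrad X (φ (ns n)) x - V x)) +
          fun x => deriv T (φ (ns n) x) • V x - deriv T (u x) • V x := by
      funext x
      rw [xGrad_comp ((hφ' (ns n)).1.differentiable (by simp)) hTd]
      simp only [Pi.add_apply, smul_sub]
      abel
    dsimp only
    rw [hsplit]
    refine (eLpNorm_add_le ?_ ((hsm n).sub hTV) (by norm_num)).trans ?_
    · exact (hT'.comp_aestronglyMeasurable ((hφ' (ns n)).memLp 2).aestronglyMeasurable).smul
        (hg.sub hV.aestronglyMeasurable)
    · refine add_le_add ?_ le_rfl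
      refine eLpNorm_le_mul_eLpNorm_of_ae_le_mul (ae_of_all _ fun x => ?_) 2
      rw [norm_smul]
      exact mul_le_mul_of_nonneg_right (hM _) (norm_nonneg _)

theorem HasXGradW0.neg {p : ℝ≥0∞} {u : EuclideanSpace ℝ (Fin N) → ℝ}
    {V : EuclideanSpace ℝ (Fin N) → EuclideanSpace ℝ (Fin m)} (h : HasXGradW0 X Ω p u V) :
    HasXGradW0 X Ω p (fun x => -u x) (fun x => -V x) := by
  obtain ⟨hu, hV, φ, hφ, h1, h2⟩ := h
  refine ⟨hu.neg, hV.neg, fun n x => -1 * φ n x, fun n => IsTestFun.const_mul (hφ n) (-1), ?_, ?_⟩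
  · refine h1.congr fun n => ?_
    rw [← eLpNorm_neg]
    congr 1
    funext x
    simp only [Pi.neg_apply]
    ring
  · refine h2.congr fun n => ?_
    rw [← eLpNorm_neg]
    congr 1
    funext x
    rw [xGrad_const_mul ((hφ n).1.differentiable (by simp))]
    simp only [Pi.neg_apply, neg_smul, one_smul]
    abel

theorem XAdmissible.exists_sobolev_W0 (hX : XAdmissible X Ω Q) (hN : 0 < N) :
    ∃ C > (0 : ℝ), ∀ u V, HasXGradW0 X Ω 2 u V → ∀ E ⊆ Ω, MeasurableSet E →
      ∫⁻ x in E, ‖u x‖ₑ ≤ ENNReal.ofReal C * volume E ^ (1 / Q) * ∫⁻ x in Ω, ‖V x‖ₑ := by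
  obtain ⟨C, hC, hS⟩ := hX.exists_sobolev hN
  refine ⟨C, hC, ?_⟩
  rintro u V ⟨hu, hV, φ, hφ, h1, h2⟩ E hEΩ hE
  have hφ' : ∀ n, IsTestFun Ω (φ n) := hφ
  have hvt : volume Ω ^ (1 / 2 : ℝ) ≠ ∞ :=
    ENNReal.rpow_ne_top_of_nonneg (by norm_num) hX.volume_lt_top.ne
  have hEt : volume E ^ (1 / Q) ≠ ∞ := ENNReal.rpow_ne_top_of_nonneg
    (by have := hX.two_lt; positivity) ((measure_mono hEΩ).trans_lt hX.volume_lt_top).ne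
  set K := ENNReal.ofReal C * volume E ^ (1 / Q) with hK
  have hKt : K ≠ ∞ := ENNReal.mul_ne_top ENNReal.ofReal_ne_top hEt
  have hlim : Tendsto (fun n => eLpNorm (fun x => φ n x - u x) 2 (volume.restrict Ω) *
      volume Ω ^ (1 / 2 : ℝ) + K * (eLpNorm (fun x => xGrad X (φ n) x - V x) 2 (volume.restrict Ω) *
      volume Ω ^ (1 / 2 : ℝ) + ∫⁻ x in Ω, ‖V x‖ₑ)) atTop (𝓝 (K * ∫⁻ x in Ω, ‖V x‖ₑ)) := by
    have a1 := ENNReal.Tendsto.mul_const h1 (Or.inr hvt)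
    have a2 := (ENNReal.Tendsto.mul_const h2 (Or.inr hvt)).add_const (∫⁻ x in Ω, ‖V x‖ₑ)
    have a3 := a1.add (ENNReal.Tendsto.const_mul a2 (Or.inr hKt))
    simpa using a3
  refine ge_of_tendsto' hlim fun n => ?_
  have hsub : AEStronglyMeasurable (fun x => φ n x - u x) (volume.restrict Ω) :=
    ((hφ' n).memLp 2).aestronglyMeasurable.sub hu.aestronglyMeasurable
  have hsubV : AEStronglyMeasurable (fun x => xGrad X (φ n) x - V x) (volume.restrict Ω) :=
    ((hφ' n).memLp_xGrad hX.continuous 2).aestronglyMeasurable.sub hV.aestronglyMeasurable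
  have e1 := lintegral_enorm_le_eLpNorm_two hsub
  have e2 := lintegral_enorm_le_eLpNorm_two hsubV
  rw [Measure.restrict_apply_univ] at e1 e2
  calc ∫⁻ x in E, ‖u x‖ₑ ≤ ∫⁻ x in E, (‖φ n x - u x‖ₑ + ‖φ n x‖ₑ) := by
        refine lintegral_mono fun x => ?_
        calc ‖u x‖ₑ = ‖-(φ n x - u x) + φ n x‖ₑ := by congr 1; ring
          _ ≤ _ := by
            refine (enorm_add_le _ _).trans ?_
            rw [enorm_neg]
    _ = (∫⁻ x in E, ‖φ n x - u x‖ₑ) + ∫⁻ x in E, ‖φ n x‖ₑ :=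
        lintegral_add_right _ (hφ' n).1.continuous.enorm.measurable
    _ ≤ (∫⁻ x in Ω, ‖φ n x - u x‖ₑ) + K * ∫⁻ x in Ω, ‖xGrad X (φ n) x‖ₑ :=
        add_le_add (lintegral_mono_set hEΩ) (hS _ (hφ' n) E hEΩ hE)
    _ ≤ (∫⁻ x in Ω, ‖φ n x - u x‖ₑ) + K * ∫⁻ x in Ω, (‖xGrad X (φ n) x - V x‖ₑ + ‖V x‖ₑ) := by
        gcongr with x
        calc ‖xGrad X (φ n) x‖ₑ = ‖xGrad X (φ n) x - V x + V x‖ₑ := by rw [sub_add_cancel]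
          _ ≤ _ := enorm_add_le _ _
    _ = (∫⁻ x in Ω, ‖φ n x - u x‖ₑ) + K * ((∫⁻ x in Ω, ‖xGrad X (φ n) x - V x‖ₑ) +
          ∫⁻ x in Ω, ‖V x‖ₑ) := by
        rw [lintegral_add_right' _ hV.aestronglyMeasurable.enorm]
    _ ≤ _ := by gcongr

/-- The L^1 inequality on E = Ω is applied to φ^2, whose X-gradient is 2 φ Xφ. Cauchy-Schwarz and
division by the L^2 norm of φ give the claim for test functions, and density gives the rest. It
provides the coercivity in Lax-Milgram. -/
theorem XAdmissible.exists_poincare_W0 (hX : XAdmissible X Ω Q) (hN : 0 < N) :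
    ∃ C > (0 : ℝ), ∀ u V, HasXGradW0 X Ω 2 u V →
      eLpNorm u 2 (volume.restrict Ω) ≤ ENNReal.ofReal C * eLpNorm V 2 (volume.restrict Ω) := by
  obtain ⟨C, hC, hS⟩ := hX.exists_sobolev hN
  set K : ℝ≥0∞ := ENNReal.ofReal C * volume Ω ^ (1 / Q) * 2 with hK
  have hKt : K ≠ ∞ := ENNReal.mul_ne_top (ENNReal.mul_ne_top ENNReal.ofReal_ne_top
    (ENNReal.rpow_ne_top_of_nonneg (by have := hX.two_lt; positivity) hX.volume_lt_top.ne))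
    (by norm_num)
  have htest : ∀ φ, IsTestFun Ω φ → eLpNorm φ 2 (volume.restrict Ω) ≤
      K * eLpNorm (xGrad X φ) 2 (volume.restrict Ω) := by
    intro φ hφ
    have hsq := hS _ (hφ.comp (T := fun s => s ^ 2) (contDiff_id.pow 2) (by simp)) Ω Subset.rfl
      hX.isOpen.measurableSet
    have h1 : ∀ x, ‖((fun s : ℝ => s ^ 2) ∘ φ) x‖ₑ = ‖φ x‖ₑ ^ 2 := fun x => by
      simp
    have h2 : ∀ x, ‖xGrad X ((fun s : ℝ => s ^ 2) ∘ φ) x‖ₑ = 2 * (‖φ x‖ₑ * ‖xGrad X φ x‖ₑ) :=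
      fun x => by
      rw [xGrad_comp (hφ.1.differentiable (by simp)) (by fun_prop), enorm_smul]
      simp only [differentiableAt_fun_id, deriv_fun_pow, Nat.cast_ofNat, Nat.add_one_sub_one,
        pow_one, deriv_id'', mul_one, enorm_mul]
      rw [mul_assoc]
      congr 1
      rw [Real.enorm_of_nonneg (by norm_num)]
      simp
    simp_rw [h1, h2] at hsq
    rw [lintegral_const_mul' _ _ (by norm_num), ← eLpNorm_two_sq, ← mul_assoc, ← hK] at hsq
    have h3 := hsq.trans (mul_le_mul_right (lintegral_enorm_mul_enorm_le
      (hφ.memLp 2).aestronglyMeasurable (hφ.memLp_xGrad hX.continuous 2).aestronglyMeasurable) K)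
    rcases eq_or_ne (eLpNorm φ 2 (volume.restrict Ω)) 0 with h0 | h0
    · rw [h0]; exact zero_le
    · rw [pow_two, mul_left_comm] at h3
      exact (ENNReal.mul_le_mul_iff_right h0 (hφ.memLp 2).eLpNorm_ne_top).1 h3
  refine ⟨K.toReal + 1, by positivity, ?_⟩
  rintro u V ⟨hu, hV, φ, hφ, h1, h2⟩
  have hφ' : ∀ n, IsTestFun Ω (φ n) := hφ
  have hlim : Tendsto (fun n => eLpNorm (fun x => φ n x - u x) 2 (volume.restrict Ω) +
      K * (eLpNorm (fun x => xGrad X (φ n) x - V x) 2 (volume.restrict Ω) +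
      eLpNorm V 2 (volume.restrict Ω))) atTop (𝓝 (K * eLpNorm V 2 (volume.restrict Ω))) := by
    have a3 := h1.add (ENNReal.Tendsto.const_mul (h2.add_const (eLpNorm V 2 (volume.restrict Ω)))
      (Or.inr hKt))
    simpa using a3
  have hfin : eLpNorm u 2 (volume.restrict Ω) ≤ K * eLpNorm V 2 (volume.restrict Ω) := by
    refine ge_of_tendsto' hlim fun n => ?_
    have hm := ((hφ' n).memLp 2).aestronglyMeasurable
    have hm' := ((hφ' n).memLp_xGrad hX.continuous 2).aestronglyMeasurable
    have e1 : eLpNorm u 2 (volume.restrict Ω) ≤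
        eLpNorm (fun x => φ n x - u x) 2 (volume.restrict Ω) + eLpNorm (φ n) 2 (volume.restrict Ω) := by
      have := eLpNorm_sub_le (p := 2) (hm) (hm.sub hu.aestronglyMeasurable) (by norm_num)
      rw [sub_sub_cancel, add_comm] at this
      exact this
    have e2 : eLpNorm (xGrad X (φ n)) 2 (volume.restrict Ω) ≤
        eLpNorm (fun x => xGrad X (φ n) x - V x) 2 (volume.restrict Ω) +
          eLpNorm V 2 (volume.restrict Ω) := by
      have := eLpNorm_add_le (p := 2) (hm'.sub hV.aestronglyMeasurable) hV.aestronglyMeasurable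
        (by norm_num)
      rw [sub_add_cancel] at this
      exact this
    exact e1.trans (add_le_add le_rfl ((htest _ (hφ' n)).trans (by gcongr)))
  refine hfin.trans ?_
  gcongr
  rw [← ENNReal.ofReal_toReal hKt]
  exact ENNReal.ofReal_le_ofReal (by simp)

end W0

/-! ### Rearrangements and dyadic sums -/

section Lorentz

variable {α : Type*} [MeasurableSpace α] {μ : Measure α} {f g : α → ℝ}

theorem antitone_decRearrangement : Antitone (decRearrangement μ f) := fun _ _ hst =>
  sInf_le_sInf fun _ h => le_trans h (ENNReal.ofReal_le_ofReal hst)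

theorem decRearrangement_mono (h : ∀ᵐ x ∂μ, ‖g x‖ₑ ≤ ‖f x‖ₑ) (t : ℝ) :
    decRearrangement μ g t ≤ decRearrangement μ f t := by
  refine sInf_le_sInf fun s hs => le_trans (measure_mono_ae ?_) hs
  filter_upwards [h] with x hx hlt
  exact lt_of_lt_of_le hlt hx

theorem le_decRearrangement {s : ℝ≥0∞} {t : ℝ} (h : ENNReal.ofReal t < μ {x | s < ‖f x‖ₑ}) :
    s ≤ decRearrangement μ f t := by
  refine le_sInf fun r hr => ?_
  by_contra! hrs
  refine absurd h (not_lt.2 (le_trans (measure_mono fun x hx => ?_) hr))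
  exact hrs.trans hx

theorem eLorentzNorm_one_eq {p : ℝ} :
    eLorentzNorm μ p 1 f =
      ∫⁻ t in Ioi (0 : ℝ), ENNReal.ofReal (t ^ (1 / p - 1)) * decRearrangement μ f t := by
  rw [eLorentzNorm, div_one, ENNReal.rpow_one]
  refine setLIntegral_congr_fun measurableSet_Ioi fun t ht => ?_
  have ht' : 0 < t := ht
  simp only [ENNReal.rpow_one]
  rw [mul_right_comm, ← ENNReal.ofReal_mul (by positivity), Real.rpow_sub_one ht'.ne']
  congr 2
  ring

theorem eLorentzNorm_one_mono (h : ∀ᵐ x ∂μ, ‖g x‖ₑ ≤ ‖f x‖ₑ) (p : ℝ) :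
    eLorentzNorm μ p 1 g ≤ eLorentzNorm μ p 1 f := by
  rw [eLorentzNorm_one_eq, eLorentzNorm_one_eq]
  refine lintegral_mono fun t => ?_
  gcongr
  exact decRearrangement_mono h t

/-- By the layer-cake formula the left side is at most the integral of min(a, d(σ)), where d is the
distribution function. This is the area of the region t < d(σ), 0 < t < a. Slicing it at fixed t
instead gives segments of length at most f^*(t). -/
theorem lintegral_le_lintegral_decRearrangement (hf : AEMeasurable f μ) {E : Set α}
    {a : ℝ} (hE : μ E ≤ ENNReal.ofReal a) :
    ∫⁻ x in E, ‖f x‖ₑ ∂μ ≤ ∫⁻ t in Ioo 0 a, decRearrangement μ f t := by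
  set d : ℝ → ℝ≥0∞ := fun σ => μ {x | ENNReal.ofReal σ < ‖f x‖ₑ} with hd
  have hda : Antitone d := fun s t hst => measure_mono fun x hx =>
    (ENNReal.ofReal_le_ofReal hst).trans_lt hx
  have hset : MeasurableSet {p : ℝ × ℝ | ENNReal.ofReal p.2 < d p.1} :=
    measurableSet_lt (ENNReal.measurable_ofReal.comp measurable_snd)
      (hda.measurable.comp measurable_fst)
  calc ∫⁻ x in E, ‖f x‖ₑ ∂μ = ∫⁻ x in E, ENNReal.ofReal |f x| ∂μ := by
        simp_rw [← Real.norm_eq_abs, ofReal_norm]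
    _ = ∫⁻ σ in Ioi 0, μ.restrict E {x | σ < |f x|} :=
        lintegral_eq_lintegral_meas_lt _ (ae_of_all _ fun x => abs_nonneg _)
          (continuous_abs.measurable.comp_aemeasurable hf.restrict)
    _ ≤ ∫⁻ σ in Ioi 0, ∫⁻ t in Ioo 0 a,
          {p : ℝ × ℝ | ENNReal.ofReal p.2 < d p.1}.indicator (fun _ => (1 : ℝ≥0∞)) (σ, t) := by
        refine setLIntegral_mono' measurableSet_Ioi fun σ hσ => ?_
        have hσ' : 0 < σ := hσ
        have h1 : μ.restrict E {x | σ < |f x|} ≤ min (ENNReal.ofReal a) (d σ) := by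
          refine le_min ?_ ?_
          · refine (measure_mono (subset_univ _)).trans ?_
            rwa [Measure.restrict_apply_univ]
          · refine (Measure.restrict_apply_le _ _).trans (measure_mono fun x hx => ?_)
            have hx' : σ < |f x| := hx
            simp only [mem_ofPred_eq]
            rw [← ofReal_norm, Real.norm_eq_abs]
            exact (ENNReal.ofReal_lt_ofReal_iff (hσ'.trans hx')).2 hx'
        refine h1.trans ?_
        have h2 : ∫⁻ t in Ioo 0 a,
            {p : ℝ × ℝ | ENNReal.ofReal p.2 < d p.1}.indicator (fun _ => (1 : ℝ≥0∞)) (σ, t) =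
            volume ({t | ENNReal.ofReal t < d σ} ∩ Ioo 0 a) := by
          have hm : MeasurableSet {t | ENNReal.ofReal t < d σ} :=
            measurableSet_lt ENNReal.measurable_ofReal measurable_const
          rw [← Measure.restrict_apply hm, ← lintegral_indicator_one hm]
          rfl
        rw [h2]
        have hfin : min (ENNReal.ofReal a) (d σ) ≠ ∞ :=
          ((min_le_left _ _).trans_lt ENNReal.ofReal_lt_top).ne
        set b := (min (ENNReal.ofReal a) (d σ)).toReal with hb
        have hbe : ENNReal.ofReal b = min (ENNReal.ofReal a) (d σ) := ENNReal.ofReal_toReal hfin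
        calc min (ENNReal.ofReal a) (d σ) = volume (Ioo 0 b) := by
              rw [Real.volume_Ioo, sub_zero, hbe]
          _ ≤ _ := by
              refine measure_mono fun t ht => ?_
              have h3 : ENNReal.ofReal t < ENNReal.ofReal b :=
                (ENNReal.ofReal_lt_ofReal_iff (ht.1.trans ht.2)).2 ht.2
              rw [hbe, lt_min_iff] at h3
              exact ⟨h3.2, ht.1, (ENNReal.ofReal_lt_ofReal_iff_of_nonneg ht.1.le).1 h3.1⟩
    _ = ∫⁻ t in Ioo 0 a, ∫⁻ σ in Ioi 0,
          {p : ℝ × ℝ | ENNReal.ofReal p.2 < d p.1}.indicator (fun _ => (1 : ℝ≥0∞)) (σ, t) :=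
        lintegral_lintegral_swap ((measurable_const.indicator hset).aemeasurable)
    _ ≤ ∫⁻ t in Ioo 0 a, decRearrangement μ f t := by
        refine lintegral_mono fun t => ?_
        have hm : MeasurableSet {σ | ENNReal.ofReal t < d σ} :=
          measurableSet_lt measurable_const hda.measurable
        calc ∫⁻ σ in Ioi 0,
              {p : ℝ × ℝ | ENNReal.ofReal p.2 < d p.1}.indicator (fun _ => (1 : ℝ≥0∞)) (σ, t)
            = volume ({σ | ENNReal.ofReal t < d σ} ∩ Ioi 0) := by
              rw [← Measure.restrict_apply hm, ← lintegral_indicator_one hm]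
              rfl
          _ ≤ decRearrangement μ f t := by
              rcases eq_or_ne (decRearrangement μ f t) ∞ with h | h
              · rw [h]; exact le_top
              · calc _ ≤ volume (Icc 0 (decRearrangement μ f t).toReal) := by
                      refine measure_mono fun σ hσ => ⟨le_of_lt hσ.2, ?_⟩
                      have := le_decRearrangement (f := f) hσ.1
                      exact (ENNReal.ofReal_le_iff_le_toReal h).1 this
                  _ = _ := by rw [Real.volume_Icc, sub_zero, ENNReal.ofReal_toReal h]

/-- The terms that survive form an increasing geometric progression bounded by s^{-a}, so the sum is
comparable to its last term. -/
theorem sum_dyadic_rpow_le {a s m : ℝ} (ha : 0 < a) (hs : 0 < s) (hm : 0 < m) (n : ℕ) :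
    ∑ i ∈ Finset.range n, (if s < m / 2 ^ i then (m / 2 ^ i) ^ (-a) else 0) ≤
      (1 - 2 ^ (-a))⁻¹ * s ^ (-a) := by
  have h2 : (2 : ℝ) ^ (-a) < 1 := Real.rpow_lt_one_of_one_lt_of_neg one_lt_two (by linarith)
  have h2' : 0 < 1 - (2 : ℝ) ^ (-a) := by linarith
  -- The progression cut off at s^{-a}: its increments dominate the terms up to the factor 1 -
  -- 2^{-a}, so the sum telescopes.
  set G : ℕ → ℝ := fun i => min (s ^ (-a)) ((2 * (m / 2 ^ i)) ^ (-a)) with hG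
  have hstep : ∀ i, (1 - 2 ^ (-a)) * (if s < m / 2 ^ i then (m / 2 ^ i) ^ (-a) else 0) ≤
      G (i + 1) - G i := by
    intro i
    have ht : 0 < m / 2 ^ i := by positivity
    have e1 : 2 * (m / 2 ^ (i + 1)) = m / 2 ^ i := by rw [pow_succ]; field_simp
    have e2 : (2 * (m / 2 ^ i)) ^ (-a) = 2 ^ (-a) * (m / 2 ^ i) ^ (-a) :=
      Real.mul_rpow two_pos.le ht.le
    have hle : (2 * (m / 2 ^ i)) ^ (-a) ≤ (m / 2 ^ i) ^ (-a) := by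
      rw [e2]
      exact mul_le_of_le_one_left (by positivity) h2.le
    simp only [hG, e1]
    split_ifs with h
    · have h3 : (m / 2 ^ i) ^ (-a) ≤ s ^ (-a) :=
        Real.rpow_le_rpow_of_nonpos hs h.le (by linarith)
      rw [min_eq_right h3, min_eq_right (hle.trans h3), e2]
      linarith
    · rw [mul_zero, sub_nonneg]
      exact min_le_min_left _ hle
  have hsum := Finset.sum_le_sum fun i (_ : i ∈ Finset.range n) => hstep i
  rw [← Finset.mul_sum, Finset.sum_range_sub] at hsum
  rw [inv_mul_eq_div, le_div_iff₀' h2']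
  have h4 : 0 ≤ G 0 := by positivity
  have h5 : G n ≤ s ^ (-a) := min_le_left _ _
  linarith

/-- With h = f^* and a = 1 - 2/Q the right side is a multiple of the L^{Q/2,1} norm, while the left
side is the total rise of the levels in the iteration. -/
theorem tsum_dyadic_lintegral_le {a m : ℝ} (ha : 0 < a) (hm : 0 < m) {h : ℝ → ℝ≥0∞}
    (hh : Measurable h) :
    ∑' i : ℕ, ENNReal.ofReal ((m / 2 ^ i) ^ (-a)) * ∫⁻ s in Ioo 0 (m / 2 ^ i), h s ≤
      ENNReal.ofReal (1 - 2 ^ (-a))⁻¹ * ∫⁻ s in Ioi 0, ENNReal.ofReal (s ^ (-a)) * h s := by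
  have h1 : ∀ i : ℕ, ENNReal.ofReal ((m / 2 ^ i) ^ (-a)) * ∫⁻ s in Ioo 0 (m / 2 ^ i), h s =
      ∫⁻ s in Ioi 0, ENNReal.ofReal (if s < m / 2 ^ i then (m / 2 ^ i) ^ (-a) else 0) * h s := by
    intro i
    rw [← lintegral_const_mul _ hh, ← lintegral_indicator measurableSet_Ioo,
      ← lintegral_indicator measurableSet_Ioi]
    refine lintegral_congr fun s => ?_
    by_cases hs : 0 < s
    · by_cases hs' : s < m / 2 ^ i
      · rw [indicator_of_mem (mem_Ioo.2 ⟨hs, hs'⟩), indicator_of_mem (mem_Ioi.2 hs), if_pos hs']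
      · rw [indicator_of_notMem (fun h => hs' h.2), indicator_of_mem (mem_Ioi.2 hs), if_neg hs']
        simp
    · rw [indicator_of_notMem (fun h => hs h.1), indicator_of_notMem (show s ∉ Ioi (0 : ℝ) from hs)]
  simp_rw [h1]
  refine ENNReal.tsum_le_of_sum_range_le fun n => ?_
  rw [← lintegral_finsetSum]
  · rw [← lintegral_const_mul' _ _ ENNReal.ofReal_ne_top]
    refine setLIntegral_mono' measurableSet_Ioi fun s hs => ?_
    have hs' : 0 < s := hs
    have h2 : (2 : ℝ) ^ (-a) < 1 := Real.rpow_lt_one_of_one_lt_of_neg one_lt_two (by linarith)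
    rw [← Finset.sum_mul, ← mul_assoc, ← ENNReal.ofReal_sum_of_nonneg,
      ← ENNReal.ofReal_mul (inv_nonneg.2 (by linarith))]
    · gcongr
      exact sum_dyadic_rpow_le ha hs' hm n
    · intro i _
      split_ifs <;> positivity
  · intro i _
    exact (ENNReal.measurable_ofReal.comp (Measurable.ite measurableSet_Iio measurable_const
      measurable_const)).mul hh

end Lorentz

/-! ### Energy estimate for truncations -/

section Energy

variable {N m : ℕ} {X : Fin m → EuclideanSpace ℝ (Fin N) → EuclideanSpace ℝ (Fin N)}
  {Ω : Set (EuclideanSpace ℝ (Fin N))} {Q : ℝ}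

theorem HasXGradW0.congr_ae {p : ℝ≥0∞} {u u' : EuclideanSpace ℝ (Fin N) → ℝ}
    {V V' : EuclideanSpace ℝ (Fin N) → EuclideanSpace ℝ (Fin m)} (h : HasXGradW0 X Ω p u V)
    (hu : u =ᵐ[volume.restrict Ω] u') (hV : V =ᵐ[volume.restrict Ω] V') :
    HasXGradW0 X Ω p u' V' := by
  obtain ⟨h1, h2, φ, hφ, h3, h4⟩ := h
  refine ⟨h1.ae_eq hu, h2.ae_eq hV, φ, hφ, h3.congr fun n => eLpNorm_congr_ae ?_,
    h4.congr fun n => eLpNorm_congr_ae ?_⟩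
  · filter_upwards [hu] with x hx using by rw [hx]
  · filter_upwards [hV] with x hx using by rw [hx]

theorem dotProduct_self_eq_norm_sq (v : EuclideanSpace ℝ (Fin m)) :
    v.ofLp ⬝ᵥ v.ofLp = ‖v‖ ^ 2 := by
  rw [EuclideanSpace.norm_sq_eq]
  simp [dotProduct, pow_two]

theorem IsEllipticCoeff.aestronglyMeasurable {α β : ℝ}
    {A : EuclideanSpace ℝ (Fin N) → Matrix (Fin m) (Fin m) ℝ} (hA : IsEllipticCoeff Ω α β A)
    {V W : EuclideanSpace ℝ (Fin N) → EuclideanSpace ℝ (Fin m)}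
    (hV : AEStronglyMeasurable V (volume.restrict Ω))
    (hW : AEStronglyMeasurable W (volume.restrict Ω)) :
    AEStronglyMeasurable (fun x => (A x *ᵥ (V x).ofLp) ⬝ᵥ (W x).ofLp) (volume.restrict Ω) := by
  simp only [Matrix.mulVec, dotProduct]
  refine Finset.aestronglyMeasurable_fun_sum _ fun i _ => AEStronglyMeasurable.mul
    (Finset.aestronglyMeasurable_fun_sum _ fun j _ => AEStronglyMeasurable.mul
      (hA.measurable i j).aestronglyMeasurable ?_) ?_
  · exact (PiLp.continuous_apply 2 _ j).comp_aestronglyMeasurable hV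
  · exact (PiLp.continuous_apply 2 _ i).comp_aestronglyMeasurable hW

theorem Real.smoothTransition.deriv_eq_zero {x : ℝ} (hx : x ≤ 0) :
    deriv Real.smoothTransition x = 0 := by
  apply IsLocalMin.deriv_eq_zero
  refine Eventually.of_forall fun y => ?_
  rw [Real.smoothTransition.zero_of_nonpos hx]
  exact Real.smoothTransition.nonneg y

/-- The energy estimate on a superlevel set. -/
theorem energy_superlevel_le (hX : ∀ j, Continuous (X j)) {α β : ℝ}
    (hα : 0 < α) {A : EuclideanSpace ℝ (Fin N) → Matrix (Fin m) (Fin m) ℝ}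
    (hA : IsEllipticCoeff Ω α β A) {f u : EuclideanSpace ℝ (Fin N) → ℝ}
    (hf : Integrable f (volume.restrict Ω)) (hu : Measurable u)
    {V : EuclideanSpace ℝ (Fin N) → EuclideanSpace ℝ (Fin m)} (hV : HasXGradW0 X Ω 2 u V)
    (heq : ∀ v Z, HasXGradW0 X Ω 2 v Z →
      ∫ x in Ω, (A x *ᵥ (V x).ofLp) ⬝ᵥ (Z x).ofLp = ∫ x in Ω, f x * v x)
    {M : ℝ} (hM0 : 0 ≤ M) (hM : ∀ x, |deriv Real.smoothTransition x| ≤ M) {k h : ℝ} (hk : 0 ≤ k)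
    (hh : 0 < h) :
    HasXGradW0 X Ω 2 (fun x => h * Real.smoothTransition ((u x - k) / h))
      (fun x => deriv Real.smoothTransition ((u x - k) / h) • V x) ∧
    eLpNorm (fun x => deriv Real.smoothTransition ((u x - k) / h) • V x) 2 (volume.restrict Ω) ^ 2 ≤
      ENNReal.ofReal (M * h / α) * ∫⁻ x in Ω ∩ {x | k < u x}, ‖f x‖ₑ := by
  set σ := Real.smoothTransition with hσ
  -- A smooth substitute for min((s - k)^+, h): it is 0 below k and h above k + h, and its slope is
  -- bounded by M whatever h is. It vanishes at 0 because k ≥ 0.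
  set T : ℝ → ℝ := fun s => h * σ ((s - k) / h) with hT
  have hTc : ContDiff ℝ ((⊤ : ℕ∞) : WithTop ℕ∞) T :=
    contDiff_const.mul (Real.smoothTransition.contDiff.comp
      ((contDiff_id.sub contDiff_const).div_const h))
  have hTd : ∀ s, deriv T s = deriv σ ((s - k) / h) := fun s => by
    have h1 : HasDerivAt (fun s => (s - k) / h) (1 / h) s :=
      ((hasDerivAt_id s).sub_const k).div_const h
    have h2 := ((Real.smoothTransition.hasDerivAt ((s - k) / h)).comp s h1).const_mul h
    rw [HasDerivAt.deriv (f := T) h2]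
    field_simp
    rfl
  have hT0 : T 0 = 0 := by
    simp only [hT]
    rw [hσ, Real.smoothTransition.zero_of_nonpos, mul_zero]
    exact div_nonpos_of_nonpos_of_nonneg (by linarith) hh.le
  have hW := hV.comp hX hTc hT0 (M := M) (fun s => by rw [hTd]; exact hM _)
  simp only [hTd] at hW
  refine ⟨hW, ?_⟩
  set τ : EuclideanSpace ℝ (Fin N) → ℝ := fun x => deriv σ ((u x - k) / h) with hτ
  have hτ0 : ∀ x, 0 ≤ τ x := fun x => Real.smoothTransition.deriv_nonneg _
  have hτM : ∀ x, τ x ≤ M := fun x => (le_abs_self _).trans (hM _)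
  have hσ'c : Continuous (deriv σ) :=
    (Real.smoothTransition.contDiff (n := 1)).continuous_deriv le_rfl
  have hτm : Measurable τ := hσ'c.measurable.comp ((hu.sub_const k).div_const h)
  obtain ⟨-, hVm, -⟩ := hV
  have hV2 : Integrable (fun x => ‖V x‖ ^ 2) (volume.restrict Ω) := hVm.integrable_norm_pow two_ne_zero
  have hI : Integrable (fun x => τ x * ‖V x‖ ^ 2) (volume.restrict Ω) :=
    hV2.bdd_mul (c := M) hτm.aestronglyMeasurable
      (ae_of_all _ fun x => by rw [Real.norm_of_nonneg (hτ0 x)]; exact hτM x)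
  have hdot : ∀ x, (A x *ᵥ (V x).ofLp) ⬝ᵥ (τ x • V x).ofLp =
      τ x * ((A x *ᵥ (V x).ofLp) ⬝ᵥ (V x).ofLp) := fun x => by
    rw [WithLp.ofLp_smul, dotProduct_smul, smul_eq_mul]
  have hAVi : Integrable (fun x => (A x *ᵥ (V x).ofLp) ⬝ᵥ (V x).ofLp) (volume.restrict Ω) := by
    refine (hV2.const_mul β).mono' (hA.aestronglyMeasurable hVm.aestronglyMeasurable
      hVm.aestronglyMeasurable) ?_
    filter_upwards [hA.elliptic] with x hx
    obtain ⟨h1, h2⟩ := hx (V x).ofLp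
    rw [dotProduct_self_eq_norm_sq] at h1 h2
    rw [Real.norm_of_nonneg ((by positivity : (0 : ℝ) ≤ α * ‖V x‖ ^ 2).trans h1)]
    exact h2
  have hAi : Integrable (fun x => τ x * ((A x *ᵥ (V x).ofLp) ⬝ᵥ (V x).ofLp))
      (volume.restrict Ω) :=
    hAVi.bdd_mul (c := M) hτm.aestronglyMeasurable
      (ae_of_all _ fun x => by rw [Real.norm_of_nonneg (hτ0 x)]; exact hτM x)
  have hlow : α * ∫ x in Ω, τ x * ‖V x‖ ^ 2 ≤
      ∫ x in Ω, τ x * ((A x *ᵥ (V x).ofLp) ⬝ᵥ (V x).ofLp) := by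
    rw [← integral_const_mul]
    refine integral_mono_ae (hI.const_mul α) hAi ?_
    filter_upwards [hA.elliptic] with x hx
    have h1 := (hx (V x).ofLp).1
    rw [dotProduct_self_eq_norm_sq] at h1
    have := mul_le_mul_of_nonneg_left h1 (hτ0 x)
    linarith
  have hsol := heq _ _ hW
  simp_rw [show ∀ x, (A x *ᵥ (V x).ofLp) ⬝ᵥ (deriv σ ((u x - k) / h) • V x).ofLp =
    τ x * ((A x *ᵥ (V x).ofLp) ⬝ᵥ (V x).ofLp) from hdot] at hsol
  have hSm : MeasurableSet {x | k < u x} := measurableSet_lt measurable_const hu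
  have hup : ∫ x in Ω, f x * (T ∘ u) x ≤ h * ∫ x in Ω ∩ {x | k < u x}, ‖f x‖ := by
    rw [inter_comm, ← Measure.restrict_restrict hSm, ← integral_const_mul,
      ← integral_indicator hSm]
    refine (le_abs_self _).trans ?_
    rw [← Real.norm_eq_abs]
    refine norm_integral_le_of_norm_le ((hf.norm.const_mul h).indicator hSm) (ae_of_all _ fun x => ?_)
    rw [norm_mul, mul_comm]
    by_cases hx : k < u x
    · rw [indicator_of_mem (show x ∈ {x | k < u x} from hx)]
      refine mul_le_mul_of_nonneg_right ?_ (norm_nonneg _)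
      simp only [Function.comp_apply, hT]
      rw [Real.norm_of_nonneg (mul_nonneg hh.le (Real.smoothTransition.nonneg _))]
      exact mul_le_of_le_one_right hh.le (Real.smoothTransition.le_one _)
    · rw [indicator_of_notMem (show x ∉ {x | k < u x} from hx)]
      simp only [Function.comp_apply, hT]
      rw [hσ, Real.smoothTransition.zero_of_nonpos]
      · simp
      · exact div_nonpos_of_nonpos_of_nonneg (by linarith) hh.le
  -- Testing the equation controls the integral of τ |V|^2, whereas the truncation has gradient τ V.
  -- The bound τ^2 ≤ M τ connects the two.
  have hmain : M * ∫ x in Ω, τ x * ‖V x‖ ^ 2 ≤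
      M * h / α * ∫ x in Ω ∩ {x | k < u x}, ‖f x‖ := by
    rw [← hsol] at hup
    have h1 := hlow.trans hup
    rw [mul_div_assoc, mul_assoc, div_mul_eq_mul_div]
    gcongr
    rw [le_div_iff₀' hα]
    exact h1
  rw [eLpNorm_two_sq]
  calc ∫⁻ x in Ω, ‖τ x • V x‖ₑ ^ 2 ≤ ∫⁻ x in Ω, ENNReal.ofReal (M * (τ x * ‖V x‖ ^ 2)) := by
        refine lintegral_mono fun x => ?_
        rw [← ofReal_norm, ← ENNReal.ofReal_pow (norm_nonneg _), norm_smul,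
          Real.norm_of_nonneg (hτ0 x)]
        refine ENNReal.ofReal_le_ofReal ?_
        rw [mul_pow, pow_two (τ x), mul_assoc]
        exact mul_le_mul_of_nonneg_right (hτM x) (mul_nonneg (hτ0 x) (sq_nonneg _))
    _ = ENNReal.ofReal (M * ∫ x in Ω, τ x * ‖V x‖ ^ 2) := by
        rw [← integral_const_mul, ofReal_integral_eq_lintegral_ofReal (hI.const_mul M)
          (ae_of_all _ fun x => mul_nonneg hM0 (mul_nonneg (hτ0 x) (sq_nonneg _)))]
    _ ≤ ENNReal.ofReal (M * h / α * ∫ x in Ω ∩ {x | k < u x}, ‖f x‖) :=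
        ENNReal.ofReal_le_ofReal hmain
    _ = _ := by
        have hfi : Integrable f (volume.restrict (Ω ∩ {x | k < u x})) :=
          hf.mono_measure (Measure.restrict_mono inter_subset_left le_rfl)
        rw [ENNReal.ofReal_mul (by positivity), ofReal_integral_norm_eq_lintegral_enorm hfi]

end Energy

/-- The algebra of the decay of the distribution function between two levels. -/
theorem level_gap_le {Q C K t D h F : ℝ} (hQ : 2 < Q) (ht : 0 < t)
    (hD : t / 2 < D) (hh : 0 < h)
    (hle : (h * D) ^ 2 ≤ (C * D ^ (1 / Q)) ^ 2 * (K * h * F * t)) :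
    h ≤ 4 * C ^ 2 * K * (t ^ (-(1 - 2 / Q)) * F) := by
  have hD0 : 0 < D := by linarith
  -- The power of D left after dividing D^2 by D^{2/Q}. As D > t/2 and 0 ≤ e ≤ 2, it is at least t^e
  -- / 4, which is where the factor 4 comes from.
  set e : ℝ := 2 - 2 / Q with he
  have he2 : e ≤ 2 := by
    have : 0 < 2 / Q := by positivity
    linarith
  have he0 : 0 ≤ e := by
    have : 2 / Q ≤ 1 := (div_le_one (by linarith)).2 hQ.le
    linarith
  have h1 : D ^ 2 = D ^ e * (D ^ (1 / Q)) ^ 2 := by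
    rw [← Real.rpow_natCast (D ^ (1 / Q)) 2, ← Real.rpow_mul hD0.le, ← Real.rpow_add hD0,
      ← Real.rpow_natCast D 2]
    congr 1
    rw [he]; push_cast; ring
  have hDQ : 0 < (D ^ (1 / Q)) ^ 2 := by positivity
  have h2 : h * D ^ e ≤ C ^ 2 * (K * F * t) := by
    rw [mul_pow, mul_pow, h1] at hle
    have h3 : (h * (D ^ (1 / Q)) ^ 2) * (h * D ^ e) ≤
        (h * (D ^ (1 / Q)) ^ 2) * (C ^ 2 * (K * F * t)) := by
      calc _ = h ^ 2 * (D ^ e * (D ^ (1 / Q)) ^ 2) := by ring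
        _ ≤ _ := hle
        _ = _ := by ring
    exact le_of_mul_le_mul_left h3 (by positivity)
  have h4 : t ^ e / 4 ≤ D ^ e := by
    calc t ^ e / 4 ≤ t ^ e / 2 ^ e := by
          gcongr
          calc (2 : ℝ) ^ e ≤ 2 ^ (2 : ℝ) := Real.rpow_le_rpow_of_exponent_le one_le_two he2
            _ = 4 := by norm_num
      _ = (t / 2) ^ e := (Real.div_rpow ht.le two_pos.le e).symm
      _ ≤ D ^ e := Real.rpow_le_rpow (by positivity) hD.le he0
  have h5 : t = t ^ (-(1 - 2 / Q)) * t ^ e := by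
    rw [← Real.rpow_add ht, show -(1 - 2 / Q) + e = 1 by rw [he]; ring, Real.rpow_one]
  have hte : 0 < t ^ e := by positivity
  have h6 : h * (t ^ e / 4) ≤ C ^ 2 * (K * F * (t ^ (-(1 - 2 / Q)) * t ^ e)) := by
    rw [← h5]
    exact (mul_le_mul_of_nonneg_left h4 hh.le).trans h2
  have h7 : h * t ^ e ≤ (4 * C ^ 2 * K * (t ^ (-(1 - 2 / Q)) * F)) * t ^ e := by
    calc h * t ^ e = 4 * (h * (t ^ e / 4)) := by ring
      _ ≤ 4 * (C ^ 2 * (K * F * (t ^ (-(1 - 2 / Q)) * t ^ e))) := by gcongr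
      _ = _ := by ring
  exact le_of_mul_le_mul_right h7 hte

/-! ### Level-set iteration and the L^∞ bound -/

section Bounded

variable {N m : ℕ} {X : Fin m → EuclideanSpace ℝ (Fin N) → EuclideanSpace ℝ (Fin N)}
  {Ω : Set (EuclideanSpace ℝ (Fin N))} {Q : ℝ}

/-- Continuity from below. The iteration contradicts only gaps strictly larger than the critical
one, and this recovers the critical gap itself, even when it is 0. -/
theorem measure_superlevel_le_of_forall_lt {α : Type*} [MeasurableSpace α] {μ : Measure α}
    {u : α → ℝ} {k : ℝ} {c : ℝ≥0∞} (h : ∀ s, k < s → μ {x | s < u x} ≤ c) :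
    μ {x | k < u x} ≤ c := by
  have hU : {x | k < u x} = ⋃ n : ℕ, {x | k + 1 / ((n : ℝ) + 1) < u x} := by
    ext x
    simp only [mem_ofPred_eq, mem_iUnion]
    constructor
    · intro hx
      obtain ⟨n, hn⟩ := exists_nat_one_div_lt (sub_pos.2 hx)
      exact ⟨n, by linarith⟩
    · rintro ⟨n, hn⟩
      have : 0 < 1 / ((n : ℝ) + 1) := by positivity
      linarith
  rw [hU, Monotone.measure_iUnion]
  · refine iSup_le fun n => h _ ?_
    have : 0 < 1 / ((n : ℝ) + 1) := by positivity
    linarith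
  · intro a b hab x hx
    simp only [mem_ofPred_eq] at hx ⊢
    have : 1 / ((b : ℝ) + 1) ≤ 1 / ((a : ℝ) + 1) := by gcongr
    linarith

/-- The integral appears, with a positive weight, as the first term of the dyadic sum bounded by the
Lorentz norm. -/
theorem MemLorentz.lintegral_Ioo_lt_top {Q : ℝ} (hQ : 2 < Q) {f : EuclideanSpace ℝ (Fin N) → ℝ}
    {μ : Measure (EuclideanSpace ℝ (Fin N))} (hf : MemLorentz μ (Q / 2) 1 f) {t : ℝ} (ht : 0 < t) :
    ∫⁻ s in Ioo 0 t, decRearrangement μ f s < ∞ := by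
  have ha : 0 < 1 - 2 / Q := by
    rw [sub_pos, div_lt_one (by linarith)]; exact hQ
  have h1 := tsum_dyadic_lintegral_le ha ht (antitone_decRearrangement (μ := μ) (f := f)).measurable
  have h2 := hf.2
  rw [eLorentzNorm_one_eq, show 1 / (Q / 2) - 1 = -(1 - 2 / Q) by
    rw [one_div_div]; ring] at h2
  have h3 := (ENNReal.le_tsum 0).trans h1
  rw [pow_zero, div_one] at h3
  have h4 := h3.trans_lt (ENNReal.mul_lt_top ENNReal.ofReal_lt_top h2)
  by_contra hcon
  rw [not_lt, top_le_iff] at hcon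
  rw [hcon, ENNReal.mul_top] at h4
  · exact lt_irrefl _ h4
  · exact (ENNReal.ofReal_pos.2 (by positivity)).ne'

theorem MemLorentz.integrable {Q : ℝ} (hQ : 2 < Q) {f : EuclideanSpace ℝ (Fin N) → ℝ}
    {μ : Measure (EuclideanSpace ℝ (Fin N))} [IsFiniteMeasure μ]
    (hf : MemLorentz μ (Q / 2) 1 f) : Integrable f μ := by
  refine ⟨hf.1.aestronglyMeasurable, ?_⟩
  have h := lintegral_le_lintegral_decRearrangement hf.1 (E := univ) (a := (μ univ).toReal + 1) (by
    rw [← ENNReal.ofReal_toReal (measure_ne_top μ univ)]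
    exact ENNReal.ofReal_le_ofReal (by simp))
  rw [Measure.restrict_univ] at h
  exact h.trans_lt (hf.lintegral_Ioo_lt_top hQ (by positivity))

theorem IsWeakSolution.neg {A : EuclideanSpace ℝ (Fin N) → Matrix (Fin m) (Fin m) ℝ}
    {f u : EuclideanSpace ℝ (Fin N) → ℝ} (h : IsWeakSolution X Ω A f u) :
    IsWeakSolution X Ω A (fun x => -f x) (fun x => -u x) := by
  obtain ⟨V, hV, heq⟩ := h
  refine ⟨_, hV.neg, fun v Z hv => ?_⟩
  have := heq v Z hv
  simp only [WithLp.ofLp_neg, Matrix.mulVec_neg, neg_dotProduct, neg_mul]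
  rw [integral_neg, integral_neg, this]

/-- Raising the level by H(t) brings a superlevel set of measure at most t down to measure at most
t/2. Repeated from t = |Ω|, the levels stay below the sum of the H(|Ω| 2^{-i}), a constant times the
Lorentz norm over α, while the measures tend to 0. -/
theorem XAdmissible.exists_ae_le (hX : XAdmissible X Ω Q) (hN : 0 < N) :
    ∃ C > (0 : ℝ), ∀ α β : ℝ, 0 < α →
      ∀ A : EuclideanSpace ℝ (Fin N) → Matrix (Fin m) (Fin m) ℝ, IsEllipticCoeff Ω α β A →
      ∀ f u : EuclideanSpace ℝ (Fin N) → ℝ, MemLorentz (volume.restrict Ω) (Q / 2) 1 f →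
        IsWeakSolution X Ω A f u → ∀ᵐ x ∂(volume.restrict Ω),
          u x ≤ C / α * (eLorentzNorm (volume.restrict Ω) (Q / 2) 1 f).toReal := by
  obtain ⟨C, hC, hS⟩ := hX.exists_sobolev_W0 hN
  obtain ⟨M, hM0, hM⟩ := Real.smoothTransition.exists_deriv_bound
  have hQ := hX.two_lt
  set a : ℝ := 1 - 2 / Q with ha
  have ha0 : 0 < a := by rw [ha, sub_pos, div_lt_one (by linarith)]; exact hQ
  have h2a : (2 : ℝ) ^ (-a) < 1 := Real.rpow_lt_one_of_one_lt_of_neg one_lt_two (by linarith)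
  have hc0 : 0 < (1 - (2 : ℝ) ^ (-a))⁻¹ := inv_pos.2 (by linarith)
  refine ⟨4 * C ^ 2 * M * (1 - 2 ^ (-a))⁻¹, by positivity, ?_⟩
  intro α β hα A hA f u hf hu
  have : IsFiniteMeasure (volume.restrict Ω) :=
    isFiniteMeasure_restrict.2 hX.volume_lt_top.ne
  have hΩm := hX.isOpen.measurableSet
  have hfi := hf.integrable hQ
  obtain ⟨V, hV, heq⟩ := hu
  wlog hum : Measurable u generalizing u
  · have hae := hV.1.aestronglyMeasurable.ae_eq_mk
    filter_upwards [this _ (hV.congr_ae hae (ae_eq_refl _))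
      hV.1.aestronglyMeasurable.stronglyMeasurable_mk.measurable, hae] with x hx hx'
    rw [hx']
    exact hx
  rcases Ω.eq_empty_or_nonempty with rfl | hne
  · simp
  have hv0 : 0 < volume.real Ω :=
    ENNReal.toReal_pos (hX.isOpen.measure_pos _ hne).ne' hX.volume_lt_top.ne
  set v := volume.real Ω with hv
  have hvΩ : volume Ω = ENNReal.ofReal v := (ofReal_measureReal hX.volume_lt_top.ne).symm
  set μ := volume.restrict Ω with hμ
  set F : ℝ → ℝ≥0∞ := fun t => ∫⁻ s in Ioo 0 t, decRearrangement μ f s with hF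
  have hFt : ∀ t, 0 < t → F t ≠ ∞ := fun t ht => (hf.lintegral_Ioo_lt_top hQ ht).ne
  set H : ℝ → ℝ := fun t => 4 * C ^ 2 * (M / α) * (t ^ (-a) * (F t).toReal) with hH
  have hH0 : ∀ t, 0 < t → 0 ≤ H t := fun t ht => by positivity
  have hstep : ∀ k t, 0 ≤ k → 0 < t → μ {x | k < u x} ≤ ENNReal.ofReal t →
      μ {x | k + H t < u x} ≤ ENNReal.ofReal (t / 2) := by
    intro k t hk ht hkt
    refine measure_superlevel_le_of_forall_lt fun s hs => ?_
    set h := s - k with hh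
    have hh0 : H t < h := by linarith
    have hhpos : 0 < h := (hH0 t ht).trans_lt hh0
    have hSm : MeasurableSet {x | s < u x} := measurableSet_lt measurable_const hum
    have hkm : MeasurableSet {x | k < u x} := measurableSet_lt measurable_const hum
    obtain ⟨hW, hen⟩ := energy_superlevel_le hX.continuous hα hA hfi hum hV heq hM0.le hM hk hhpos
    set W := fun x => deriv Real.smoothTransition ((u x - k) / h) • V x with hWdef
    set E := Ω ∩ {x | s < u x} with hE
    have hEm : MeasurableSet E := hΩm.inter hSm
    have hμE : μ {x | s < u x} = volume E := by
      rw [hμ, Measure.restrict_apply hSm, inter_comm]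
    rw [hμE]
    set D := volume.real E with hD
    have hEt : volume E ≠ ∞ := ((measure_mono inter_subset_left).trans_lt hX.volume_lt_top).ne
    have hDE : volume E = ENNReal.ofReal D := (ofReal_measureReal hEt).symm
    rw [hDE]
    refine ENNReal.ofReal_le_ofReal ?_
    -- If the measure D of {u > s} exceeded t/2, then `level_gap_le` would give h ≤ H(t), contrary
    -- to the choice of s.
    by_contra! hcon
    refine absurd hh0 (not_lt.2 ?_)
    have hD0 : 0 < D := by linarith
    have hsob := hS _ _ hW E inter_subset_left hEm
    have hlow : ENNReal.ofReal h * volume E ≤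
        ∫⁻ x in E, ‖h * Real.smoothTransition ((u x - k) / h)‖ₑ := by
      rw [← setLIntegral_const]
      refine setLIntegral_mono' hEm fun x hx => ?_
      have hx2 : s < u x := hx.2
      rw [Real.smoothTransition.one_of_one_le, mul_one, Real.enorm_of_nonneg hhpos.le]
      rw [one_le_div hhpos]
      linarith
    -- W vanishes off {u > k}, a set of measure at most t, so Cauchy-Schwarz gains the factor
    -- t^{1/2}.
    have hW1 : ∫⁻ x in Ω, ‖W x‖ₑ ≤ eLpNorm W 2 μ * ENNReal.ofReal t ^ (1 / 2 : ℝ) := by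
      have h0 : ∫⁻ x in Ω, ‖W x‖ₑ = ∫⁻ x in {x | k < u x}, ‖W x‖ₑ ∂μ := by
        rw [← lintegral_indicator hkm, hμ]
        refine lintegral_congr fun x => ?_
        by_cases hx : k < u x
        · rw [indicator_of_mem (show x ∈ {x | k < u x} from hx)]
        · rw [indicator_of_notMem (show x ∉ {x | k < u x} from hx)]
          simp only [hWdef]
          rw [Real.smoothTransition.deriv_eq_zero, zero_smul, enorm_zero]
          exact div_nonpos_of_nonpos_of_nonneg (by linarith) hhpos.le
      rw [h0]
      refine (lintegral_enorm_le_eLpNorm_two hW.2.1.aestronglyMeasurable.restrict).trans ?_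
      rw [Measure.restrict_apply_univ]
      gcongr
      exact Measure.restrict_le_self
    have hfF : ∫⁻ x in Ω ∩ {x | k < u x}, ‖f x‖ₑ ≤ F t := by
      rw [inter_comm, ← Measure.restrict_restrict hkm]
      exact lintegral_le_lintegral_decRearrangement hf.1 hkt
    have hsq : (ENNReal.ofReal h * volume E) ^ 2 ≤ (ENNReal.ofReal C * volume E ^ (1 / Q)) ^ 2 *
        (ENNReal.ofReal (M * h / α) * F t * ENNReal.ofReal t) := by
      calc _ ≤ (ENNReal.ofReal C * volume E ^ (1 / Q) *
            (eLpNorm W 2 μ * ENNReal.ofReal t ^ (1 / 2 : ℝ))) ^ 2 := by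
            refine pow_le_pow_left₀ zero_le (hlow.trans (hsob.trans ?_)) 2
            gcongr
        _ = (ENNReal.ofReal C * volume E ^ (1 / Q)) ^ 2 *
            (eLpNorm W 2 μ ^ 2 * ENNReal.ofReal t) := by
            rw [mul_pow, mul_pow (eLpNorm W 2 μ), ← ENNReal.rpow_natCast (ENNReal.ofReal t ^ _) 2,
              ← ENNReal.rpow_mul]
            norm_num
        _ ≤ _ := by
            gcongr
            exact hen.trans (by gcongr)
    have hsq' := ENNReal.toReal_mono (by
      refine ENNReal.mul_ne_top (ENNReal.pow_ne_top (ENNReal.mul_ne_top ENNReal.ofReal_ne_top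
        (ENNReal.rpow_ne_top_of_nonneg (by positivity) hEt))) (ENNReal.mul_ne_top
        (ENNReal.mul_ne_top ENNReal.ofReal_ne_top (hFt t ht)) ENNReal.ofReal_ne_top)) hsq
    rw [hDE] at hsq'
    simp only [ENNReal.toReal_pow, ENNReal.toReal_mul, ENNReal.toReal_ofReal hhpos.le,
      ENNReal.toReal_ofReal hD0.le, ENNReal.toReal_ofReal hC.le, ← ENNReal.toReal_rpow,
      ENNReal.toReal_ofReal ht.le, ENNReal.toReal_ofReal (show 0 ≤ M * h / α by positivity)] at hsq'
    refine level_gap_le hQ ht hcon hhpos (hsq'.trans ?_)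
    rw [div_mul_eq_mul_div, mul_div_right_comm, mul_div_right_comm M]
  set ti : ℕ → ℝ := fun i => v / 2 ^ i with hti
  have hti0 : ∀ i, 0 < ti i := fun i => by positivity
  set S : ℕ → ℝ := fun n => ∑ i ∈ Finset.range n, H (ti i) with hSdef
  have hS0 : ∀ n, 0 ≤ S n := fun n => Finset.sum_nonneg fun i _ => hH0 _ (hti0 i)
  have hlev : ∀ n, μ {x | S n < u x} ≤ ENNReal.ofReal (ti n) := by
    intro n
    induction n with
    | zero =>
      refine (measure_mono (subset_univ _)).trans ?_
      rw [hμ, Measure.restrict_apply_univ, hvΩ]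
      simp [hti]
    | succ n ih =>
      have := hstep (S n) (ti n) (hS0 n) (hti0 n) ih
      have e1 : S (n + 1) = S n + H (ti n) := by simp only [hSdef]; rw [Finset.sum_range_succ]
      have e2 : ti (n + 1) = ti n / 2 := by simp only [hti]; rw [pow_succ, div_div]
      rw [e1, e2]
      exact this
  set L := eLorentzNorm μ (Q / 2) 1 f with hL
  have hLt : L ≠ ∞ := hf.2.ne
  have hSle : ∀ n, S n ≤ 4 * C ^ 2 * M * (1 - 2 ^ (-a))⁻¹ / α * L.toReal := by
    intro n
    have h1 := tsum_dyadic_lintegral_le ha0 hv0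
      (antitone_decRearrangement (μ := μ) (f := f)).measurable
    rw [eLorentzNorm_one_eq, show 1 / (Q / 2) - 1 = -a by
      rw [one_div_div, ha]; ring] at hL
    rw [← hL] at h1
    have h2 := (ENNReal.sum_le_tsum (Finset.range n)).trans h1
    have h3 := ENNReal.toReal_mono (ENNReal.mul_ne_top ENNReal.ofReal_ne_top hLt) h2
    rw [ENNReal.toReal_mul, ENNReal.toReal_ofReal hc0.le, ENNReal.toReal_sum (fun i _ =>
      ENNReal.mul_ne_top ENNReal.ofReal_ne_top (hFt _ (hti0 i)))] at h3
    have h4 : S n = 4 * C ^ 2 * (M / α) * ∑ i ∈ Finset.range n,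
        (ENNReal.ofReal ((v / 2 ^ i) ^ (-a)) * F (v / 2 ^ i)).toReal := by
      simp only [hSdef, hH]
      rw [← Finset.mul_sum]
      congr 1
      refine Finset.sum_congr rfl fun i _ => ?_
      rw [ENNReal.toReal_mul, ENNReal.toReal_ofReal (by positivity)]
    rw [h4]
    refine (mul_le_mul_of_nonneg_left h3 (by positivity)).trans (le_of_eq ?_)
    ring
  set B := 4 * C ^ 2 * M * (1 - 2 ^ (-a))⁻¹ / α * L.toReal with hB
  have hlim : Tendsto (fun n => ENNReal.ofReal (ti n)) atTop (𝓝 0) := by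
    have : Tendsto ti atTop (𝓝 0) :=
      tendsto_const_nhds.div_atTop (tendsto_pow_atTop_atTop_of_one_lt one_lt_two)
    simpa using ENNReal.tendsto_ofReal this
  have hzero : μ {x | B < u x} = 0 := by
    refine nonpos_iff_eq_zero.1 (ge_of_tendsto' hlim fun n => ?_)
    refine (measure_mono fun x hx => ?_).trans (hlev n)
    exact (hSle n).trans_lt hx
  rw [ae_iff]
  simpa only [not_le] using hzero

theorem XAdmissible.exists_linfty_bound (hX : XAdmissible X Ω Q) (hN : 0 < N) :
    ∃ C > (0 : ℝ), ∀ α β : ℝ, 0 < α →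
      ∀ A : EuclideanSpace ℝ (Fin N) → Matrix (Fin m) (Fin m) ℝ, IsEllipticCoeff Ω α β A →
      ∀ f u : EuclideanSpace ℝ (Fin N) → ℝ, MemLorentz (volume.restrict Ω) (Q / 2) 1 f →
        IsWeakSolution X Ω A f u → ∀ᵐ x ∂(volume.restrict Ω),
          ‖u x‖ ≤ C / α * (eLorentzNorm (volume.restrict Ω) (Q / 2) 1 f).toReal := by
  obtain ⟨C, hC, h⟩ := hX.exists_ae_le hN
  refine ⟨C, hC, fun α β hα A hA f u hf hu => ?_⟩
  have hneg : eLorentzNorm (volume.restrict Ω) (Q / 2) 1 (fun x => -f x) =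
      eLorentzNorm (volume.restrict Ω) (Q / 2) 1 f :=
    le_antisymm (eLorentzNorm_one_mono (ae_of_all _ fun x => by rw [enorm_neg]) _)
      (eLorentzNorm_one_mono (ae_of_all _ fun x => by rw [enorm_neg]) _)
  have h2 := h α β hα A hA (fun x => -f x) (fun x => -u x) ⟨hf.1.neg, hneg ▸ hf.2⟩ hu.neg
  rw [hneg] at h2
  filter_upwards [h α β hα A hA f u hf hu, h2] with x hx1 hx2
  rw [Real.norm_eq_abs, abs_le]
  constructor <;> linarith

end Bounded

/-! ### The Hilbert space of pairs (u, Xu) and Lax-Milgram -/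

section GraphSpace

variable {N m : ℕ} {X : Fin m → EuclideanSpace ℝ (Fin N) → EuclideanSpace ℝ (Fin N)}
  {Ω : Set (EuclideanSpace ℝ (Fin N))} {Q : ℝ}

/-- The space `L^2(Ω) × L^2(Ω; ℝ^m)` of pairs of a function and a candidate `X`-gradient. -/
abbrev GradPair {N : ℕ} (m : ℕ) (Ω : Set (EuclideanSpace ℝ (Fin N))) : Type :=
  WithLp 2 (Lp ℝ 2 (volume.restrict Ω) × Lp (EuclideanSpace ℝ (Fin m)) 2 (volume.restrict Ω))

theorem IsTestFun.add {φ ψ : EuclideanSpace ℝ (Fin N) → ℝ} (hφ : IsTestFun Ω φ)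
    (hψ : IsTestFun Ω ψ) : IsTestFun Ω (φ + ψ) :=
  ⟨hφ.1.add hψ.1, hφ.2.1.add hψ.2.1,
    (tsupport_add φ ψ).trans (union_subset hφ.2.2 hψ.2.2)⟩

theorem xGrad_add {φ ψ : EuclideanSpace ℝ (Fin N) → ℝ} (hφ : Differentiable ℝ φ)
    (hψ : Differentiable ℝ ψ) : xGrad X (φ + ψ) = xGrad X φ + xGrad X ψ := by
  ext x j
  simp [xGrad, fderiv_add (hφ x) (hψ x)]

theorem IsTestFun.differentiable {φ : EuclideanSpace ℝ (Fin N) → ℝ} (hφ : IsTestFun Ω φ) :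
    Differentiable ℝ φ :=
  hφ.1.differentiable (by simp)

/-- The pairs `(φ, X φ)` with `φ ∈ C_c^∞(Ω)`. -/
noncomputable def testPairs {N m : ℕ} (X : Fin m → EuclideanSpace ℝ (Fin N) → EuclideanSpace ℝ (Fin N))
    (Ω : Set (EuclideanSpace ℝ (Fin N))) : Submodule ℝ (GradPair m Ω) where
  carrier := {p | ∃ φ, IsTestFun Ω φ ∧ p.fst =ᵐ[volume.restrict Ω] φ ∧
    p.snd =ᵐ[volume.restrict Ω] xGrad X φ}
  add_mem' := by
    rintro p q ⟨φ, hφ, h1, h2⟩ ⟨ψ, hψ, h3, h4⟩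
    refine ⟨φ + ψ, hφ.add hψ, ?_, ?_⟩
    · rw [WithLp.add_fst]
      exact (Lp.coeFn_add _ _).trans (h1.add h3)
    · rw [WithLp.add_snd, xGrad_add hφ.differentiable hψ.differentiable]
      exact (Lp.coeFn_add _ _).trans (h2.add h4)
  zero_mem' := by
    refine ⟨0, ⟨contDiff_const, HasCompactSupport.zero, by simp [tsupport]⟩, ?_, ?_⟩
    · rw [WithLp.zero_fst]
      exact Lp.coeFn_zero _ _ _
    · rw [WithLp.zero_snd]
      refine (Lp.coeFn_zero _ _ _).trans (ae_of_all _ fun x => ?_)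
      ext j
      simp [xGrad]
  smul_mem' := by
    rintro c p ⟨φ, hφ, h1, h2⟩
    refine ⟨fun x => c * φ x, hφ.const_mul c, ?_, ?_⟩
    · rw [WithLp.smul_fst]
      filter_upwards [Lp.coeFn_smul c p.fst, h1] with x hx hx1
      rw [hx, Pi.smul_apply, hx1, smul_eq_mul]
    · rw [WithLp.smul_snd]
      filter_upwards [Lp.coeFn_smul c p.snd, h2] with x hx hx1
      rw [hx, Pi.smul_apply, hx1, xGrad_const_mul hφ.differentiable]

/-- `W_0^{1,2}(Ω, X)`, as the closed space of the pairs `(u, X u)`. -/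
noncomputable def graphW0 {N m : ℕ} (X : Fin m → EuclideanSpace ℝ (Fin N) → EuclideanSpace ℝ (Fin N))
    (Ω : Set (EuclideanSpace ℝ (Fin N))) : Submodule ℝ (GradPair m Ω) :=
  (testPairs X Ω).topologicalClosure

/-- Since the elements are pairs, V need not be determined by u, and closability of φ ↦ Xφ is never
called upon. -/
theorem mem_graphW0_iff (hX : ∀ j, Continuous (X j)) {p : GradPair m Ω} :
    p ∈ graphW0 X Ω ↔ HasXGradW0 X Ω 2 p.fst p.snd := by
  rw [graphW0, ← SetLike.mem_coe, Submodule.topologicalClosure_coe, mem_closure_iff_seq_limit]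
  constructor
  · rintro ⟨q, hq, hlim⟩
    choose φ hφ h1 h2 using hq
    refine ⟨Lp.memLp _, Lp.memLp _, φ, hφ, ?_, ?_⟩
    · refine ((Lp.tendsto_Lp_iff_tendsto_eLpNorm' _ _).1
        ((WithLp.fstL 2 ℝ _ _).continuous.continuousAt.tendsto.comp hlim)).congr fun n => ?_
      refine eLpNorm_congr_ae ?_
      filter_upwards [h1 n] with x hx
      simp [hx]
    · refine ((Lp.tendsto_Lp_iff_tendsto_eLpNorm' _ _).1
        ((WithLp.sndL 2 ℝ _ _).continuous.continuousAt.tendsto.comp hlim)).congr fun n => ?_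
      refine eLpNorm_congr_ae ?_
      filter_upwards [h2 n] with x hx
      simp [hx]
  · rintro ⟨-, -, φ, hφ, h1, h2⟩
    have hφ' : ∀ n, IsTestFun Ω (φ n) := hφ
    refine ⟨fun n => WithLp.toLp 2 (((hφ' n).memLp 2).toLp (φ n),
        ((hφ' n).memLp_xGrad hX 2).toLp (xGrad X (φ n))),
      fun n => ⟨φ n, hφ' n, ((hφ' n).memLp 2).coeFn_toLp,
        ((hφ' n).memLp_xGrad hX 2).coeFn_toLp⟩, ?_⟩
    have hlim : Tendsto (fun n => (((hφ' n).memLp 2).toLp (φ n),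
        ((hφ' n).memLp_xGrad hX 2).toLp (xGrad X (φ n))))
        atTop (𝓝 (p.fst, p.snd)) := by
      refine Tendsto.prodMk_nhds ?_ ?_
      · rw [Lp.tendsto_Lp_iff_tendsto_eLpNorm']
        refine h1.congr fun n => eLpNorm_congr_ae ?_
        filter_upwards [((hφ' n).memLp 2).coeFn_toLp] with x hx
        simp [hx]
      · rw [Lp.tendsto_Lp_iff_tendsto_eLpNorm']
        refine h2.congr fun n => eLpNorm_congr_ae ?_
        filter_upwards [((hφ' n).memLp_xGrad hX 2).coeFn_toLp] with x hx
        simp [hx]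
    exact ((WithLp.prod_continuous_toLp 2 _ _).tendsto _).comp hlim

theorem abs_mulVec_dotProduct_le {B : Matrix (Fin m) (Fin m) ℝ} {M : ℝ}
    (hB : ∀ i j, |B i j| ≤ M) (v w : EuclideanSpace ℝ (Fin m)) :
    |(B *ᵥ v.ofLp) ⬝ᵥ w.ofLp| ≤ (m * m * M) * (‖v‖ * ‖w‖) := by
  have h1 : ∀ i, |(B *ᵥ v.ofLp) i * w i| ≤ m * M * (‖v‖ * ‖w‖) := by
    intro i
    have hs : |(B *ᵥ v.ofLp) i| ≤ m * (M * ‖v‖) := by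
      rw [Matrix.mulVec, dotProduct]
      refine (Finset.abs_sum_le_sum_abs _ _).trans ?_
      refine (Finset.sum_le_card_nsmul _ _ (M * ‖v‖) fun j _ => ?_).trans (by simp)
      rw [abs_mul]
      exact mul_le_mul (hB i j) (PiLp.norm_apply_le v j) (abs_nonneg _)
        ((abs_nonneg _).trans (hB i j))
    rw [abs_mul]
    calc _ ≤ m * (M * ‖v‖) * ‖w‖ :=
          mul_le_mul hs (PiLp.norm_apply_le w i) (abs_nonneg _) ((abs_nonneg _).trans hs)
      _ = _ := by ring
  rw [dotProduct]
  refine (Finset.abs_sum_le_sum_abs _ _).trans ?_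
  refine (Finset.sum_le_card_nsmul _ _ _ fun i _ => h1 i).trans (le_of_eq ?_)
  simp
  ring

theorem IsEllipticCoeff.exists_integrable_bound {α β : ℝ}
    {A : EuclideanSpace ℝ (Fin N) → Matrix (Fin m) (Fin m) ℝ} (hA : IsEllipticCoeff Ω α β A) :
    ∃ K : ℝ, ∀ V W : Lp (EuclideanSpace ℝ (Fin m)) 2 (volume.restrict Ω),
      Integrable (fun x => (A x *ᵥ (V x).ofLp) ⬝ᵥ (W x).ofLp) (volume.restrict Ω) ∧
      ‖∫ x in Ω, (A x *ᵥ (V x).ofLp) ⬝ᵥ (W x).ofLp‖ ≤ K * ‖V‖ * ‖W‖ := by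
  obtain ⟨M, hM⟩ := hA.bounded
  refine ⟨m * m * |M|, fun V W => ?_⟩
  have hle : ∫⁻ x in Ω, ‖(A x *ᵥ (V x).ofLp) ⬝ᵥ (W x).ofLp‖ₑ ≤
      ENNReal.ofReal (m * m * |M| * ‖V‖ * ‖W‖) := by
    calc _ ≤ ∫⁻ x in Ω, ENNReal.ofReal (m * m * |M|) * (‖V x‖ₑ * ‖W x‖ₑ) := by
          refine lintegral_mono_ae ?_
          filter_upwards [hM] with x hx
          rw [Real.enorm_eq_ofReal_abs, ← ofReal_norm, ← ofReal_norm,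
            ← ENNReal.ofReal_mul (norm_nonneg _), ← ENNReal.ofReal_mul (by positivity)]
          exact ENNReal.ofReal_le_ofReal
            (abs_mulVec_dotProduct_le (fun i j => (hx i j).trans (le_abs_self M)) _ _)
      _ ≤ ENNReal.ofReal (m * m * |M|) * (eLpNorm V 2 (volume.restrict Ω) *
            eLpNorm W 2 (volume.restrict Ω)) := by
          rw [lintegral_const_mul' _ _ ENNReal.ofReal_ne_top]
          gcongr
          exact lintegral_enorm_mul_enorm_le (Lp.aestronglyMeasurable V) (Lp.aestronglyMeasurable W)
      _ = _ := by
          rw [← Lp.enorm_def, ← Lp.enorm_def, ← ofReal_norm, ← ofReal_norm, mul_assoc _ ‖V‖,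
            ENNReal.ofReal_mul (p := m * m * |M|) (by positivity), ENNReal.ofReal_mul (norm_nonneg V)]
  refine ⟨⟨hA.aestronglyMeasurable (Lp.aestronglyMeasurable V) (Lp.aestronglyMeasurable W),
    hle.trans_lt ENNReal.ofReal_lt_top⟩, ?_⟩
  refine (norm_integral_le_lintegral_norm _).trans ?_
  refine ENNReal.toReal_le_of_le_ofReal (by positivity) ?_
  simpa only [ofReal_norm] using hle

theorem IsEllipticCoeff.exists_bilin {α β : ℝ}
    {A : EuclideanSpace ℝ (Fin N) → Matrix (Fin m) (Fin m) ℝ} (hA : IsEllipticCoeff Ω α β A) :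
    ∃ b : Lp (EuclideanSpace ℝ (Fin m)) 2 (volume.restrict Ω) →L[ℝ]
        Lp (EuclideanSpace ℝ (Fin m)) 2 (volume.restrict Ω) →L[ℝ] ℝ,
      ∀ V W, b V W = ∫ x in Ω, (A x *ᵥ (V x).ofLp) ⬝ᵥ (W x).ofLp := by
  obtain ⟨K, hK⟩ := hA.exists_integrable_bound
  refine ⟨LinearMap.mkContinuous₂ (LinearMap.mk₂ ℝ
    (fun V W => ∫ x in Ω, (A x *ᵥ (V x).ofLp) ⬝ᵥ (W x).ofLp) ?_ ?_ ?_ ?_) K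
    fun V W => (hK V W).2, fun V W => rfl⟩
  · intro V V' W
    rw [← integral_add (hK V W).1 (hK V' W).1]
    refine integral_congr_ae ?_
    filter_upwards [Lp.coeFn_add V V'] with x hx
    rw [hx, Pi.add_apply, WithLp.ofLp_add, Matrix.mulVec_add, add_dotProduct]
  · intro c V W
    rw [smul_eq_mul, ← integral_const_mul]
    refine integral_congr_ae ?_
    filter_upwards [Lp.coeFn_smul c V] with x hx
    rw [hx, Pi.smul_apply, WithLp.ofLp_smul, Matrix.mulVec_smul, smul_dotProduct, smul_eq_mul]
  · intro V W W'
    rw [← integral_add (hK V W).1 (hK V W').1]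
    refine integral_congr_ae ?_
    filter_upwards [Lp.coeFn_add W W'] with x hx
    rw [hx, Pi.add_apply, WithLp.ofLp_add, dotProduct_add]
  · intro c V W
    rw [smul_eq_mul, ← integral_const_mul]
    refine integral_congr_ae ?_
    filter_upwards [Lp.coeFn_smul c W] with x hx
    rw [hx, Pi.smul_apply, WithLp.ofLp_smul, dotProduct_smul, smul_eq_mul]

theorem IsEllipticCoeff.le_integral {α β : ℝ}
    {A : EuclideanSpace ℝ (Fin N) → Matrix (Fin m) (Fin m) ℝ} (hA : IsEllipticCoeff Ω α β A)
    (V : Lp (EuclideanSpace ℝ (Fin m)) 2 (volume.restrict Ω)) :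
    α * ‖V‖ ^ 2 ≤ ∫ x in Ω, (A x *ᵥ (V x).ofLp) ⬝ᵥ (V x).ofLp := by
  obtain ⟨K, hK⟩ := hA.exists_integrable_bound
  have hV : ‖V‖ ^ 2 = ∫ x in Ω, ‖V x‖ ^ 2 := by
    rw [← real_inner_self_eq_norm_sq, L2.inner_def]
    simp only [real_inner_self_eq_norm_sq]
  rw [hV, ← integral_const_mul]
  refine integral_mono_ae (((Lp.memLp V).integrable_norm_pow two_ne_zero).const_mul α) (hK V V).1 ?_
  filter_upwards [hA.elliptic] with x hx
  have h1 := (hx (V x).ofLp).1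
  rwa [dotProduct_self_eq_norm_sq] at h1

set_option maxHeartbeats 1000000 in
/-- The Lax-Milgram theorem in `W_0^{1,2}(Ω, X)`. -/
theorem XAdmissible.exists_isWeakSolution (hX : XAdmissible X Ω Q) (hN : 0 < N) {α β : ℝ}
    (hα : 0 < α) {A : EuclideanSpace ℝ (Fin N) → Matrix (Fin m) (Fin m) ℝ}
    (hA : IsEllipticCoeff Ω α β A) {f : EuclideanSpace ℝ (Fin N) → ℝ}
    (hf : AEStronglyMeasurable f (volume.restrict Ω)) {K : ℝ≥0∞} (hK : K ≠ ∞)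
    (hfK : ∀ v Z, HasXGradW0 X Ω 2 v Z →
      ∫⁻ x in Ω, ‖f x * v x‖ₑ ≤ K * eLpNorm Z 2 (volume.restrict Ω)) :
    ∃ u, IsWeakSolution X Ω A f u := by
  obtain ⟨C, hC, hP⟩ := hX.exists_poincare_W0 hN
  obtain ⟨b, hb⟩ := hA.exists_bilin
  set H := graphW0 X Ω with hH
  have hmem : ∀ p : H, HasXGradW0 X Ω 2 p.1.fst p.1.snd := fun p =>
    (mem_graphW0_iff hX.continuous).1 p.2
  have : CompleteSpace H := Submodule.topologicalClosure.completeSpace _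
  let S : H →L[ℝ] Lp (EuclideanSpace ℝ (Fin m)) 2 (volume.restrict Ω) :=
    (WithLp.sndL 2 ℝ _ _).comp H.subtypeL
  have hS : ∀ p : H, S p = p.1.snd := fun p => rfl
  let B : H →L[ℝ] H →L[ℝ] ℝ := b.bilinearComp S S
  have hB : ∀ p q : H, B p q = ∫ x in Ω, (A x *ᵥ (p.1.snd x).ofLp) ⬝ᵥ (q.1.snd x).ofLp :=
    fun p q => hb _ _
  have hcoer : IsCoercive B := by
    -- By Poincaré the squared norm of a pair is at most (C^2 + 1) times that of its gradient
    -- component, the only one that the form sees.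
    refine ⟨α / (C ^ 2 + 1), by positivity, fun p => ?_⟩
    have h1 := hA.le_integral p.1.snd
    have h2 := hP _ _ (hmem p)
    rw [← Lp.enorm_def, ← Lp.enorm_def, ← ofReal_norm, ← ofReal_norm,
      ← ENNReal.ofReal_mul hC.le, ENNReal.ofReal_le_ofReal_iff (by positivity)] at h2
    have h3 : ‖p‖ ^ 2 ≤ (C ^ 2 + 1) * ‖p.1.snd‖ ^ 2 := by
      rw [show ‖p‖ = ‖p.1‖ from rfl, WithLp.prod_norm_sq_eq_of_L2]
      nlinarith [pow_le_pow_left₀ (norm_nonneg _) h2 2]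
    rw [hB]
    refine le_trans ?_ h1
    rw [mul_assoc, ← pow_two, div_mul_eq_mul_div, div_le_iff₀ (by positivity), mul_assoc]
    exact mul_le_mul_of_nonneg_left (by linarith) hα.le
  have hint : ∀ v Z, HasXGradW0 X Ω 2 v Z →
      Integrable (fun x => f x * v x) (volume.restrict Ω) := fun v Z hv =>
    ⟨hf.mul hv.1.aestronglyMeasurable, (hfK v Z hv).trans_lt
      (ENNReal.mul_lt_top hK.lt_top hv.2.1.eLpNorm_lt_top)⟩
  let l : H →ₗ[ℝ] ℝ :=
    { toFun := fun p => ∫ x in Ω, f x * p.1.fst x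
      map_add' := fun p q => by
        rw [← integral_add (hint _ _ (hmem p)) (hint _ _ (hmem q))]
        refine integral_congr_ae ?_
        filter_upwards [Lp.coeFn_add p.1.fst q.1.fst] with x hx
        rw [Submodule.coe_add, WithLp.add_fst, hx, Pi.add_apply, mul_add]
      map_smul' := fun c p => by
        rw [RingHom.id_apply, smul_eq_mul, ← integral_const_mul]
        refine integral_congr_ae ?_
        filter_upwards [Lp.coeFn_smul c p.1.fst] with x hx
        rw [Submodule.coe_smul, WithLp.smul_fst, hx, Pi.smul_apply, smul_eq_mul, mul_left_comm] }
  have hl : ∀ p, ‖l p‖ ≤ K.toReal * ‖p‖ := fun p => by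
    have h1 : ‖l p‖ ≤ K.toReal * ‖p.1.snd‖ := by
      refine (norm_integral_le_lintegral_norm _).trans ?_
      refine ENNReal.toReal_le_of_le_ofReal (by positivity) ?_
      simp only [ofReal_norm]
      refine (hfK _ _ (hmem p)).trans (le_of_eq ?_)
      rw [← Lp.enorm_def, ← ofReal_norm, ENNReal.ofReal_mul ENNReal.toReal_nonneg,
        ENNReal.ofReal_toReal hK]
    exact h1.trans (mul_le_mul_of_nonneg_left (WithLp.norm_snd_le _ p.1) ENNReal.toReal_nonneg)
  set w : H := hcoer.continuousLinearEquivOfBilin.symm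
    ((InnerProductSpace.toDual ℝ H).symm (l.mkContinuous _ hl)) with hw
  have hsol : ∀ q : H, B w q = l q := fun q => by
    rw [← hcoer.continuousLinearEquivOfBilin_apply, hw, ContinuousLinearEquiv.apply_symm_apply,
      InnerProductSpace.toDual_symm_apply]
    rfl
  refine ⟨w.1.fst, w.1.snd, hmem w, fun v Z hv => ?_⟩
  have hv1 := hv.1.coeFn_toLp
  have hv2 := hv.2.1.coeFn_toLp
  have hq : WithLp.toLp 2 (hv.1.toLp v, hv.2.1.toLp Z) ∈ H :=
    (mem_graphW0_iff hX.continuous).2 (hv.congr_ae hv1.symm hv2.symm)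
  have h1 := hsol ⟨_, hq⟩
  rw [hB] at h1
  refine (integral_congr_ae ?_).trans (h1.trans (integral_congr_ae ?_))
  · filter_upwards [hv2] with x hx
    simp only [WithLp.toLp_snd]
    rw [hx]
  · filter_upwards [hv1] with x hx
    simp only [WithLp.toLp_fst]
    rw [hx]

end GraphSpace

/-! ### Solvability for data in L^{Q/2,1} by duality -/

section Existence

variable {N m : ℕ} {X : Fin m → EuclideanSpace ℝ (Fin N) → EuclideanSpace ℝ (Fin N)}
  {Ω : Set (EuclideanSpace ℝ (Fin N))} {Q : ℝ}

theorem isEllipticCoeff_one : IsEllipticCoeff Ω 1 2 (fun _ => (1 : Matrix (Fin m) (Fin m) ℝ)) where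
  measurable i j := aemeasurable_const
  bounded := ⟨1, ae_of_all _ fun x i j => by
    rw [Matrix.one_apply]; split_ifs <;> simp⟩
  elliptic := ae_of_all _ fun x η => by
    have : 0 ≤ η ⬝ᵥ η := Finset.sum_nonneg fun i _ => mul_self_nonneg _
    rw [Matrix.one_mulVec]
    constructor <;> linarith

/-- For bounded data Poincaré alone suffices, so the truncated problems in the duality argument are
solvable without circularity. -/
theorem XAdmissible.exists_lintegral_bdd_mul_le (hX : XAdmissible X Ω Q) (hN : 0 < N) {c : ℝ}
    {g : EuclideanSpace ℝ (Fin N) → ℝ} (hg : ∀ x, |g x| ≤ c) :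
    ∃ K ≠ ∞, ∀ v Z, HasXGradW0 X Ω 2 v Z →
      ∫⁻ x in Ω, ‖g x * v x‖ₑ ≤ K * eLpNorm Z 2 (volume.restrict Ω) := by
  obtain ⟨C, -, hP⟩ := hX.exists_poincare_W0 hN
  refine ⟨ENNReal.ofReal c * (ENNReal.ofReal C * volume Ω ^ (1 / 2 : ℝ)), ?_, fun v Z hv => ?_⟩
  · exact ENNReal.mul_ne_top ENNReal.ofReal_ne_top (ENNReal.mul_ne_top ENNReal.ofReal_ne_top
      (ENNReal.rpow_ne_top_of_nonneg (by positivity) hX.volume_lt_top.ne))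
  calc ∫⁻ x in Ω, ‖g x * v x‖ₑ ≤ ∫⁻ x in Ω, ENNReal.ofReal c * ‖v x‖ₑ := by
        refine lintegral_mono fun x => ?_
        rw [enorm_mul, Real.enorm_eq_ofReal_abs]
        gcongr
        exact hg x
    _ ≤ ENNReal.ofReal c * (eLpNorm v 2 (volume.restrict Ω) * volume Ω ^ (1 / 2 : ℝ)) := by
        rw [lintegral_const_mul' _ _ ENNReal.ofReal_ne_top]
        gcongr
        have h := lintegral_enorm_le_eLpNorm_two hv.1.aestronglyMeasurable
        rwa [Measure.restrict_apply_univ] at h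
    _ ≤ ENNReal.ofReal c * ((ENNReal.ofReal C * eLpNorm Z 2 (volume.restrict Ω)) *
          volume Ω ^ (1 / 2 : ℝ)) := by
        gcongr
        exact hP v Z hv
    _ = _ := by ring

theorem mul_div_abs_self_mul (a v : ℝ) : a * (v / |v|) * v = a * |v| := by
  rcases eq_or_ne v 0 with rfl | hv
  · simp
  · rw [mul_assoc, div_mul_eq_mul_div, ← abs_mul_abs_self v,
      mul_div_cancel_right₀ _ (abs_ne_zero.2 hv)]

/-- Duality: the boundedness of the solutions with datum `f` makes `f` a functional on
`W_0^{1,2}(Ω, X)`. -/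
theorem XAdmissible.exists_lintegral_mul_le (hX : XAdmissible X Ω Q) (hN : 0 < N)
    {f : EuclideanSpace ℝ (Fin N) → ℝ} (hf : MemLorentz (volume.restrict Ω) (Q / 2) 1 f) :
    ∃ K ≠ ∞, ∀ v Z, HasXGradW0 X Ω 2 v Z →
      ∫⁻ x in Ω, ‖f x * v x‖ₑ ≤ K * eLpNorm Z 2 (volume.restrict Ω) := by
  obtain ⟨C, hC, hbd⟩ := hX.exists_linfty_bound hN
  have : IsFiniteMeasure (volume.restrict Ω) :=
    isFiniteMeasure_restrict.2 hX.volume_lt_top.ne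
  have hfi := hf.integrable hX.two_lt
  set B := C * (eLorentzNorm (volume.restrict Ω) (Q / 2) 1 f).toReal with hB
  refine ⟨ENNReal.ofReal (B * ∫ x in Ω, |f x|) ^ (1 / 2 : ℝ),
    ENNReal.rpow_ne_top_of_nonneg (by norm_num) ENNReal.ofReal_ne_top, fun v Z hv => ?_⟩
  have hvm := hv.1.aestronglyMeasurable.aemeasurable
  have hmain : ∀ n : ℕ, ∫⁻ x in Ω, ENNReal.ofReal (min |f x| n * |v x|) ≤
      ENNReal.ofReal (B * ∫ x in Ω, |f x|) ^ (1 / 2 : ℝ) * eLpNorm Z 2 (volume.restrict Ω) := by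
    intro n
    -- The quotient is the sign of v, with value 0 where v = 0, so that g v = min(|f|, n) |v|.
    -- Truncation at n makes the problem with datum g solvable, and |g| ≤ |f| makes the bound on its
    -- solution w independent of n.
    set g : EuclideanSpace ℝ (Fin N) → ℝ := fun x => min |f x| n * (v x / |v x|) with hg
    have hmin0 : ∀ x, 0 ≤ min |f x| (n : ℝ) := fun x => le_min (abs_nonneg _) n.cast_nonneg
    have hgmin : ∀ x, |g x| ≤ min |f x| n := fun x => by
      rw [hg, abs_mul, abs_of_nonneg (hmin0 x), abs_div, abs_abs]
      exact mul_le_of_le_one_right (hmin0 x) (div_self_le_one _)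
    have hgm : AEMeasurable g (volume.restrict Ω) :=
      ((continuous_abs.measurable.comp_aemeasurable hf.1).min aemeasurable_const).mul
        (hvm.div (continuous_abs.measurable.comp_aemeasurable hvm))
    have hgf : ∀ x, ‖g x‖ₑ ≤ ‖f x‖ₑ := fun x => by
      rw [Real.enorm_eq_ofReal_abs, Real.enorm_eq_ofReal_abs]
      exact ENNReal.ofReal_le_ofReal ((hgmin x).trans (min_le_left _ _))
    obtain ⟨K, hK, hgK⟩ := hX.exists_lintegral_bdd_mul_le hN
      (fun x => (hgmin x).trans (min_le_right _ _))
    obtain ⟨w, hw⟩ := hX.exists_isWeakSolution hN one_pos isEllipticCoeff_one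
      hgm.aestronglyMeasurable hK hgK
    have hgL := eLorentzNorm_one_mono (ae_of_all (volume.restrict Ω) hgf) (Q / 2)
    have hwB : ∀ᵐ x ∂(volume.restrict Ω), |w x| ≤ B := by
      filter_upwards [hbd 1 2 one_pos _ isEllipticCoeff_one g w ⟨hgm, hgL.trans_lt hf.2⟩ hw]
        with x hx
      rw [Real.norm_eq_abs, div_one] at hx
      exact hx.trans (mul_le_mul_of_nonneg_left (ENNReal.toReal_mono hf.2.ne hgL) hC.le)
    obtain ⟨W, hW, heq⟩ := hw
    simp only [Matrix.one_mulVec] at heq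
    -- Testing the equation of w with w itself gives ∫ |W|^2 = ∫ g w ≤ B ∫ |f|. Testing it with v
    -- then bounds ∫ g v by the L^2 norms of W and Z.
    have hW2 : eLpNorm W 2 (volume.restrict Ω) ≤
        ENNReal.ofReal (B * ∫ x in Ω, |f x|) ^ (1 / 2 : ℝ) := by
      have h1 := heq w W hW
      simp only [dotProduct_self_eq_norm_sq] at h1
      have h2 : eLpNorm W 2 (volume.restrict Ω) ^ 2 = ENNReal.ofReal (∫ x in Ω, ‖W x‖ ^ 2) := by
        rw [eLpNorm_two_sq, ofReal_integral_eq_lintegral_ofReal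
          (hW.2.1.integrable_norm_pow two_ne_zero) (ae_of_all _ fun x => by positivity)]
        refine lintegral_congr fun x => ?_
        rw [ENNReal.ofReal_pow (norm_nonneg _), ofReal_norm]
      have h3 : ∫ x in Ω, g x * w x ≤ B * ∫ x in Ω, |f x| := by
        rw [← integral_const_mul]
        refine integral_mono_ae ⟨hgm.aestronglyMeasurable.mul hW.1.aestronglyMeasurable,
          (hgK w W hW).trans_lt (ENNReal.mul_lt_top hK.lt_top hW.2.1.eLpNorm_lt_top)⟩
          (hfi.abs.const_mul B) ?_
        filter_upwards [hwB] with x hx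
        calc g x * w x ≤ |g x| * |w x| := by rw [← abs_mul]; exact le_abs_self _
          _ ≤ |f x| * B := mul_le_mul ((hgmin x).trans (min_le_left _ _)) hx (abs_nonneg _)
              (abs_nonneg _)
          _ = B * |f x| := mul_comm _ _
      calc eLpNorm W 2 (volume.restrict Ω) =
            (eLpNorm W 2 (volume.restrict Ω) ^ 2) ^ (1 / 2 : ℝ) := by
            rw [← ENNReal.rpow_natCast, ← ENNReal.rpow_mul]; norm_num
        _ ≤ _ := by
            rw [h2, h1]
            gcongr
    have hgv : ∀ x, g x * v x = min |f x| n * |v x| := fun x => mul_div_abs_self_mul _ _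
    have hgvi : Integrable (fun x => g x * v x) (volume.restrict Ω) :=
      ⟨hgm.aestronglyMeasurable.mul hv.1.aestronglyMeasurable,
        (hgK v Z hv).trans_lt (ENNReal.mul_lt_top hK.lt_top hv.2.1.eLpNorm_lt_top)⟩
    calc ∫⁻ x in Ω, ENNReal.ofReal (min |f x| n * |v x|) = ENNReal.ofReal (∫ x in Ω, g x * v x) := by
          rw [ofReal_integral_eq_lintegral_ofReal hgvi (ae_of_all _ fun x => by
            change 0 ≤ g x * v x
            rw [hgv]; exact mul_nonneg (hmin0 x) (abs_nonneg _))]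
          simp only [hgv]
      _ = ENNReal.ofReal (∫ x in Ω, (W x).ofLp ⬝ᵥ (Z x).ofLp) := by rw [heq v Z hv]
      _ ≤ ∫⁻ x in Ω, ‖W x‖ₑ * ‖Z x‖ₑ := by
          refine (ENNReal.ofReal_le_ofReal ((Real.le_norm_self _).trans
            (norm_integral_le_lintegral_norm _))).trans (ENNReal.ofReal_toReal_le.trans ?_)
          refine lintegral_mono fun x => ?_
          rw [← ofReal_norm, ← ofReal_norm, ← ENNReal.ofReal_mul (norm_nonneg _)]
          refine ENNReal.ofReal_le_ofReal ?_
          have h := norm_inner_le_norm (𝕜 := ℝ) (W x) (Z x)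
          rwa [EuclideanSpace.inner_eq_star_dotProduct, star_trivial, dotProduct_comm] at h
      _ ≤ eLpNorm W 2 (volume.restrict Ω) * eLpNorm Z 2 (volume.restrict Ω) :=
          lintegral_enorm_mul_enorm_le hW.2.1.aestronglyMeasurable hv.2.1.aestronglyMeasurable
      _ ≤ _ := by gcongr
  -- The bound does not depend on n, so monotone convergence removes the truncation.
  have hlim := lintegral_tendsto_of_tendsto_of_monotone (μ := volume.restrict Ω)
    (f := fun (n : ℕ) x => ENNReal.ofReal (min |f x| n * |v x|)) (F := fun x => ‖f x * v x‖ₑ)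
    (fun n => (((continuous_abs.measurable.comp_aemeasurable hf.1).min aemeasurable_const).mul
      (continuous_abs.measurable.comp_aemeasurable hvm)).ennreal_ofReal)
    (ae_of_all _ fun x a b hab => by
      have : (a : ℝ) ≤ b := by exact_mod_cast hab
      dsimp only
      gcongr)
    (ae_of_all _ fun x => by
      obtain ⟨k, hk⟩ := exists_nat_ge |f x|
      refine tendsto_const_nhds.congr' ?_
      filter_upwards [eventually_ge_atTop k] with n hn
      have : (k : ℝ) ≤ n := by exact_mod_cast hn
      rw [min_eq_left (hk.trans this), ← abs_mul, Real.enorm_eq_ofReal_abs])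
  exact le_of_tendsto' hlim hmain

end Existence

/-! ### Existence and the L^∞ estimate combined -/

theorem theorem5p3 {N m : ℕ} (hN : 2 ≤ N)
    (X : Fin m → EuclideanSpace ℝ (Fin N) → EuclideanSpace ℝ (Fin N))
    (Ω : Set (EuclideanSpace ℝ (Fin N))) (Q : ℝ) (hX : XAdmissible X Ω Q) :
    ∃ C : ℝ, 0 < C ∧ ∀ α β : ℝ, 0 < α → α < β →
      ∀ A : EuclideanSpace ℝ (Fin N) → Matrix (Fin m) (Fin m) ℝ, IsEllipticCoeff Ω α β A →
      ∀ f : EuclideanSpace ℝ (Fin N) → ℝ, MemLorentz (volume.restrict Ω) (Q / 2) 1 f →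
        (∃ u, IsWeakSolution X Ω A f u) ∧
        ∀ u, IsWeakSolution X Ω A f u →
          MemLp u ∞ (volume.restrict Ω) ∧
          eLpNorm u ∞ (volume.restrict Ω) ≤
            ENNReal.ofReal (C / α) * eLorentzNorm (volume.restrict Ω) (Q / 2) 1 f := by
  have hN0 : 0 < N := by omega
  obtain ⟨C, hC, hbd⟩ := hX.exists_linfty_bound hN0
  refine ⟨C, hC, fun α β hα _ A hA f hf => ⟨?_, fun u hu => ?_⟩⟩
  · obtain ⟨K, hK, hfK⟩ := hX.exists_lintegral_mul_le hN0 hf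
    exact hX.exists_isWeakSolution hN0 hα hA hf.1.aestronglyMeasurable hK hfK
  · have hb := hbd α β hα A hA f u hf hu
    obtain ⟨V, hV, -⟩ := hu
    refine ⟨memLp_top_of_bound hV.1.aestronglyMeasurable _ hb, ?_⟩
    rw [eLpNorm_exponent_top]
    refine (eLpNormEssSup_le_of_ae_bound hb).trans (le_of_eq ?_)
    rw [ENNReal.ofReal_mul (by positivity), ENNReal.ofReal_toReal hf.2.ne]
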